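/- Let $K$ be a number field of degree $d$ with ring of integers $\mathcal O$, let $\mathfrak m$ be a non-zero ideal of $\mathcal O$, put $N=\lvert\mathcal O/\mathfrak m\rvert$ and $$p_{\mathfrak m}=\frac{\lvert(\mathcal O/\mathfrak m)^\times\rvert}{\lvert\mathcal O/\mathfrak m\rvert}.$$ For $\bar a\in\mathcal O/\mathfrak m$ put $\varphi(\bar a)=\lvert\mathcal O/((a)+\mathfrak m)\rvert$. **Basic operations.** Let $R$ be a commutative ring with a Euclidean function $\varphi$, and $a,b\in R$. The basic operations in $R$ are: - (B1) return $a+b$, $a-b$ or $a\cdot b$; - (B2) if $b$ divides $a$, return some $c$ with $bc=a$; - (B3) if $b\ne0$, return $(q,r)$ with $a=qb+r$ and ($r=0$ or $\varphi(r)<\varphi(b)$); - (B4) return $(g,s,t,u,v)$ with $(g)=(a,b)$, $g=sa+tb$, $ua+vb=0$ and $sv-ut=1$; - (B5) return $c$ with $(c)=\{r\in R: ra=0\}$. For $R=\mathcal O/\mathfrak m$ there is the additional operation - (B6) given an ideal $\mathfrak a$ of $\mathcal O$, return $\bar c\in\mathcal O/\mathfrak m$ with $(\bar c)=(\mathfrak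 a+\mathfrak m)/\mathfrak m$. **Representation of the data.** We are given a $\mathbb Z$-basis $\omega_1,\dots,\omega_d$ of $\mathcal O$ and integers $n_i\ge1$ such that $n_1\omega_1,\dots,n_d\omega_d$ is a $\mathbb Z$-basis of $\mathfrak m$, together with $N$ and the structure constants $\Gamma_{i,j}^k\in\mathbb Z$ defined by $\omega_i\omega_j=\sum_k\Gamma_{i,j}^k\omega_k$. An element $\overline{\sum_i a_i\omega_i}$ of $\mathcal O/\mathfrak m$ is represented by $(a_i \bmod n_i)_i\in\prod_i\mathbb Z/n_i\mathbb Z$. The ideal in (B6) is given by the coordinates with respect to $(\omega_i)$ of $d$ elements that generate it as an abelian group (for instance, of a $\mathbb Z$-basis). **Model of computation.** A program is a finite text in an imperative language that works on data cells holding integers. It may - carry out the basic operations (B1)–(B5) in $\mathbb Z/k\mathbb Z$ for $1\le k\le N$, where the Euclidean function of $\mathbb Z/k\mathbb Z$ is $a\mapsto\gcd(a,k)$, each of which counts as one basic operation in $\mathbb Z/N\mathbb Z$; - call an oracle for uniformly distributed random elements of $\mathbb Z/k\mathbb Z$, $k\geq 1$; - write integer constants, copy cells, and test a cell for zero; - use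 loops and index variables, whose values are not obtained from data cells. The results of (B2)–(B5) in $\mathbb Z/k\mathbb Z$ are not unique; a program has to work with every fixed choice of results that meets the specifications. **Theorem.** There are an absolute constant $C$ and, for each of the basic operations (addition, subtraction, multiplication, (B2), (B3), (B4), (B5), (B6)), one program, independent of $K$, $d$, $\mathfrak m$ and the bases, such that for all $K$, $\mathfrak m$, $(\omega_i)$, $(n_i)$ as above and all admissible operands the program ends with probability $1$, always returns a correct result of that operation in $\mathcal O/\mathfrak m$ when it ends, and uses an expected number of at most $$C\cdot\frac1{p_{\mathfrak m}}\cdot d^3$$ basic operations in $\mathbb Z/N\mathbb Z$. This bound holds even if every other elementary step (oracle call, copy, constant, test, index assignment, pass through a loop) is counted like a basic operation. -/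

import Mathlib

open scoped NumberField ENNReal

/-! ### The basic operations of a Euclidean ring, as input/output specifications -/

section Specifications

variable {R : Type*} [CommRing R]

/-- Specification of division: `c = div(a, b)` (asked for only if `b` divides `a`). -/
def IsDivResult (a b c : R) : Prop := b * c = a

/-- Specification of Euclidean division `(q, r) = eudiv(a, b)` for the Euclidean function `φ`
(asked for only if `b ≠ 0`). -/
def IsEudivResult (φ : R → ℕ) (a b q r : R) : Prop :=
  a = q * b + r ∧ (r = 0 ∨ φ r < φ b)

/-- Specification of `(g, s, t, u, v) = xgcd(a, b)`: `g` generates the ideal `(a, b)` and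
`(g 0) = (a b) * !![s, u; t, v]` with a transformation matrix of determinant one. -/
def IsXgcdResult (a b g s t u v : R) : Prop :=
  Ideal.span {g} = Ideal.span {a, b} ∧ g = s * a + t * b ∧ u * a + v * b = 0 ∧
    s * v - u * t = 1

/-- Specification of `c = Ann(a)`: the ideal generated by `c` is `{r | r * a = 0}`. -/
def IsAnnResult (a c : R) : Prop :=
  ∀ r : R, r ∈ Ideal.span {c} ↔ r * a = 0

end Specifications

/-- The Euclidean function of `ℤ/kℤ`: `gcd(a, k)`. -/
def zmodNorm (k : ℕ) (a : ZMod k) : ℕ := Nat.gcd a.val k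

/-- A way of carrying out the operations div, eudiv, xgcd and Ann in `ℤ/kℤ`. Their results are
not unique: programs have to work with every choice of results that meets the specifications.
Outside the preconditions the result is an unspecified element. -/
structure BasicOps (k : ℕ) where
  div : ZMod k → ZMod k → ZMod k
  div_spec : ∀ a b, b ∣ a → IsDivResult a b (div a b)
  quo : ZMod k → ZMod k → ZMod k
  rem : ZMod k → ZMod k → ZMod k
  eudiv_spec : ∀ a b, b ≠ 0 → IsEudivResult (zmodNorm k) a b (quo a b) (rem a b)
  xgcd : ZMod k → ZMod k → Fin 5 → ZMod k
  xgcd_spec : ∀ a b, IsXgcdResult a b (xgcd a b 0) (xgcd a b 1) (xgcd a b 2) (xgcd a b 3)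
    (xgcd a b 4)
  ann : ZMod k → ZMod k
  ann_spec : ∀ a, IsAnnResult a (ann a)

/-! ### Programs

Programs are finite texts of a small imperative language. Data cells hold integers and are
addressed by an array name and a list of natural-number indices. Index variables hold natural
numbers and are used for addressing and for loop counters only; no data value can be moved into
an index variable, and the only way in which data influence the control flow is a zero test. -/

/-- Names of arrays: the input describing the ring (the number `N`, the numbers `n i`, the
structure constants), the operands, the results, and work space. -/
inductive Arr where
  | modulus
  | diag
  | struct
  | input
  | output
  | work (t : ℕ)
  deriving DecidableEq

/-- Index expressions. -/
inductive Ix where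
  | lit (c : ℕ)
  | var (i : ℕ)
  | add (e₁ e₂ : Ix)
  | sub (e₁ e₂ : Ix)

/-- A reference to a data cell. -/
structure Ref where
  arr : Arr
  idx : List Ix

/-- Elementary instructions. In each of the basic operations, the first argument `k` refers to the
cell that holds the modulus, then come the cells for the results, then those of the operands. -/
inductive Instr where
  | const (x : Ref) (z : ℤ)
  | copy (x a : Ref)
  | add (k x a b : Ref)
  | sub (k x a b : Ref)
  | mul (k x a b : Ref)
  | div (k x a b : Ref)
  | eudiv (k q r a b : Ref)
  | xgcd (k g s t u v a b : Ref)
  | ann (k x a : Ref)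
  /-- a uniformly distributed random element of `ℤ/kℤ` -/
  | rand (k x : Ref)
  /-- assignment to the index variable `i` -/
  | setIx (i : ℕ) (e : Ix)

/-- Programs. -/
inductive Cmd where
  | skip
  | prim (I : Instr)
  | seq (c₁ c₂ : Cmd)
  /-- branch on whether the data cell `x` contains zero -/
  | ifZero (x : Ref) (c₁ c₂ : Cmd)
  /-- branch on a comparison of index expressions -/
  | ifLt (e₁ e₂ : Ix) (c₁ c₂ : Cmd)
  /-- run `c` with the index variable `i` set to `0, 1, …, e - 1` in turn -/
  | for (i : ℕ) (e : Ix) (c : Cmd)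
  /-- as long as the data cell `x` is not zero, run `c` -/
  | while (x : Ref) (c : Cmd)

/-- The memory of the machine. -/
structure Store where
  ix : ℕ → ℕ
  mem : Arr → List ℕ → ℤ

def Ix.eval (s : Store) : Ix → ℕ
  | .lit c => c
  | .var i => s.ix i
  | .add e₁ e₂ => e₁.eval s + e₂.eval s
  | .sub e₁ e₂ => e₁.eval s - e₂.eval s

namespace Store

def setIx (s : Store) (i v : ℕ) : Store :=
  { s with ix := Function.update s.ix i v }

def read (s : Store) (x : Ref) : ℤ := s.mem x.arr (x.idx.map (Ix.eval s))

def write (s : Store) (x : Ref) (z : ℤ) : Store :=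
  { s with mem := fun A l => if A = x.arr ∧ l = x.idx.map (Ix.eval s) then z else s.mem A l }

/-- The content of a cell as an element of `ℤ/kℤ`. -/
def residue (s : Store) (k : ℕ) (x : Ref) : ZMod k := (s.read x : ZMod k)

/-- Store a residue class modulo `k ≥ 1` as its representative in `{0, …, k - 1}`. -/
def writeResidue (s : Store) {k : ℕ} (x : Ref) (z : ZMod k) : Store := s.write x (z.val : ℤ)

/-- Run `f` with the modulus found in the cell `k`, which has to be in `{1, …, N}`; any other
modulus is an error. -/
def withModulus (s : Store) (N : ℕ) (k : Ref) (f : ℕ → Store) : Option Store :=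
  if 1 ≤ s.read k ∧ s.read k ≤ N then some (f (s.read k).toNat) else none

end Store

/-! ### Semantics and cost -/

/-- The effect of an elementary instruction, as a probability distribution; `none` is an error. -/
noncomputable def Instr.exec (N : ℕ) (ops : (k : ℕ) → BasicOps k) (s : Store) :
    Instr → PMF (Option Store)
  | .const x z => PMF.pure (some (s.write x z))
  | .copy x a => PMF.pure (some (s.write x (s.read a)))
  | .add k x a b => PMF.pure <| s.withModulus N k fun m =>
      s.writeResidue x (s.residue m a + s.residue m b)
  | .sub k x a b => PMF.pure <| s.withModulus N k fun m =>
      s.writeResidue x (s.residue m a - s.residue m b)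
  | .mul k x a b => PMF.pure <| s.withModulus N k fun m =>
      s.writeResidue x (s.residue m a * s.residue m b)
  | .div k x a b => PMF.pure <| s.withModulus N k fun m =>
      s.writeResidue x ((ops m).div (s.residue m a) (s.residue m b))
  | .eudiv k q r a b => PMF.pure <| s.withModulus N k fun m =>
      (s.writeResidue q ((ops m).quo (s.residue m a) (s.residue m b))).writeResidue r
        ((ops m).rem (s.residue m a) (s.residue m b))
  | .xgcd k g x₁ x₂ x₃ x₄ a b => PMF.pure <| s.withModulus N k fun m =>
      let w := (ops m).xgcd (s.residue m a) (s.residue m b)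
      ((((s.writeResidue g (w 0)).writeResidue x₁ (w 1)).writeResidue x₂ (w 2)).writeResidue
        x₃ (w 3)).writeResidue x₄ (w 4)
  | .ann k x a => PMF.pure <| s.withModulus N k fun m =>
      s.writeResidue x ((ops m).ann (s.residue m a))
  | .rand k x =>
      if h : (Finset.range (s.read k).toNat).Nonempty then
        (PMF.uniformOfFinset (Finset.range (s.read k).toNat) h).map
          fun v : ℕ => some (s.write x ((v : ℕ) : ℤ))
      else PMF.pure none
  | .setIx i e => PMF.pure (some (s.setIx i (e.eval s)))

/-- The distribution of the outcome of a run: the final memory (`none` if the run was aborted),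
together with the cost of the run so far. -/
abbrev Outcome := PMF (Option Store × ℕ)

namespace Outcome

noncomputable def done (s : Store) : Outcome := PMF.pure (some s, 0)

noncomputable def aborted : Outcome := PMF.pure (none, 0)

/-- Charge one unit of cost. -/
noncomputable def tick (o : Outcome) : Outcome := PMF.map (fun r => (r.1, r.2 + 1)) o

/-- Continue with `f`, adding up the costs. -/
noncomputable def andThen (o : Outcome) (f : Store → Outcome) : Outcome :=
  PMF.bind o fun r =>
    match r with
    | (none, n) => PMF.pure (none, n)
    | (some s, n) => PMF.map (fun r' => (r'.1, n + r'.2)) (f s)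

noncomputable def forLoop (body : Store → Outcome) (i : ℕ) : ℕ → Store → Outcome
  | 0, s => done s
  | n + 1, s => (forLoop body i n s).andThen fun s' => tick (body (s'.setIx i n))

/-- The loop `while x ≠ 0`, aborted when `fuel` tests do not suffice. -/
noncomputable def whileLoop (body : Store → Outcome) (x : Ref) : ℕ → Store → Outcome
  | 0, _ => aborted
  | fuel + 1, s =>
      tick (if s.read x = 0 then done s else (body s).andThen (whileLoop body x fuel))

end Outcome

/-- The outcome of a program when every while loop is aborted after `fuel` tests. Every elementary
instruction (each basic operation in `ℤ/kℤ` with `1 ≤ k ≤ N`, but also each copy, each call of the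
random oracle, and each index assignment), every test and every pass through a loop costs one unit. -/
noncomputable def Cmd.exec (N : ℕ) (ops : (k : ℕ) → BasicOps k) (fuel : ℕ) :
    Cmd → Store → Outcome
  | .skip, s => Outcome.done s
  | .prim I, s => PMF.map (fun r => (r, 1)) (I.exec N ops s)
  | .seq c₁ c₂, s => (c₁.exec N ops fuel s).andThen (c₂.exec N ops fuel)
  | .ifZero x c₁ c₂, s =>
      Outcome.tick (if s.read x = 0 then c₁.exec N ops fuel s else c₂.exec N ops fuel s)
  | .ifLt e₁ e₂ c₁ c₂, s =>
      Outcome.tick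
        (if e₁.eval s < e₂.eval s then c₁.exec N ops fuel s else c₂.exec N ops fuel s)
  | .for i e c, s => Outcome.forLoop (c.exec N ops fuel) i (e.eval s) s
  | .while x c, s => Outcome.whileLoop (c.exec N ops fuel) x fuel s

/-- The expected cost of the (untruncated) run of a program. -/
noncomputable def Cmd.expectedCost (N : ℕ) (ops : (k : ℕ) → BasicOps k) (c : Cmd) (s : Store) :
    ℝ≥0∞ :=
  ⨆ fuel, ∑' o, c.exec N ops fuel s o * (o.2 : ℝ≥0∞)

/-- The probability that the (untruncated) run of a program ends without an error. -/
noncomputable def Cmd.haltingProb (N : ℕ) (ops : (k : ℕ) → BasicOps k) (c : Cmd) (s : Store) :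
    ℝ≥0∞ :=
  ⨆ fuel, (c.exec N ops fuel s).toOuterMeasure {o | o.1.isSome}

/-- Las Vegas computation: started in `s`, the program ends with probability one, every final
memory that can occur satisfies `Post`, and the expected cost is at most `B`. -/
structure Cmd.LasVegas (N : ℕ) (ops : (k : ℕ) → BasicOps k) (c : Cmd) (s : Store)
    (Post : Store → Prop) (B : ℝ≥0∞) : Prop where
  halts : c.haltingProb N ops s = 1
  correct : ∀ fuel s' n, (some s', n) ∈ (c.exec N ops fuel s).support → Post s'
  cost : c.expectedCost N ops s ≤ B

/-! ### Residue rings of rings of integers -/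

section ResidueRing

variable {K : Type*} [Field K]

/-- The Euclidean function `φ(ā) = N((a) + 𝔪)` of `𝓞 K ⧸ 𝔪`. -/
noncomputable def residueNorm [NumberField K] (𝔪 : Ideal (𝓞 K)) (x : 𝓞 K ⧸ 𝔪) : ℕ :=
  Ideal.absNorm (Ideal.comap (Ideal.Quotient.mk 𝔪) (Ideal.span {x}))

theorem residueNorm_mk [NumberField K] (𝔪 : Ideal (𝓞 K)) (a : 𝓞 K) :
    residueNorm 𝔪 (Ideal.Quotient.mk 𝔪 a) = Ideal.absNorm (Ideal.span {a} ⊔ 𝔪) := by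
  unfold residueNorm
  rw [← Set.image_singleton, ← Ideal.map_span,
    Ideal.comap_map_of_surjective _ Ideal.Quotient.mk_surjective, ← RingHom.ker_eq_comap_bot,
    Ideal.mk_ker]

/-- The proportion of units in `𝓞 K ⧸ 𝔪`. -/
noncomputable def unitDensity (𝔪 : Ideal (𝓞 K)) : ℝ :=
  (Nat.card (𝓞 K ⧸ 𝔪)ˣ : ℝ) / (Nat.card (𝓞 K ⧸ 𝔪) : ℝ)

variable {d : ℕ}

/-- The coordinates of `x` under `𝓞 K ⧸ 𝔪 ≅ ℤ/n₁ℤ × ⋯ × ℤ/n_dℤ`, where `n₁ ω₁, …, n_d ω_d` is a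
`ℤ`-basis of `𝔪`, as integers in `{0, …, n_i - 1}`. -/
noncomputable def coords (ω : Module.Basis (Fin d) ℤ (𝓞 K)) (n : Fin d → ℕ) (𝔪 : Ideal (𝓞 K))
    (x : 𝓞 K ⧸ 𝔪) (i : Fin d) : ℤ :=
  ω.repr (Quotient.out x) i % (n i : ℤ)

theorem coords_mk (ω : Module.Basis (Fin d) ℤ (𝓞 K)) (n : Fin d → ℕ) (𝔪 : Ideal (𝓞 K))
    (ν : Module.Basis (Fin d) ℤ 𝔪) (hν : ∀ i, (ν i : 𝓞 K) = (n i : ℤ) • ω i)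
    (a : 𝓞 K) (i : Fin d) :
    coords ω n 𝔪 (Ideal.Quotient.mk 𝔪 a) i = ω.repr a i % (n i : ℤ) := by
  unfold coords
  have h : Quotient.out (Ideal.Quotient.mk 𝔪 a) - a ∈ 𝔪 := by
    rw [← Ideal.Quotient.eq]
    exact Quotient.out_eq _
  set y := Quotient.out (Ideal.Quotient.mk 𝔪 a) with hy
  have h2 : y - a = ∑ j, (ν.repr ⟨y - a, h⟩ j * (n j : ℤ)) • ω j := by
    have h3 := congrArg Subtype.val (ν.sum_repr ⟨y - a, h⟩)
    rw [AddSubmonoidClass.coe_finsetSum] at h3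
    refine h3.symm.trans ?_
    refine Finset.sum_congr rfl fun j _ => ?_
    rw [mul_smul, ← hν]
    rfl
  have h3 : ω.repr y i - ω.repr a i = ν.repr ⟨y - a, h⟩ i * (n i : ℤ) := by
    have h4 := congrArg (fun z => ω.repr z i) h2
    simp only [map_sub, Finsupp.sub_apply] at h4
    rw [h4, Module.Basis.repr_sum_self]
  exact Int.ModEq.symm ((Int.modEq_iff_dvd).2 (h3 ▸ dvd_mul_left _ _))

/-- The initial memory: index variable `0` holds `d`; the arrays hold `N`, the numbers `n i`, the
structure constants `Γ i j k` of `𝓞 K` with respect to `ω` (so that `ω i * ω j = ∑ k, Γ i j k • ω k`),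
and the rows of the operand `X`. Everything else is zero. -/
noncomputable def initialStore (ω : Module.Basis (Fin d) ℤ (𝓞 K)) (n : Fin d → ℕ) (N : ℕ)
    {r : ℕ} (X : Fin r → Fin d → ℤ) : Store where
  ix i := if i = 0 then d else 0
  mem
    | .modulus, [] => (N : ℤ)
    | .diag, [i] => if hi : i < d then (n ⟨i, hi⟩ : ℤ) else 0
    | .struct, [i, j, k] =>
        if h : i < d ∧ j < d ∧ k < d then
          ω.repr (ω ⟨i, h.1⟩ * ω ⟨j, h.2.1⟩) ⟨k, h.2.2⟩ else 0
    | .input, [t, i] => if h : t < r ∧ i < d then X ⟨t, h.1⟩ ⟨i, h.2⟩ else 0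
    | _, _ => 0

/-- On the operand with rows `X`, the program `P` computes (in the Las Vegas sense) elements
`c 0, …, c (r' - 1)` of `𝓞 K ⧸ 𝔪` that satisfy `Post`, at expected cost at most
`C * (1 / p) * d ^ 3`, where `p` is the proportion of units in `𝓞 K ⧸ 𝔪`. -/
def Performs [NumberField K] (C : ℝ) (ops : (k : ℕ) → BasicOps k) (ω : Module.Basis (Fin d) ℤ (𝓞 K))
    (n : Fin d → ℕ) (𝔪 : Ideal (𝓞 K)) (P : Cmd) {r r' : ℕ} (X : Fin r → Fin d → ℤ)
    (Post : (Fin r' → 𝓞 K ⧸ 𝔪) → Prop) : Prop :=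
  P.LasVegas (Ideal.absNorm 𝔪) ops (initialStore ω n (Ideal.absNorm 𝔪) X)
    (fun s => ∃ c : Fin r' → 𝓞 K ⧸ 𝔪, Post c ∧
      ∀ (t : Fin r') (i : Fin d), s.mem .output [(t : ℕ), (i : ℕ)] = coords ω n 𝔪 (c t) i)
    (ENNReal.ofReal (C * (1 / unitDensity 𝔪) * (d : ℝ) ^ 3))

end ResidueRing

/-!
The residue ring `R = 𝓞 K ⧸ 𝔪` is the quotient of `ℤ^d` by the relations `n i * ω i = 0`. If `c i`
generates the annihilator of `n i` in `ℤ/Nℤ`, then `n i` divides an integer `z` if and only if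
`z * c i = 0` in `ℤ/Nℤ`. Therefore an equation `z * e = y` in `R` amounts to a linear system over
`ℤ/Nℤ`, given by the multiplication matrix of `e` with its columns scaled by the `c i`
(`Coordinates.system_iff`). Such a system `x A = y` is solved with a Howell basis of the graph
`{(x A, x)}`, that is, a triangular basis such that the elements of the graph with leading zeros are
spanned by the corresponding rows. It arises from `O(d)` insertions of vectors into a triangular
matrix, first of the `d` generators of the graph and then, row by row, of the multiples of the row
in which the diagonal entry vanishes (`HowellUpTo.insert`). An insertion takes `O(d)` extended gcds, each
followed by `O(d)` ring operations, so that the basis costs `O(d ^ 3)`. Reduction by the basis, in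
`O(d ^ 2)` steps, decides solvability and yields a solution (`Reducing.solvable_iff`,
`Reducing.solution`), and the last rows of the basis span the kernel (`IsHowell.kernel`). Thus
addition, subtraction, multiplication and division in `R` need no random choice.

The other operations require a generator of an ideal of the form `(a, b)`. The ring `R` is a finite
principal ideal ring. In such a ring `(a, b)` is generated by some `a + q * b`
(`exists_mem_span_add_mul`), and the proportion of such `q` is at least the proportion `p` of units
(`card_units_le_card_generators`). A random element of `(b)` is a random `ℤ/Nℤ`-combination of `d`
elements that generate `(b)` as a group; the generator `b` itself need not be known. Whether the sum
of `a` and a random combination is a generator is tested by dividing the `d` elements by it, at cost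
`O(d ^ 3)`. Hence an expected number of at most `1 / p` trials suffices (`Cmd.runs_while`,
`search_runs`).

* With `a = 0` this gives generators of ideals, in particular of annihilators, which are kernels of
  multiplication maps.
* If `b` does not divide `a`, a generator `r = a + x * b` of `(a, b)` is a remainder: `(b)` is
  strictly contained in `(r)`, so that the norm of `r` is smaller (`residueNorm_lt`).
* For a generator `g = a + x * b` of `(a, b)` with `b = -u * g`, the coefficients `s = 1`, `t = x`, `u`
  and `v = u * x + 1` are a result of the extended gcd (`isXgcdResult_of_eq`). The unit element is
  found as the quotient of a random unit by itself.

For the semantics, the deterministic parts of the programs are treated by weakest preconditions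
(`Cmd.Wp`), and their cost is bounded from their text: if all loop counters are at most `2 d`, it is
`O(d ^ k)` for loops nested `k` deep (`Cmd.cost_le_pow`). Randomized runs are described by
`Cmd.Runs`. There a run is aborted only after as many steps as it has fuel, so that by the Markov
inequality a finite expected cost makes the program end with probability one
(`Cmd.Runs.lasVegas`).
-/

/-! ### Deterministic evaluation -/

/-- Structural induction, with names of the cases that are not keywords of programs. -/
@[elab_as_elim]
theorem Cmd.induction {P : Cmd → Prop} (skip : P .skip) (prim : ∀ I, P (.prim I))
    (seq : ∀ c₁ c₂, P c₁ → P c₂ → P (.seq c₁ c₂))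
    (ifZero : ∀ x c₁ c₂, P c₁ → P c₂ → P (.ifZero x c₁ c₂))
    (ifLt : ∀ e₁ e₂ c₁ c₂, P c₁ → P c₂ → P (.ifLt e₁ e₂ c₁ c₂))
    (loop : ∀ i e c, P c → P (.for i e c)) (iterate : ∀ x c, P c → P (.while x c)) (c : Cmd) :
    P c :=
  Cmd.rec skip prim seq ifZero ifLt loop iterate c

/-- The effect of an elementary instruction other than the random oracle, as a function. Both an
error and a call of the oracle give `none`. -/
noncomputable def Instr.eval (N : ℕ) (ops : (k : ℕ) → BasicOps k) (s : Store) :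
    Instr → Option Store
  | .const x z => some (s.write x z)
  | .copy x a => some (s.write x (s.read a))
  | .add k x a b => s.withModulus N k fun m =>
      s.writeResidue x (s.residue m a + s.residue m b)
  | .sub k x a b => s.withModulus N k fun m =>
      s.writeResidue x (s.residue m a - s.residue m b)
  | .mul k x a b => s.withModulus N k fun m =>
      s.writeResidue x (s.residue m a * s.residue m b)
  | .div k x a b => s.withModulus N k fun m =>
      s.writeResidue x ((ops m).div (s.residue m a) (s.residue m b))
  | .eudiv k q r a b => s.withModulus N k fun m =>
      (s.writeResidue q ((ops m).quo (s.residue m a) (s.residue m b))).writeResidue r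
        ((ops m).rem (s.residue m a) (s.residue m b))
  | .xgcd k g x₁ x₂ x₃ x₄ a b => s.withModulus N k fun m =>
      let w := (ops m).xgcd (s.residue m a) (s.residue m b)
      ((((s.writeResidue g (w 0)).writeResidue x₁ (w 1)).writeResidue x₂ (w 2)).writeResidue
        x₃ (w 3)).writeResidue x₄ (w 4)
  | .ann k x a => s.withModulus N k fun m =>
      s.writeResidue x ((ops m).ann (s.residue m a))
  | .rand _ _ => none
  | .setIx i e => some (s.setIx i (e.eval s))

/-- The `for` loop of the deterministic evaluation. -/
def evalFor (body : Store → Option Store) (i : ℕ) : ℕ → Store → Option Store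
  | 0, s => some s
  | n + 1, s => (evalFor body i n s).bind fun s' => body (s'.setIx i n)

/-- Evaluation of programs without `while` loops and without random choices; all others give
`none`. -/
noncomputable def Cmd.eval (N : ℕ) (ops : (k : ℕ) → BasicOps k) : Cmd → Store → Option Store
  | .skip, s => some s
  | .prim I, s => I.eval N ops s
  | .seq c₁ c₂, s => (c₁.eval N ops s).bind (c₂.eval N ops)
  | .ifZero x c₁ c₂, s => if s.read x = 0 then c₁.eval N ops s else c₂.eval N ops s
  | .ifLt e₁ e₂ c₁ c₂, s =>
      if e₁.eval s < e₂.eval s then c₁.eval N ops s else c₂.eval N ops s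
  | .for i e c, s => evalFor (c.eval N ops) i (e.eval s) s
  | .while _ _, _ => none

/-- The arrays in which an instruction may change cells. -/
def Instr.arrs : Instr → List Arr
  | .const x _ => [x.arr]
  | .copy x _ => [x.arr]
  | .add _ x _ _ => [x.arr]
  | .sub _ x _ _ => [x.arr]
  | .mul _ x _ _ => [x.arr]
  | .div _ x _ _ => [x.arr]
  | .eudiv _ q r _ _ => [q.arr, r.arr]
  | .xgcd _ g s t u v _ _ => [g.arr, s.arr, t.arr, u.arr, v.arr]
  | .ann _ x _ => [x.arr]
  | .rand _ x => [x.arr]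
  | .setIx _ _ => []

/-- The index variables that an instruction may change. -/
def Instr.vars : Instr → List ℕ
  | .setIx i _ => [i]
  | _ => []

/-- The arrays in which a program may change cells. -/
def Cmd.arrs : Cmd → List Arr
  | .skip => []
  | .prim I => I.arrs
  | .seq c₁ c₂ => c₁.arrs ++ c₂.arrs
  | .ifZero _ c₁ c₂ => c₁.arrs ++ c₂.arrs
  | .ifLt _ _ c₁ c₂ => c₁.arrs ++ c₂.arrs
  | .for _ _ c => c.arrs
  | .while _ c => c.arrs

/-- The index variables that a program may change. -/
def Cmd.vars : Cmd → List ℕ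
  | .skip => []
  | .prim I => I.vars
  | .seq c₁ c₂ => c₁.vars ++ c₂.vars
  | .ifZero _ c₁ c₂ => c₁.vars ++ c₂.vars
  | .ifLt _ _ c₁ c₂ => c₁.vars ++ c₂.vars
  | .for i _ c => i :: c.vars
  | .while _ c => c.vars

/-- `s'` agrees with `s` outside the arrays in `A` and the index variables in `V`. -/
def Frame (A : List Arr) (V : List ℕ) (s s' : Store) : Prop :=
  (∀ B, B ∉ A → s'.mem B = s.mem B) ∧ ∀ j, j ∉ V → s'.ix j = s.ix j

theorem Frame.refl (A : List Arr) (V : List ℕ) (s : Store) : Frame A V s s :=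
  ⟨fun _ _ => rfl, fun _ _ => rfl⟩

theorem Frame.trans {A : List Arr} {V : List ℕ} {s s' s'' : Store} (h : Frame A V s s')
    (h' : Frame A V s' s'') : Frame A V s s'' :=
  ⟨fun B hB => (h'.1 B hB).trans (h.1 B hB), fun j hj => (h'.2 j hj).trans (h.2 j hj)⟩

theorem Frame.mono {A A' : List Arr} {V V' : List ℕ} {s s' : Store} (h : Frame A V s s')
    (hA : A ⊆ A') (hV : V ⊆ V') : Frame A' V' s s' :=
  ⟨fun B hB => h.1 B fun hB' => hB (hA hB'), fun j hj => h.2 j fun hj' => hj (hV hj')⟩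

theorem Frame.setIx {A : List Arr} {V : List ℕ} {s s' : Store} (h : Frame A V s s') {i : ℕ}
    (hi : i ∈ V) (n : ℕ) : Frame A V s (s'.setIx i n) := by
  refine ⟨h.1, fun j hj => ?_⟩
  have hne : j ≠ i := fun hji => hj (hji ▸ hi)
  simp [Store.setIx, hne, h.2 j hj]

theorem Frame.write {A : List Arr} {V : List ℕ} {s s' : Store} (h : Frame A V s s') {x : Ref}
    (hx : x.arr ∈ A) (z : ℤ) : Frame A V s (s'.write x z) := by
  refine ⟨fun B hB => ?_, h.2⟩
  have hne : B ≠ x.arr := fun hBx => hB (hBx ▸ hx)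
  funext l
  simp [Store.write, hne, h.1 B hB]

theorem Store.withModulus_eq_some {s : Store} {N : ℕ} {k : Ref} {f : ℕ → Store} {s' : Store}
    (h : s.withModulus N k f = some s') : ∃ m, s' = f m := by
  unfold Store.withModulus at h
  split_ifs at h
  exact ⟨_, (Option.some.inj h).symm⟩

variable {N : ℕ} {ops : (k : ℕ) → BasicOps k}

theorem Instr.frame_of_eval {s s' : Store} {I : Instr} (h : I.eval N ops s = some s') :
    Frame I.arrs I.vars s s' := by
  cases I with
  | const x z => cases h; exact (Frame.refl _ _ _).write (by simp [Instr.arrs]) _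
  | copy x a => cases h; exact (Frame.refl _ _ _).write (by simp [Instr.arrs]) _
  | rand k x => cases h
  | setIx i e => cases h; exact (Frame.refl _ _ _).setIx (by simp [Instr.vars]) _
  | _ =>
    simp only [Instr.eval] at h
    obtain ⟨m, rfl⟩ := Store.withModulus_eq_some h
    simp only [Store.writeResidue]
    repeat' first
      | exact Frame.refl _ _ _
      | refine Frame.write ?_ (by simp [Instr.arrs]) _

theorem evalFor_frame {A : List Arr} {V : List ℕ} {i : ℕ} {body : Store → Option Store}
    (hb : ∀ s s', body s = some s' → Frame A V s s') (hi : i ∈ V) :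
    ∀ n s s', evalFor body i n s = some s' → Frame A V s s'
  | 0, s, s', h => by cases h; exact Frame.refl _ _ _
  | n + 1, s, s', h => by
    obtain ⟨s₁, h₁, h₂⟩ := Option.bind_eq_some_iff.1 h
    have h₃ := (evalFor_frame hb hi n s s₁ h₁).setIx hi n
    exact h₃.trans (hb _ _ h₂)

theorem Cmd.frame_of_eval {c : Cmd} : ∀ {s s' : Store}, c.eval N ops s = some s' →
    Frame c.arrs c.vars s s' := by
  induction c using Cmd.induction with
  | skip => intro s s' h; cases h; exact Frame.refl _ _ _
  | prim I => intro s s' h; exact Instr.frame_of_eval h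
  | seq c₁ c₂ ih₁ ih₂ =>
    intro s s' h
    obtain ⟨s₁, h₁, h₂⟩ := Option.bind_eq_some_iff.1 h
    exact ((ih₁ h₁).mono (by simp [Cmd.arrs]) (by simp [Cmd.vars])).trans
      ((ih₂ h₂).mono (by simp [Cmd.arrs]) (by simp [Cmd.vars]))
  | ifZero x c₁ c₂ ih₁ ih₂ =>
    intro s s' h
    simp only [Cmd.eval] at h
    split_ifs at h
    · exact (ih₁ h).mono (by simp [Cmd.arrs]) (by simp [Cmd.vars])
    · exact (ih₂ h).mono (by simp [Cmd.arrs]) (by simp [Cmd.vars])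
  | ifLt e₁ e₂ c₁ c₂ ih₁ ih₂ =>
    intro s s' h
    simp only [Cmd.eval] at h
    split_ifs at h
    · exact (ih₁ h).mono (by simp [Cmd.arrs]) (by simp [Cmd.vars])
    · exact (ih₂ h).mono (by simp [Cmd.arrs]) (by simp [Cmd.vars])
  | loop i e c ih =>
    intro s s' h
    exact evalFor_frame (fun s s' h => (ih h).mono (by simp [Cmd.arrs]) (by simp [Cmd.vars]))
      (by simp [Cmd.vars]) _ _ _ h
  | iterate x c ih => intro s s' h; cases h

/-! ### A calculus of weakest preconditions -/

/-- The deterministic run of `c` from `s` ends without an error in a memory satisfying `Q`. -/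
def Cmd.Wp (N : ℕ) (ops : (k : ℕ) → BasicOps k) (c : Cmd) (s : Store) (Q : Store → Prop) : Prop :=
  ∃ s', c.eval N ops s = some s' ∧ Q s'

/-- The postcondition may be weakened with the help of the frame: arrays and index variables to
which the program does not assign are unchanged. -/
theorem Cmd.Wp.mono {c : Cmd} {s : Store} {Q Q' : Store → Prop} (h : c.Wp N ops s Q)
    (hQ : ∀ s', Frame c.arrs c.vars s s' → Q s' → Q' s') : c.Wp N ops s Q' := by
  obtain ⟨s', hs, hq⟩ := h
  exact ⟨s', hs, hQ s' (Cmd.frame_of_eval hs) hq⟩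

theorem Cmd.wp_skip {s : Store} {Q : Store → Prop} (h : Q s) : Cmd.skip.Wp N ops s Q :=
  ⟨s, rfl, h⟩

theorem Cmd.wp_seq {c₁ c₂ : Cmd} {s : Store} {Q : Store → Prop}
    (h : c₁.Wp N ops s fun s' => c₂.Wp N ops s' Q) : (Cmd.seq c₁ c₂).Wp N ops s Q := by
  obtain ⟨s₁, h₁, s₂, h₂, h₃⟩ := h
  exact ⟨s₂, by simp [Cmd.eval, h₁, h₂], h₃⟩

theorem Cmd.Wp.seq {c₁ c₂ : Cmd} {s : Store} {Q₁ Q : Store → Prop} (h₁ : c₁.Wp N ops s Q₁)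
    (h₂ : ∀ s', Frame c₁.arrs c₁.vars s s' → Q₁ s' → c₂.Wp N ops s' Q) :
    (Cmd.seq c₁ c₂).Wp N ops s Q :=
  Cmd.wp_seq (h₁.mono h₂)

theorem Cmd.wp_ifZero {x : Ref} {c₁ c₂ : Cmd} {s : Store} {Q : Store → Prop}
    (h₁ : s.read x = 0 → c₁.Wp N ops s Q) (h₂ : s.read x ≠ 0 → c₂.Wp N ops s Q) :
    (Cmd.ifZero x c₁ c₂).Wp N ops s Q := by
  unfold Cmd.Wp
  by_cases h : s.read x = 0
  · simp only [Cmd.eval, if_pos h]; exact h₁ h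
  · simp only [Cmd.eval, if_neg h]; exact h₂ h

theorem Cmd.wp_ifLt {e₁ e₂ : Ix} {c₁ c₂ : Cmd} {s : Store} {Q : Store → Prop}
    (h₁ : e₁.eval s < e₂.eval s → c₁.Wp N ops s Q)
    (h₂ : ¬ e₁.eval s < e₂.eval s → c₂.Wp N ops s Q) :
    (Cmd.ifLt e₁ e₂ c₁ c₂).Wp N ops s Q := by
  unfold Cmd.Wp
  by_cases h : e₁.eval s < e₂.eval s
  · simp only [Cmd.eval, if_pos h]; exact h₁ h
  · simp only [Cmd.eval, if_neg h]; exact h₂ h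

/-- The invariant rule for `for` loops. The body may use that nothing outside given arrays and index
variables has changed since an earlier state `s₀`. -/
theorem Cmd.wp_for {i n : ℕ} {e : Ix} {c : Cmd} {s₀ s : Store} {Q : Store → Prop} {A : List Arr}
    {V : List ℕ} (hF : Frame A V s₀ s) (hA : c.arrs ⊆ A) (hV : i :: c.vars ⊆ V)
    (he : e.eval s = n) (Inv : ℕ → (Arr → List ℕ → ℤ) → Prop) (h0 : Inv 0 s.mem)
    (hstep : ∀ k s', k < n → Frame A V s₀ s' → s'.ix i = k →
      (∀ j, j ≠ i → j ∉ c.vars → s'.ix j = s.ix j) → Inv k s'.mem →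
      c.Wp N ops s' fun s'' => Inv (k + 1) s''.mem)
    (hQ : ∀ s', Frame A V s₀ s' → (∀ j, j ≠ i → j ∉ c.vars → s'.ix j = s.ix j) →
      Inv n s'.mem → Q s') :
    (Cmd.for i e c).Wp N ops s Q := by
  have key : ∀ m ≤ n, ∃ s', evalFor (c.eval N ops) i m s = some s' ∧
      Frame A V s₀ s' ∧ (∀ j, j ≠ i → j ∉ c.vars → s'.ix j = s.ix j) ∧ Inv m s'.mem := by
    intro m
    induction m with
    | zero => exact fun _ => ⟨s, rfl, hF, fun _ _ _ => rfl, h0⟩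
    | succ m ih =>
      intro hm
      obtain ⟨s₁, h₁, h₂, hj, h₃⟩ := ih (by omega)
      have h₄ := h₂.setIx (i := i) (hV (by simp)) m
      have hj' : ∀ j, j ≠ i → j ∉ c.vars → (s₁.setIx i m).ix j = s.ix j := fun j h h' => by
        simp [Store.setIx, h, hj j h h']
      obtain ⟨s₂, h₅, h₆⟩ := hstep m (s₁.setIx i m) (by omega) h₄ (by simp [Store.setIx]) hj' h₃
      have h₇ := Cmd.frame_of_eval h₅
      refine ⟨s₂, by simp [evalFor, h₁, h₅], h₄.trans ?_, fun j h h' => ?_, h₆⟩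
      · exact h₇.mono hA fun j hj => hV (by simp [hj])
      · rw [h₇.2 j h', hj' j h h']
  obtain ⟨s', h₁, h₂, h₃, h₄⟩ := key n le_rfl
  exact ⟨s', by simpa only [Cmd.eval, he] using h₁, hQ s' h₂ h₃ h₄⟩

theorem Store.withModulus_eq {s : Store} {N m : ℕ} {k : Ref} {f : ℕ → Store}
    (hk : s.read k = m) (h1 : 1 ≤ m) (hN : m ≤ N) : s.withModulus N k f = some (f m) := by
  unfold Store.withModulus
  rw [if_pos (by rw [hk]; omega), hk, Int.toNat_natCast]

section Instructions

variable {s : Store} {Q : Store → Prop} {m : ℕ} {k : Ref}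

theorem Cmd.wp_const {x : Ref} {z : ℤ} (h : Q (s.write x z)) :
    (Cmd.prim (.const x z)).Wp N ops s Q := ⟨_, rfl, h⟩

theorem Cmd.wp_copy {x a : Ref} (h : Q (s.write x (s.read a))) :
    (Cmd.prim (.copy x a)).Wp N ops s Q := ⟨_, rfl, h⟩

theorem Cmd.wp_setIx {i : ℕ} {e : Ix} (h : Q (s.setIx i (e.eval s))) :
    (Cmd.prim (.setIx i e)).Wp N ops s Q := ⟨_, rfl, h⟩

theorem Cmd.wp_add {x a b : Ref} (hk : s.read k = m) (h1 : 1 ≤ m) (hN : m ≤ N)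
    (h : Q (s.writeResidue x (s.residue m a + s.residue m b))) :
    (Cmd.prim (.add k x a b)).Wp N ops s Q :=
  ⟨_, by simpa only [Cmd.eval, Instr.eval] using Store.withModulus_eq hk h1 hN, h⟩

theorem Cmd.wp_sub {x a b : Ref} (hk : s.read k = m) (h1 : 1 ≤ m) (hN : m ≤ N)
    (h : Q (s.writeResidue x (s.residue m a - s.residue m b))) :
    (Cmd.prim (.sub k x a b)).Wp N ops s Q :=
  ⟨_, by simpa only [Cmd.eval, Instr.eval] using Store.withModulus_eq hk h1 hN, h⟩

theorem Cmd.wp_mul {x a b : Ref} (hk : s.read k = m) (h1 : 1 ≤ m) (hN : m ≤ N)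
    (h : Q (s.writeResidue x (s.residue m a * s.residue m b))) :
    (Cmd.prim (.mul k x a b)).Wp N ops s Q :=
  ⟨_, by simpa only [Cmd.eval, Instr.eval] using Store.withModulus_eq hk h1 hN, h⟩

theorem Cmd.wp_div {x a b : Ref} (hk : s.read k = m) (h1 : 1 ≤ m) (hN : m ≤ N)
    (h : Q (s.writeResidue x ((ops m).div (s.residue m a) (s.residue m b)))) :
    (Cmd.prim (.div k x a b)).Wp N ops s Q :=
  ⟨_, by simpa only [Cmd.eval, Instr.eval] using Store.withModulus_eq hk h1 hN, h⟩

theorem Cmd.wp_ann {x a : Ref} (hk : s.read k = m) (h1 : 1 ≤ m) (hN : m ≤ N)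
    (h : Q (s.writeResidue x ((ops m).ann (s.residue m a)))) :
    (Cmd.prim (.ann k x a)).Wp N ops s Q :=
  ⟨_, by simpa only [Cmd.eval, Instr.eval] using Store.withModulus_eq hk h1 hN, h⟩

theorem Cmd.wp_xgcd {x₀ x₁ x₂ x₃ x₄ a b : Ref} (hk : s.read k = m) (h1 : 1 ≤ m) (hN : m ≤ N)
    (h : ∀ w, w = (ops m).xgcd (s.residue m a) (s.residue m b) →
      Q (((((s.writeResidue x₀ (w 0)).writeResidue x₁ (w 1)).writeResidue x₂ (w 2)).writeResidue
        x₃ (w 3)).writeResidue x₄ (w 4))) :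
    (Cmd.prim (.xgcd k x₀ x₁ x₂ x₃ x₄ a b)).Wp N ops s Q :=
  ⟨_, by simpa only [Cmd.eval, Instr.eval] using Store.withModulus_eq hk h1 hN, h _ rfl⟩

end Instructions

/-! ### Cost of programs whose loop counters are at most `2 d` -/

/-- The program never changes index variable `0`, and the number of passes of each of its `for`
loops is the value of that variable or twice this value. -/
def Cmd.Bounded : Cmd → Prop
  | .skip => True
  | .prim I => 0 ∉ I.vars
  | .seq c₁ c₂ => c₁.Bounded ∧ c₂.Bounded
  | .ifZero _ c₁ c₂ => c₁.Bounded ∧ c₂.Bounded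
  | .ifLt _ _ c₁ c₂ => c₁.Bounded ∧ c₂.Bounded
  | .for i e c => i ≠ 0 ∧ (e = .var 0 ∨ e = .add (.var 0) (.var 0)) ∧ c.Bounded
  | .while _ c => c.Bounded

/-- An upper bound for the cost of a `while`-free program when index variable `0` holds `d`. -/
def Cmd.cost (d : ℕ) : Cmd → ℕ
  | .skip => 0
  | .prim _ => 1
  | .seq c₁ c₂ => c₁.cost d + c₂.cost d
  | .ifZero _ c₁ c₂ => c₁.cost d + c₂.cost d + 1
  | .ifLt _ _ c₁ c₂ => c₁.cost d + c₂.cost d + 1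
  | .for _ _ c => 2 * d * (c.cost d + 1)
  | .while _ _ => 0

/-- The nesting depth of the loops of a program. -/
def Cmd.depth : Cmd → ℕ
  | .skip => 0
  | .prim _ => 0
  | .seq c₁ c₂ => max c₁.depth c₂.depth
  | .ifZero _ c₁ c₂ => max c₁.depth c₂.depth
  | .ifLt _ _ c₁ c₂ => max c₁.depth c₂.depth
  | .for _ _ c => c.depth + 1
  | .while _ c => c.depth + 1

/-- The exponent of `d` in the cost is the nesting depth of the loops. -/
theorem Cmd.cost_le_pow (c : Cmd) : ∃ C, ∀ d, 1 ≤ d → c.cost d ≤ C * d ^ c.depth := by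
  have two : ∀ c₁ c₂ : Cmd, (∃ C, ∀ d, 1 ≤ d → c₁.cost d ≤ C * d ^ c₁.depth) →
      (∃ C, ∀ d, 1 ≤ d → c₂.cost d ≤ C * d ^ c₂.depth) →
      ∃ C, ∀ d, 1 ≤ d → c₁.cost d + c₂.cost d + 1 ≤ C * d ^ max c₁.depth c₂.depth := by
    rintro c₁ c₂ ⟨C₁, h₁⟩ ⟨C₂, h₂⟩
    refine ⟨C₁ + C₂ + 1, fun d hd => ?_⟩
    have h₃ : d ^ c₁.depth ≤ d ^ max c₁.depth c₂.depth := Nat.pow_le_pow_right hd (le_max_left _ _)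
    have h₄ : d ^ c₂.depth ≤ d ^ max c₁.depth c₂.depth := Nat.pow_le_pow_right hd (le_max_right _ _)
    have h₅ : 1 ≤ d ^ max c₁.depth c₂.depth := Nat.one_le_pow _ _ hd
    calc _ ≤ C₁ * d ^ c₁.depth + C₂ * d ^ c₂.depth + 1 := by
          have := h₁ d hd; have := h₂ d hd; omega
      _ ≤ C₁ * d ^ max c₁.depth c₂.depth + C₂ * d ^ max c₁.depth c₂.depth
          + 1 * d ^ max c₁.depth c₂.depth := by rw [one_mul]; gcongr
      _ = _ := by ring
  induction c using Cmd.induction with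
  | skip => exact ⟨0, fun d _ => by simp [Cmd.cost]⟩
  | prim I => exact ⟨1, fun d _ => by simp [Cmd.cost, Cmd.depth]⟩
  | seq c₁ c₂ ih₁ ih₂ =>
    obtain ⟨C, hC⟩ := two c₁ c₂ ih₁ ih₂
    exact ⟨C, fun d hd => le_trans (by simp [Cmd.cost]) (hC d hd)⟩
  | ifZero x c₁ c₂ ih₁ ih₂ => exact two c₁ c₂ ih₁ ih₂
  | ifLt e₁ e₂ c₁ c₂ ih₁ ih₂ => exact two c₁ c₂ ih₁ ih₂
  | loop i e c ih =>
    obtain ⟨C, hC⟩ := ih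
    refine ⟨2 * (C + 1), fun d hd => ?_⟩
    have h₁ := hC d hd
    have h₂ : 1 ≤ d ^ c.depth := Nat.one_le_pow _ _ hd
    calc _ = 2 * d * (c.cost d + 1) := rfl
      _ ≤ 2 * d * (C * d ^ c.depth + d ^ c.depth) := by gcongr
      _ = _ := by simp only [Cmd.depth]; ring
  | iterate x c ih => exact ⟨0, fun d _ => by simp [Cmd.cost]⟩

theorem Cmd.cost_le_cube (c : Cmd) (hc : c.depth ≤ 3) :
    ∃ C, ∀ d, 1 ≤ d → c.cost d ≤ C * d ^ 3 := by
  obtain ⟨C, hC⟩ := c.cost_le_pow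
  exact ⟨C, fun d hd => (hC d hd).trans (by gcongr)⟩

theorem Instr.exec_of_eval {I : Instr} {s s' : Store} (h : I.eval N ops s = some s') :
    I.exec N ops s = PMF.pure (some s') := by
  cases I with
  | rand k x => cases h
  | _ => exact congrArg PMF.pure h

theorem Outcome.pure_andThen_pure {s' : Store} {o : Option Store} {n n' : ℕ}
    {f : Store → Outcome} (hs : f s' = PMF.pure (o, n')) :
    Outcome.andThen (PMF.pure (some s', n)) f = PMF.pure (o, n + n') := by
  simp [Outcome.andThen, PMF.pure_bind, hs, PMF.pure_map]

theorem Outcome.tick_pure {o : Option Store} {n : ℕ} :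
    Outcome.tick (PMF.pure (o, n)) = PMF.pure (o, n + 1) := by
  simp [Outcome.tick, PMF.pure_map]

theorem Cmd.Bounded.ix_zero {c : Cmd} (hc : c.Bounded) : 0 ∉ c.vars := by
  induction c using Cmd.induction with
  | skip => simp [Cmd.vars]
  | prim I => exact hc
  | seq c₁ c₂ ih₁ ih₂ => simp [Cmd.vars, ih₁ hc.1, ih₂ hc.2]
  | ifZero x c₁ c₂ ih₁ ih₂ => simp [Cmd.vars, ih₁ hc.1, ih₂ hc.2]
  | ifLt e₁ e₂ c₁ c₂ ih₁ ih₂ => simp [Cmd.vars, ih₁ hc.1, ih₂ hc.2]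
  | loop i e c ih => simp [Cmd.vars, hc.1.symm, ih hc.2.2]
  | iterate x c ih => exact ih hc

/-- A bounded program with a deterministic run has only that run, at a cost that is read off from
its text. -/
theorem Cmd.exec_of_eval {c : Cmd} (fuel d : ℕ) : c.Bounded → ∀ {s s' : Store}, s.ix 0 = d →
    c.eval N ops s = some s' →
    ∃ n ≤ c.cost d, c.exec N ops fuel s = PMF.pure (some s', n) := by
  induction c using Cmd.induction with
  | skip => intro _ s s' _ h; cases h; exact ⟨0, le_rfl, rfl⟩
  | prim I =>
    intro _ s s' _ h
    exact ⟨1, le_rfl, by simp [Cmd.exec, Instr.exec_of_eval h, PMF.pure_map]⟩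
  | seq c₁ c₂ ih₁ ih₂ =>
    intro hb s s' hs h
    obtain ⟨s₁, h₁, h₂⟩ := Option.bind_eq_some_iff.1 h
    obtain ⟨n₁, hn₁, e₁⟩ := ih₁ hb.1 hs h₁
    obtain ⟨n₂, hn₂, e₂⟩ := ih₂ hb.2
      (((Cmd.frame_of_eval h₁).2 0 hb.1.ix_zero).trans hs) h₂
    refine ⟨n₁ + n₂, add_le_add hn₁ hn₂, ?_⟩
    rw [Cmd.exec, e₁, Outcome.pure_andThen_pure e₂]
  | ifZero x c₁ c₂ ih₁ ih₂ =>
    intro hb s s' hs h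
    simp only [Cmd.eval] at h
    split_ifs at h with hx
    · obtain ⟨n, hn, e⟩ := ih₁ hb.1 hs h
      exact ⟨n + 1, by simp only [Cmd.cost]; omega, by
        rw [Cmd.exec, if_pos hx, e, Outcome.tick_pure]⟩
    · obtain ⟨n, hn, e⟩ := ih₂ hb.2 hs h
      exact ⟨n + 1, by simp only [Cmd.cost]; omega, by
        rw [Cmd.exec, if_neg hx, e, Outcome.tick_pure]⟩
  | ifLt e₁ e₂ c₁ c₂ ih₁ ih₂ =>
    intro hb s s' hs h
    simp only [Cmd.eval] at h
    split_ifs at h with hx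
    · obtain ⟨n, hn, e⟩ := ih₁ hb.1 hs h
      exact ⟨n + 1, by simp only [Cmd.cost]; omega, by
        rw [Cmd.exec, if_pos hx, e, Outcome.tick_pure]⟩
    · obtain ⟨n, hn, e⟩ := ih₂ hb.2 hs h
      exact ⟨n + 1, by simp only [Cmd.cost]; omega, by
        rw [Cmd.exec, if_neg hx, e, Outcome.tick_pure]⟩
  | loop i e c ih =>
    intro hb s s' hs h
    have key : ∀ m s', evalFor (c.eval N ops) i m s = some s' → ∃ n ≤ m * (c.cost d + 1),
        Outcome.forLoop (c.exec N ops fuel) i m s = PMF.pure (some s', n) := by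
      intro m
      induction m with
      | zero => intro s' h; cases h; exact ⟨0, by simp, rfl⟩
      | succ m ihm =>
        intro s' h
        obtain ⟨s₁, h₁, h₂⟩ := Option.bind_eq_some_iff.1 h
        obtain ⟨n₁, hn₁, e₁⟩ := ihm s₁ h₁
        have hF : Frame c.arrs (i :: c.vars) s s₁ :=
          evalFor_frame (fun s s' h => (Cmd.frame_of_eval h).mono (by simp) (by simp))
            (by simp) _ _ _ h₁
        have h0 : (0 : ℕ) ∉ i :: c.vars := by simp [hb.1.symm, hb.2.2.ix_zero]
        obtain ⟨n₂, hn₂, e₂⟩ := ih hb.2.2 (s := s₁.setIx i m)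
          (by simp [Store.setIx, hb.1.symm, hF.2 0 h0, hs]) h₂
        refine ⟨n₁ + (n₂ + 1), by nlinarith, ?_⟩
        rw [Outcome.forLoop, e₁]
        refine Outcome.pure_andThen_pure ?_
        rw [e₂, Outcome.tick_pure]
    obtain ⟨n, hn, e₁⟩ := key _ _ h
    refine ⟨n, hn.trans ?_, e₁⟩
    have : e.eval s ≤ 2 * d := by
      rcases hb.2.1 with rfl | rfl <;> simp [Ix.eval, hs] <;> omega
    exact Nat.mul_le_mul_right _ this
  | iterate x c ih => intro _ s s' _ h; cases h

/-! ### Las Vegas runs: outcomes and expected cost -/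

namespace Outcome

/-- The expected cost. -/
noncomputable def mean (o : Outcome) : ℝ≥0∞ := ∑' r, o r * (r.2 : ℝ≥0∞)

/-- The expectation of `f` over an image distribution. -/
theorem tsum_map {α β : Type*} (p : PMF α) (g : α → β) (f : β → ℝ≥0∞) :
    ∑' b, (p.map g) b * f b = ∑' a, p a * f (g a) := by
  classical
  simp only [PMF.map_apply, ← ENNReal.tsum_mul_right]
  rw [ENNReal.tsum_comm]
  refine tsum_congr fun a => ?_
  rw [tsum_eq_single (g a)]
  · simp
  · intro b hb; simp [hb]

theorem tsum_bind {α β : Type*} (p : PMF α) (g : α → PMF β) (f : β → ℝ≥0∞) :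
    ∑' b, (p.bind g) b * f b = ∑' a, p a * ∑' b, g a b * f b := by
  simp only [PMF.bind_apply, ← ENNReal.tsum_mul_right, ← ENNReal.tsum_mul_left]
  rw [ENNReal.tsum_comm]
  simp only [mul_assoc]

theorem mean_pure (o : Option Store) (n : ℕ) : mean (PMF.pure (o, n)) = n := by
  classical
  unfold mean
  rw [tsum_eq_single (o, n)]
  · simp
  · intro b hb; simp [PMF.pure_apply, hb]

theorem mean_map_cost {α : Type*} (p : PMF α) (g : α → Option Store) (n : α → ℕ) :
    mean (p.map fun a => (g a, n a)) = ∑' a, p a * (n a : ℝ≥0∞) :=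
  tsum_map _ _ _

theorem mean_shift (o : Outcome) (n : ℕ) :
    mean (PMF.map (fun r => (r.1, n + r.2)) o) = n + mean o := by
  unfold mean
  rw [tsum_map]
  simp only [Nat.cast_add, mul_add, ENNReal.tsum_add, ENNReal.tsum_mul_right, PMF.tsum_coe,
    one_mul]

theorem tick_eq (o : Outcome) : tick o = PMF.map (fun r => (r.1, 1 + r.2)) o := by
  simp [tick, add_comm]

theorem mean_tick (o : Outcome) : mean (tick o) = 1 + mean o := by
  rw [tick_eq]
  simpa using mean_shift o 1

/-- The expected cost of the second part of a run whose first part had the given outcome. -/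
noncomputable def meanAfter (f : Store → Outcome) (r : Option Store × ℕ) : ℝ≥0∞ :=
  match r.1 with
  | none => 0
  | some s => mean (f s)

theorem mean_andThen (o : Outcome) (f : Store → Outcome) :
    mean (o.andThen f) = mean o + ∑' r, o r * meanAfter f r := by
  unfold andThen mean
  rw [tsum_bind, ← ENNReal.tsum_add]
  refine tsum_congr fun r => ?_
  rw [← mul_add]
  congr 1
  obtain ⟨_ | s, n⟩ := r
  · simp [meanAfter]
  · exact mean_shift (f s) n

end Outcome

/-- Every aborted run has cost at least `fuel`, all other runs end in a memory satisfying `Q`, and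
the expected cost is at most `B`. If while loops are cut off after `fuel` tests, the
first condition for all values of `fuel` rules out errors, and it bounds the probability of an abort
in terms of the expected cost. -/
structure Outcome.Good (o : Outcome) (fuel : ℕ) (Q : Store → Prop) (B : ℝ≥0∞) : Prop where
  abort : ∀ n, (none, n) ∈ o.support → fuel ≤ n
  post : ∀ s n, (some s, n) ∈ o.support → Q s
  mean_le : o.mean ≤ B

theorem Outcome.Good.mono {o : Outcome} {fuel : ℕ} {Q Q' : Store → Prop} {B B' : ℝ≥0∞}
    (h : o.Good fuel Q B) (hQ : ∀ s, Q s → Q' s) (hB : B ≤ B') : o.Good fuel Q' B' :=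
  ⟨h.abort, fun s n hs => hQ s (h.post s n hs), h.mean_le.trans hB⟩

theorem Outcome.Good.done {fuel n : ℕ} {Q : Store → Prop} {s : Store} (h : Q s) :
    Outcome.Good (PMF.pure (some s, n)) fuel Q n where
  abort m hm := by simp at hm
  post s' m hm := by
    have := (PMF.mem_support_pure_iff _ _).1 hm
    simp only [Prod.mk.injEq, Option.some.injEq] at this
    exact this.1 ▸ h
  mean_le := (Outcome.mean_pure _ _).le

/-- A tick pays for one more test of a while loop. -/
theorem Outcome.Good.tick {o : Outcome} {fuel : ℕ} {Q : Store → Prop} {B : ℝ≥0∞}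
    (h : o.Good fuel Q B) : o.tick.Good (fuel + 1) Q (1 + B) where
  abort n hn := by
    obtain ⟨⟨r, m⟩, hr, he⟩ := (PMF.mem_support_map_iff _ _ _).1 hn
    simp only [Prod.mk.injEq] at he
    obtain ⟨rfl, rfl⟩ := he
    exact Nat.succ_le_succ (h.abort _ hr)
  post s n hn := by
    obtain ⟨⟨r, m⟩, hr, he⟩ := (PMF.mem_support_map_iff _ _ _).1 hn
    simp only [Prod.mk.injEq] at he
    obtain ⟨rfl, rfl⟩ := he
    exact h.post _ _ hr
  mean_le := by rw [mean_tick]; gcongr; exact h.mean_le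

/-- A run of a composition either is aborted in its first part, or splits into two runs whose costs
add up. -/
theorem Outcome.mem_support_andThen {o : Outcome} {f : Store → Outcome} {r : Option Store × ℕ}
    (h : r ∈ (o.andThen f).support) :
    (r.1 = none ∧ r ∈ o.support) ∨
      ∃ s n m, (some s, n) ∈ o.support ∧ (r.1, m) ∈ (f s).support ∧ r.2 = n + m := by
  obtain ⟨⟨r₁, n⟩, hr, h⟩ := (PMF.mem_support_bind_iff _ _ _).1 h
  cases r₁ with
  | none =>
    have := (PMF.mem_support_pure_iff _ _).1 h
    subst this
    exact Or.inl ⟨rfl, hr⟩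
  | some s =>
    obtain ⟨⟨r₂, m⟩, hm, he⟩ := (PMF.mem_support_map_iff _ _ _).1 h
    subst he
    exact Or.inr ⟨s, n, m, hr, hm, rfl⟩

theorem Outcome.support_andThen_good {o : Outcome} {f : Store → Outcome} {fuel : ℕ}
    {Q₁ Q : Store → Prop} {B₁ : ℝ≥0∞} {B : Store → ℝ≥0∞} (h₁ : o.Good fuel Q₁ B₁)
    (h₂ : ∀ s, Q₁ s → (f s).Good fuel Q (B s)) :
    (∀ n, (none, n) ∈ (o.andThen f).support → fuel ≤ n) ∧
      ∀ s n, (some s, n) ∈ (o.andThen f).support → Q s := by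
  constructor
  · intro n hn
    rcases mem_support_andThen hn with ⟨_, h⟩ | ⟨s, n', m, hs, hm, he⟩
    · exact h₁.abort _ h
    · have := (h₂ s (h₁.post _ _ hs)).abort _ hm
      simp only at he
      omega
  · intro s n hn
    rcases mem_support_andThen hn with ⟨h, _⟩ | ⟨s', n', m, hs, hm, _⟩
    · cases h
    · exact (h₂ s' (h₁.post _ _ hs)).post _ _ hm

theorem Outcome.Good.andThen {o : Outcome} {f : Store → Outcome} {fuel : ℕ}
    {Q₁ Q : Store → Prop} {B₁ B : ℝ≥0∞} (h₁ : o.Good fuel Q₁ B₁)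
    (h₂ : ∀ s, Q₁ s → (f s).Good fuel Q B) : (o.andThen f).Good fuel Q (B₁ + B) where
  abort := (support_andThen_good h₁ h₂).1
  post := (support_andThen_good h₁ h₂).2
  mean_le := by
    rw [mean_andThen]
    refine add_le_add h₁.mean_le ?_
    calc _ ≤ ∑' r, o r * B := by
          refine ENNReal.tsum_le_tsum fun r => ?_
          by_cases hr : r ∈ o.support
          · refine mul_le_mul_right ?_ _
            obtain ⟨_ | s, n⟩ := r
            · simp [meanAfter]
            · exact (h₂ s (h₁.post _ _ hr)).mean_le
          · simp [(PMF.apply_eq_zero_iff _ _).2 hr]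
      _ = B := by rw [ENNReal.tsum_mul_right, PMF.tsum_coe, one_mul]

/-- The program `c`, started in `s`, is correct with respect to the postcondition `Q` and has
expected cost at most `B`; the only way for it to be aborted is to use up its fuel. -/
def Cmd.Runs (N : ℕ) (ops : (k : ℕ) → BasicOps k) (c : Cmd) (s : Store) (Q : Store → Prop)
    (B : ℝ≥0∞) : Prop :=
  ∀ fuel, (c.exec N ops fuel s).Good fuel Q B

variable {N : ℕ} {ops : (k : ℕ) → BasicOps k}

theorem Cmd.Runs.mono {c : Cmd} {s : Store} {Q Q' : Store → Prop} {B B' : ℝ≥0∞}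
    (h : c.Runs N ops s Q B) (hQ : ∀ s, Q s → Q' s) (hB : B ≤ B') : c.Runs N ops s Q' B' :=
  fun fuel => (h fuel).mono hQ hB

theorem Cmd.Runs.seq {c₁ c₂ : Cmd} {s : Store} {Q₁ Q : Store → Prop} {B₁ B₂ : ℝ≥0∞}
    (h₁ : c₁.Runs N ops s Q₁ B₁) (h₂ : ∀ s, Q₁ s → c₂.Runs N ops s Q B₂) :
    (Cmd.seq c₁ c₂).Runs N ops s Q (B₁ + B₂) :=
  fun fuel => (h₁ fuel).andThen fun s hs => h₂ s hs fuel

theorem Cmd.Runs.ifZero {x : Ref} {c₁ c₂ : Cmd} {s : Store} {Q : Store → Prop} {B : ℝ≥0∞}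
    (h₁ : s.read x = 0 → c₁.Runs N ops s Q B) (h₂ : s.read x ≠ 0 → c₂.Runs N ops s Q B) :
    (Cmd.ifZero x c₁ c₂).Runs N ops s Q (1 + B) := by
  intro fuel
  have key : ∀ {o : Outcome}, o.Good fuel Q B → o.tick.Good fuel Q (1 + B) := fun h =>
    ⟨fun n hn => (Nat.le_succ _).trans (h.tick.abort n hn), h.tick.post, h.tick.mean_le⟩
  rw [Cmd.exec]
  split_ifs with h
  · exact key (h₁ h fuel)
  · exact key (h₂ h fuel)

theorem Cmd.Wp.runs {c : Cmd} {s : Store} {Q : Store → Prop} {d : ℕ} (h : c.Wp N ops s Q)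
    (hc : c.Bounded) (hs : s.ix 0 = d) :
    c.Runs N ops s (fun s' => Frame c.arrs c.vars s s' ∧ Q s') (c.cost d) := by
  intro fuel
  obtain ⟨s', h₁, h₂⟩ := h
  obtain ⟨n, hn, he⟩ := Cmd.exec_of_eval fuel d hc hs h₁
  rw [he]
  refine (Outcome.Good.done ⟨Cmd.frame_of_eval h₁, h₂⟩).mono (fun _ h => h) ?_
  exact_mod_cast hn

/-- The rule for repeating a randomized body until it succeeds: if each pass through the body keeps
the invariant `Inv` and has success probability at least `p`, the expected number of passes is at
most `1 / p`. -/
theorem Cmd.runs_while {c : Cmd} {x : Ref} {s : Store} {Inv : Store → Prop} {B p : ℝ≥0∞}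
    (hp : p ≠ 0) (hp1 : p ≤ 1)
    (hc : ∀ s fuel, Inv s → s.read x ≠ 0 →
      ∃ (Ω : Type) (μ : PMF Ω) (g : Ω → Store) (n : Ω → ℕ),
        c.exec N ops fuel s = μ.map (fun a => (some (g a), n a)) ∧
        (∀ a, Inv (g a)) ∧ (∀ a, (n a : ℝ≥0∞) ≤ B) ∧
        p ≤ ∑' a, μ a * (if (g a).read x = 0 then 1 else 0))
    (hs : Inv s) :
    (Cmd.while x c).Runs N ops s (fun s' => Inv s' ∧ s'.read x = 0) (1 + (B + 2) / p) := by
  intro fuel₀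
  -- The expected cost is at most `1` for a loop that stops at its first test. For any other loop,
  -- the bound `E` reproduces itself by `E = 1 + (B + (1 + (1 - p) * E))`.
  have key : ∀ fuel s, Inv s →
      (Outcome.whileLoop (c.exec N ops fuel₀) x fuel s).Good fuel
        (fun s' => Inv s' ∧ s'.read x = 0)
        (if s.read x = 0 then 1 else (B + 2) / p) := by
    intro fuel
    induction fuel with
    | zero =>
      intro s _
      refine ⟨fun _ _ => Nat.zero_le _, fun s' n hn => ?_, ?_⟩
      · have := (PMF.mem_support_pure_iff _ _).1 hn
        simp at this
      · simp only [Outcome.whileLoop, Outcome.aborted]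
        rw [Outcome.mean_pure]
        simp
    | succ fuel ih =>
      intro s hs
      rw [Outcome.whileLoop]
      by_cases hx : s.read x = 0
      · rw [if_pos hx, if_pos hx]
        have h : (Outcome.done s).Good fuel (fun s' => Inv s' ∧ s'.read x = 0) ((0 : ℕ) : ℝ≥0∞) :=
          Outcome.Good.done ⟨hs, hx⟩
        exact h.tick.mono (fun _ h => h) (by simp)
      · rw [if_neg hx, if_neg hx]
        obtain ⟨Ω, μ, g, n, he, hI, hn, hpr⟩ := hc s fuel₀ hs hx
        have hb : (c.exec N ops fuel₀ s).Good fuel Inv B := by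
          rw [he]
          refine ⟨fun m hm => ?_, fun s' m hm => ?_, ?_⟩
          · obtain ⟨a, _, ha⟩ := (PMF.mem_support_map_iff _ _ _).1 hm
            cases ha
          · obtain ⟨a, _, ha⟩ := (PMF.mem_support_map_iff _ _ _).1 hm
            cases ha
            exact hI a
          · rw [Outcome.mean_map_cost]
            calc _ ≤ ∑' a, μ a * B := by gcongr with a; exact hn a
              _ = B := by rw [ENNReal.tsum_mul_right, PMF.tsum_coe, one_mul]
        have hsup := Outcome.support_andThen_good hb fun s' hs' => ih s' hs'
        have hmean : (Outcome.andThen (c.exec N ops fuel₀ s)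
            (Outcome.whileLoop (c.exec N ops fuel₀) x fuel)).mean ≤
              B + (1 + (1 - p) * ((B + 2) / p)) := by
          rw [Outcome.mean_andThen]
          refine add_le_add hb.mean_le ?_
          rw [he, Outcome.tsum_map]
          set z : Ω → ℝ≥0∞ := fun a => if (g a).read x = 0 then 1 else 0 with hz
          have hfail : ∑' a, μ a * (1 - z a) ≤ 1 - p := by
            have h1 : ∑' a, μ a * z a + ∑' a, μ a * (1 - z a) = 1 := by
              rw [← ENNReal.tsum_add, ← PMF.tsum_coe μ]
              refine tsum_congr fun a => ?_
              rw [← mul_add]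
              by_cases ha : (g a).read x = 0 <;> simp [hz, ha]
            have h2 : p + ∑' a, μ a * (1 - z a) ≤ 1 := by
              exact (add_le_add hpr le_rfl).trans h1.le
            exact ENNReal.le_sub_of_add_le_left (ne_top_of_le_ne_top ENNReal.one_ne_top hp1) h2
          calc _ ≤ ∑' a, (μ a * 1 + μ a * (1 - z a) * ((B + 2) / p)) := by
                refine ENNReal.tsum_le_tsum fun a => ?_
                rw [mul_assoc, ← mul_add]
                refine mul_le_mul_right ?_ _
                refine (ih (g a) (hI a)).mean_le.trans ?_
                by_cases ha : (g a).read x = 0 <;> simp [hz, ha]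
            _ = 1 + (∑' a, μ a * (1 - z a)) * ((B + 2) / p) := by
                rw [ENNReal.tsum_add, ENNReal.tsum_mul_right, ENNReal.tsum_mul_right,
                  PMF.tsum_coe, one_mul]
            _ ≤ _ := by gcongr
        refine (Outcome.Good.tick ⟨hsup.1, hsup.2, hmean⟩).mono (fun _ h => h) ?_
        have hpt : p ≠ ⊤ := ne_top_of_le_ne_top ENNReal.one_ne_top hp1
        calc 1 + (B + (1 + (1 - p) * ((B + 2) / p)))
            = p * ((B + 2) / p) + (1 - p) * ((B + 2) / p) := by
              rw [ENNReal.mul_div_cancel hp hpt]; ring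
          _ = (B + 2) / p := by
              rw [← add_mul, add_tsub_cancel_of_le hp1, one_mul]
          _ ≤ _ := le_rfl
  refine (key fuel₀ s hs).mono (fun _ h => h) ?_
  split_ifs
  · exact le_self_add
  · exact le_add_self

/-- By Markov's inequality the probability of running out of fuel tends to zero. -/
theorem Cmd.Runs.lasVegas {c : Cmd} {s : Store} {Q : Store → Prop} {B : ℝ≥0∞}
    (h : c.Runs N ops s Q B) (hB : B ≠ ⊤) : c.LasVegas N ops s Q B where
  correct fuel s' n hs := (h fuel).post s' n hs
  cost := iSup_le fun fuel => (h fuel).mean_le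
  halts := by
    refine le_antisymm (iSup_le fun fuel => ?_) ?_
    · exact (PMF.toOuterMeasure_mono _ (fun _ _ => trivial)).trans
        ((PMF.toOuterMeasure_apply_eq_one_iff _ (s := Set.univ)).2 (Set.subset_univ _)).le
    · have step : ∀ fuel : ℕ, fuel ≠ 0 → 1 ≤ c.haltingProb N ops s + B / fuel := by
        intro fuel hf
        set o := c.exec N ops fuel s with ho
        have h1 : o.toOuterMeasure {o | o.1.isSome} ≤ c.haltingProb N ops s :=
          le_iSup (fun fuel => (c.exec N ops fuel s).toOuterMeasure {o | o.1.isSome}) fuel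
        refine le_trans ?_ (add_le_add_left h1 _)
        rw [PMF.toOuterMeasure_apply, ← PMF.tsum_coe o]
        have h2 : (∑' r, o r * (r.2 : ℝ≥0∞)) / fuel ≤ B / fuel :=
          ENNReal.div_le_div_right (h fuel).mean_le _
        refine le_trans ?_ (add_le_add_right h2 _)
        rw [div_eq_mul_inv, ← ENNReal.tsum_mul_right, ← ENNReal.tsum_add]
        refine ENNReal.tsum_le_tsum fun r => ?_
        obtain ⟨_ | s', n⟩ := r
        · by_cases hr : (none, n) ∈ o.support
          · have hn := (h fuel).abort n hr
            refine le_add_left ?_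
            rw [mul_assoc]
            refine le_mul_of_one_le_right (zero_le) ?_
            rw [← div_eq_mul_inv, ENNReal.le_div_iff_mul_le (by simp [hf]) (by simp)]
            rw [one_mul]
            exact_mod_cast hn
          · simp [(PMF.apply_eq_zero_iff _ _).2 hr]
        · simp [Set.indicator]
      refine ENNReal.le_of_forall_pos_le_add fun ε hε _ => ?_
      obtain ⟨fuel, hf⟩ := ENNReal.exists_nat_mul_gt (a := (ε : ℝ≥0∞)) (b := B)
        (by simpa using hε.ne') hB
      have hf0 : fuel ≠ 0 := by rintro rfl; simp at hf
      refine (step fuel hf0).trans (add_le_add_right ?_ _)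
      rw [ENNReal.div_le_iff_le_mul (by simp [hf0]) (by simp), mul_comm]
      exact hf.le

/-! ### Generators of ideals in finite principal ideal rings -/

section FiniteRing

variable {R : Type*} [CommRing R] [Finite R]

/-- In a finite ring every element has an idempotent power; the idempotent splits the ring into a
part where the element is a unit and a part where it is nilpotent. -/
theorem exists_pow_isIdempotentElem (a : R) : ∃ k, 0 < k ∧ IsIdempotentElem (a ^ k) := by
  obtain ⟨i, j, hij, h⟩ : ∃ i j : ℕ, i < j ∧ a ^ i = a ^ j := by
    obtain ⟨i, j, hne, h⟩ := Finite.exists_ne_map_eq_of_infinite fun n : ℕ => a ^ n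
    rcases lt_or_gt_of_ne hne with hlt | hlt
    · exact ⟨i, j, hlt, h⟩
    · exact ⟨j, i, hlt, h.symm⟩
  obtain ⟨p, rfl⟩ := Nat.exists_eq_add_of_le hij.le
  have hp : 0 < p := by omega
  have hstep : ∀ n, i ≤ n → a ^ (n + p) = a ^ n := by
    intro n hn
    obtain ⟨l, rfl⟩ := Nat.exists_eq_add_of_le hn
    rw [add_right_comm, pow_add, ← h, ← pow_add]
  have hmul : ∀ t n, i ≤ n → a ^ (n + t * p) = a ^ n := by
    intro t
    induction t with
    | zero => simp
    | succ t ih => intro n hn; rw [add_one_mul, ← add_assoc, hstep _ (by omega), ih n hn]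
  refine ⟨(i + 1) * p, by positivity, ?_⟩
  rw [IsIdempotentElem, ← pow_add]
  exact hmul _ _ (by nlinarith)

/-- Units modulo an ideal of a finite ring lift to units. -/
theorem exists_unit_sub_mem (I : Ideal R) (a b : R) (h : a * b - 1 ∈ I) :
    ∃ u : Rˣ, (u : R) - a ∈ I := by
  obtain ⟨k, hk, he⟩ := exists_pow_isIdempotentElem a
  obtain ⟨m, rfl⟩ : ∃ m, k = m + 1 := ⟨k - 1, by omega⟩
  obtain ⟨e, hdef⟩ : ∃ e, e = a ^ (m + 1) := ⟨_, rfl⟩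
  rw [← hdef] at he
  have hee : e * e = e := he
  have h1 : 1 - e ∈ I := by
    have h2 : Ideal.Quotient.mk I a * Ideal.Quotient.mk I b = 1 := by
      rw [← map_mul, ← map_one (Ideal.Quotient.mk I)]
      exact Ideal.Quotient.eq.2 h
    have h3 : IsUnit (Ideal.Quotient.mk I e) := by
      rw [hdef, map_pow]
      exact (IsUnit.of_mul_eq_one _ h2).pow _
    have h4 : Ideal.Quotient.mk I e = 1 := by
      apply h3.mul_left_cancel
      rw [← map_mul, hee, mul_one]
    rw [← Ideal.Quotient.eq_zero_iff_mem, map_sub, h4, map_one, sub_self]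
  -- The element that equals `a` where `a` is a unit, and `1` where `a` is nilpotent.
  have hinv : (a * e + (1 - e)) * (a ^ m * e + (1 - e)) = 1 := by
    have h5 : a * a ^ m = e := by rw [hdef]; ring
    linear_combination (e * e) * h5 + (e + 2 - a - a ^ m) * hee
  refine ⟨⟨_, _, hinv, by rw [mul_comm]; exact hinv⟩, ?_⟩
  have h6 : a * e + (1 - e) - a = (1 - a) * (1 - e) := by ring
  simp only [h6]
  exact I.mul_mem_left _ h1

/-- If `(a, b)` is principal, it is generated by some `a + q * b`. -/
theorem exists_mem_span_add_mul [IsPrincipalIdealRing R] (a b : R) :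
    ∃ q, b ∈ Ideal.span {a + q * b} := by
  obtain ⟨g, hg⟩ := (IsPrincipalIdealRing.principal (Ideal.span {a, b})).principal
  have hg : Ideal.span {a, b} = Ideal.span {g} := hg
  obtain ⟨a', ha⟩ := Ideal.mem_span_singleton'.1 (hg ▸ Ideal.subset_span (by simp) :
    a ∈ Ideal.span {g})
  obtain ⟨b', hb⟩ := Ideal.mem_span_singleton'.1 (hg ▸ Ideal.subset_span (by simp) :
    b ∈ Ideal.span {g})
  obtain ⟨s, t, hst⟩ := Ideal.mem_span_pair.1 (hg ▸ Ideal.mem_span_singleton_self g :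
    g ∈ Ideal.span {a, b})
  -- Modulo the annihilator of `g`, the cofactors `a'` and `b'` are coprime.
  let J : Ideal R := Ideal.span {1 - (s * a' + t * b')}
  obtain ⟨u, hu⟩ := exists_unit_sub_mem (Ideal.span {b'} ⊔ J) a' s (by
    have h1 : a' * s - 1 = (-t) * b' + (-1) * (1 - (s * a' + t * b')) := by ring
    rw [h1]
    exact add_mem (Ideal.mem_sup_left (Ideal.mul_mem_left _ _ (Ideal.mem_span_singleton_self _)))
      (Ideal.mem_sup_right (Ideal.mul_mem_left _ _ (Ideal.mem_span_singleton_self _))))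
  obtain ⟨y, hy, z, hz, hyz⟩ := Submodule.mem_sup.1 hu
  obtain ⟨q, rfl⟩ := Ideal.mem_span_singleton'.1 hy
  obtain ⟨r, rfl⟩ := Ideal.mem_span_singleton'.1 hz
  refine ⟨q, Ideal.mem_span_singleton'.2 ⟨b' * ↑u⁻¹, ?_⟩⟩
  have hug : (u : R) * g = a + q * b := by
    linear_combination (-g) * hyz + (1 - r * s) * ha + (q - r * t) * hb - r * hst
  rw [← hug]
  linear_combination b' * g * u.inv_mul + hb

/-- Among all `r`, the proportion of those for which `a + r * b` generates `(a, b)` is at least the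
proportion of units. -/
theorem card_units_le_card_generators [IsPrincipalIdealRing R] (a b : R) :
    Nat.card Rˣ ≤ Nat.card {r : R // b ∈ Ideal.span {a + r * b}} := by
  classical
  obtain ⟨q, hq⟩ := exists_mem_span_add_mul a b
  obtain ⟨w, hw⟩ := Ideal.mem_span_singleton'.1 hq
  -- `a + (q + t) * b` is a multiple of the generator `a + q * b` by `1 + t * w`.
  let S := {t : R // IsUnit (1 + t * w)}
  have hS : Nat.card S ≤ Nat.card {r : R // b ∈ Ideal.span {a + r * b}} := by
    refine Nat.card_le_card_of_injective (fun t : S => ⟨q + t.1, ?_⟩) fun t t' h => ?_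
    · obtain ⟨u, hu⟩ := t.2
      refine Ideal.mem_span_singleton'.2 ⟨w * ↑u⁻¹, ?_⟩
      have h1 : a + (q + t.1) * b = u * (a + q * b) := by rw [hu]; linear_combination (-t.1) * hw
      rw [h1]
      linear_combination w * (a + q * b) * u.inv_mul + hw
    · exact Subtype.ext (add_left_cancel (congrArg Subtype.val h))
  refine le_trans ?_ hS
  -- Count the pairs of a class modulo `w` and an element `t` that occur.
  let f : R →+ R := AddMonoidHom.mulRight w
  have hcard : Nat.card (R ⧸ f.range) = Nat.card f.ker := by
    have h1 := AddSubgroup.card_eq_card_quotient_mul_card_addSubgroup f.range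
    have h2 := AddSubgroup.card_eq_card_quotient_mul_card_addSubgroup f.ker
    have h3 := Nat.card_congr (QuotientAddGroup.quotientKerEquivRange f).toEquiv
    rw [h3, h1, mul_comm] at h2
    exact Nat.eq_of_mul_eq_mul_left (Nat.card_pos (α := f.range)) h2
  obtain ⟨φ⟩ : Nonempty (R ⧸ f.range ≃ f.ker) := Finite.card_eq.1 hcard
  let π : Rˣ → R ⧸ f.range := fun u => QuotientAddGroup.mk (u : R)
  let σ : Rˣ → Rˣ := fun u => Function.invFun π (π u)
  let τ : R → R := Function.invFun fun t => 1 + t * w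
  have hτ : ∀ u : Rˣ, 1 + τ (u * ↑(σ u)⁻¹) * w = u * ↑(σ u)⁻¹ := by
    intro u
    have h : π (σ u) = π u := Function.invFun_eq ⟨u, rfl⟩
    obtain ⟨t, ht⟩ := QuotientAddGroup.eq.1 h
    have ht : t * w = -(σ u : R) + u := ht
    refine Function.invFun_eq (f := fun t => 1 + t * w) ⟨t * ↑(σ u)⁻¹, ?_⟩
    linear_combination (↑(σ u)⁻¹ : R) * ht - (σ u).mul_inv
  have hk : ∀ k : f.ker, (k : R) * w = 0 := fun k => k.2
  -- A unit is determined by its class and its quotient by the representative of the class; the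
  -- latter is `1 + t * w`, and shifting `t` by the annihilator of `w` makes room for the class.
  refine Nat.card_le_card_of_injective
    (fun u : Rˣ => (⟨τ (u * ↑(σ u)⁻¹) + φ (π u), ?_⟩ : S)) fun u v h => ?_
  · rw [add_mul, hk, add_zero, hτ]
    exact (u * (σ u)⁻¹).isUnit
  · have h1 : τ (u * ↑(σ u)⁻¹) + φ (π u) = τ (v * ↑(σ v)⁻¹) + φ (π v) := congrArg Subtype.val h
    have h2 : (u : R) * ↑(σ u)⁻¹ = v * ↑(σ v)⁻¹ := by
      rw [← hτ u, ← hτ v]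
      linear_combination w * h1 - hk (φ (π u)) + hk (φ (π v))
    rw [h2] at h1
    have h3 : π u = π v := φ.injective (Subtype.ext (add_left_cancel h1))
    have h4 : σ u = σ v := congrArg (Function.invFun π) h3
    rw [h4] at h2
    exact Units.ext ((σ v)⁻¹.isUnit.mul_right_cancel h2)

/-- The same proportion for a random element of `(b)` that is drawn as the image of a uniformly
distributed element of a finite group. -/
theorem card_units_mul_card_le [IsPrincipalIdealRing R] {A : Type*} [AddCommGroup A] [Finite A]
    (f : A →+ R) (a b : R) (hf : ∀ y, y ∈ f.range ↔ y ∈ Ideal.span {b}) :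
    Nat.card Rˣ * Nat.card A ≤
      Nat.card {x : A // ∀ y ∈ f.range, y ∈ Ideal.span {a + f x}} * Nat.card R := by
  classical
  have hmem : ∀ z, (∀ y ∈ f.range, y ∈ Ideal.span {z}) ↔ b ∈ Ideal.span {z} := fun z =>
    ⟨fun h => h b ((hf b).2 (Ideal.mem_span_singleton_self b)), fun h y hy =>
      (Ideal.span_singleton_le_iff_mem _).2 h ((hf y).1 hy)⟩
  simp only [hmem]
  -- Pairs `(r, x)` are matched with pairs `(x', r')` such that `f x' = r * b` and `r' * b = f x`.
  have hr : ∀ x, ∃ r, r * b = f x := fun x => Ideal.mem_span_singleton'.1 ((hf _).1 ⟨x, rfl⟩)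
  have hx : ∀ r, ∃ x, f x = r * b := fun r =>
    (hf _).2 (Ideal.mem_span_singleton'.2 ⟨r, rfl⟩)
  let ρ : R → R := Function.invFun fun r => r * b
  let ξ : R → A := Function.invFun f
  have hρ : ∀ x, ρ (f x) * b = f x := fun x => Function.invFun_eq (f := fun r => r * b) (hr x)
  have hρ' : ∀ r, ρ (r * b) * b = r * b := fun r =>
    Function.invFun_eq (f := fun r => r * b) ⟨r, rfl⟩
  have hξ : ∀ r, f (ξ (r * b)) = r * b := fun r => Function.invFun_eq (hx r)
  have hξ' : ∀ x, f (ξ (f x)) = f x := fun x => Function.invFun_eq ⟨x, rfl⟩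
  have e1 : ∀ r x, f (ξ (r * b) + x - ξ (f x)) = r * b := fun r x => by
    rw [map_sub, map_add, hξ, hξ', add_sub_cancel_right]
  have e2 : ∀ r x, (ρ (f x) + r - ρ (r * b)) * b = f x := fun r x => by
    rw [sub_mul, add_mul, hρ, hρ', add_sub_cancel_right]
  have key : Nat.card {r : R // b ∈ Ideal.span {a + r * b}} * Nat.card A =
      Nat.card {x : A // b ∈ Ideal.span {a + f x}} * Nat.card R := by
    rw [← Nat.card_prod, ← Nat.card_prod]
    refine Nat.card_congr
      ⟨fun p => (⟨ξ (p.1.1 * b) + p.2 - ξ (f p.2), by rw [e1]; exact p.1.2⟩,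
          ρ (f p.2) + p.1.1 - ρ (p.1.1 * b)),
        fun p => (⟨ρ (f p.1.1) + p.2 - ρ (p.2 * b), by rw [e2]; exact p.1.2⟩,
          ξ (p.2 * b) + p.1.1 - ξ (f p.1.1)), ?_, ?_⟩
    · rintro ⟨⟨r, hr⟩, x⟩
      simp [e1, e2]
    · rintro ⟨⟨x, hx⟩, r⟩
      simp [e1, e2]
  calc _ ≤ _ := Nat.mul_le_mul_right _ (card_units_le_card_generators a b)
    _ = _ := key

end FiniteRing

/-! ### Howell bases -/

section Howell

variable {Z : Type*} [CommRing Z]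

/-- The span of the rows of `T` with numbers in `[i, W)`. Vectors are functions on `ℕ`;
those of length `W` vanish from `W` on. -/
def rowSpan (T : ℕ → ℕ → Z) (i W : ℕ) : Submodule Z (ℕ → Z) :=
  Submodule.span Z (T '' Set.Ico i W)

theorem rowSpan_mono (T : ℕ → ℕ → Z) {i j W : ℕ} (h : i ≤ j) : rowSpan T j W ≤ rowSpan T i W :=
  Submodule.span_mono (Set.image_mono (Set.Ico_subset_Ico_left h))

theorem row_mem_rowSpan (T : ℕ → ℕ → Z) {i j W : ℕ} (h : i ≤ j) (hj : j < W) :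
    T j ∈ rowSpan T i W :=
  Submodule.subset_span ⟨j, ⟨h, hj⟩, rfl⟩

theorem rowSpan_le (T : ℕ → ℕ → Z) {i W : ℕ} {S : Submodule Z (ℕ → Z)}
    (h : ∀ j, i ≤ j → j < W → T j ∈ S) : rowSpan T i W ≤ S := by
  refine Submodule.span_le.2 ?_
  rintro _ ⟨j, hj, rfl⟩
  exact h j hj.1 hj.2

theorem exists_of_mem_rowSpan {T : ℕ → ℕ → Z} {i W : ℕ} (hi : i < W) {v : ℕ → Z}
    (hv : v ∈ rowSpan T i W) : ∃ c : Z, ∃ u ∈ rowSpan T (i + 1) W, v = c • T i + u := by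
  have h : Set.Ico i W = insert i (Set.Ico (i + 1) W) := by
    ext j; simp only [Set.mem_Ico, Set.mem_insert_iff]; omega
  rw [rowSpan, h, Set.image_insert_eq] at hv
  obtain ⟨c, u, hu, rfl⟩ := Submodule.mem_span_insert.1 hv
  exact ⟨c, u, hu, rfl⟩

/-- The rows of `T` with numbers less than `W` form an upper triangular matrix. -/
def IsTriangular (T : ℕ → ℕ → Z) (W : ℕ) : Prop := ∀ i < W, ∀ j < i, T i j = 0

theorem IsTriangular.apply_eq_zero {T : ℕ → ℕ → Z} {W i : ℕ} (hT : IsTriangular T W) {v : ℕ → Z}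
    (hv : v ∈ rowSpan T i W) {j : ℕ} (hj : j < i) : v j = 0 := by
  have h : rowSpan T i W ≤ LinearMap.ker (LinearMap.proj (R := Z) (φ := fun _ : ℕ => Z) j) :=
    rowSpan_le T fun l hl hlW => hT l hlW j (by omega)
  exact h hv

/-- `T` is a triangular basis with Howell's property: the elements of `G` that vanish in the first
`i` coordinates are combinations of the rows with numbers at least `i`. -/
structure IsHowell (T : ℕ → ℕ → Z) (W : ℕ) (G : Submodule Z (ℕ → Z)) : Prop where
  tri : IsTriangular T W
  mem : ∀ i < W, T i ∈ G
  span : ∀ i ≤ W, ∀ v ∈ G, (∀ j < i, v j = 0) → v ∈ rowSpan T i W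

/-- The effect of inserting the vector `v` into the rows of `T` from number `a` on. -/
structure Inserted (a W : ℕ) (T : ℕ → ℕ → Z) (v : ℕ → Z) (T' : ℕ → ℕ → Z) : Prop where
  tri : IsTriangular T' W
  below : ∀ i < a, T' i = T i
  span : rowSpan T' a W = rowSpan T a W ⊔ Submodule.span Z {v}

/-- The state of an insertion in which the columns before `j` have been dealt with and the vector
has become `v'`. -/
structure Inserting (a W : ℕ) (T : ℕ → ℕ → Z) (v : ℕ → Z) (j : ℕ) (T' : ℕ → ℕ → Z)
    (v' : ℕ → Z) : Prop where
  tri : IsTriangular T' W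
  below : ∀ i < a, T' i = T i
  span : rowSpan T' a W ⊔ Submodule.span Z {v'} = rowSpan T a W ⊔ Submodule.span Z {v}
  zero : ∀ k < j, v' k = 0

/-- A transformation of determinant one of two vectors does not change their span. -/
theorem span_pair_transform {M : Type*} [AddCommGroup M] [Module Z M] (p v : M) {s t u w : Z}
    (h : s * w - u * t = 1) :
    Submodule.span Z {s • p + t • v} ⊔ Submodule.span Z {u • p + w • v} =
      Submodule.span Z {p} ⊔ Submodule.span Z {v} := by
  simp only [← Submodule.span_union, Set.singleton_union]
  refine le_antisymm (Submodule.span_le.2 ?_) (Submodule.span_le.2 ?_)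
  · rintro _ (rfl | rfl)
    · exact Submodule.mem_span_pair.2 ⟨_, _, rfl⟩
    · exact Submodule.mem_span_pair.2 ⟨_, _, rfl⟩
  · rintro x (hx | hx)
    · refine Submodule.mem_span_pair.2 ⟨w, -t, ?_⟩
      calc _ = (s * w - u * t) • p := by module
        _ = x := by rw [h, one_smul, hx]
    · refine Submodule.mem_span_pair.2 ⟨-u, s, ?_⟩
      calc _ = (s * w - u * t) • v := by module
        _ = x := by rw [h, one_smul, Set.mem_singleton_iff.1 hx]

theorem rowSpan_update (T : ℕ → ℕ → Z) {a j W : ℕ} (ha : a ≤ j) (hj : j < W) (p : ℕ → Z) :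
    rowSpan (Function.update T j p) a W =
      Submodule.span Z {p} ⊔ Submodule.span Z (T '' (Set.Ico a W \ {j})) := by
  have h : Set.Ico a W = insert j (Set.Ico a W \ {j}) := by
    ext l; simp only [Set.mem_Ico, Set.mem_insert_iff, Set.mem_sdiff, Set.mem_singleton_iff]; omega
  rw [rowSpan, ← Submodule.span_union, Set.singleton_union]
  congr 1
  conv_lhs => rw [h, Set.image_insert_eq]
  rw [Function.update_self]
  congr 1
  refine Set.image_congr fun l hl => ?_
  exact Function.update_of_ne hl.2 _ _

/-- The extended gcd of the diagonal entry and the entry of the vector clears column `j` of the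
vector, by a transformation of determinant one. -/
theorem Inserting.step {a W j : ℕ} {T T' : ℕ → ℕ → Z} {v v' : ℕ → Z}
    (h : Inserting a W T v j T' v') (ha : a ≤ j) (hj : j < W) {g s t u w : Z}
    (hx : IsXgcdResult (T' j j) (v' j) g s t u w) :
    Inserting a W T v (j + 1) (Function.update T' j (s • T' j + t • v')) (u • T' j + w • v') := by
  obtain ⟨_, _, hx0, hdet⟩ := hx
  refine ⟨fun i hi k hk => ?_, fun i hi => ?_, ?_, fun k hk => ?_⟩
  · by_cases hij : i = j
    · subst hij
      simp [h.tri i hi k hk, h.zero k hk]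
    · rw [Function.update_of_ne hij]; exact h.tri i hi k hk
  · rw [Function.update_of_ne (by omega)]; exact h.below i hi
  · rw [← h.span, rowSpan_update _ ha hj, sup_right_comm, span_pair_transform _ _ hdet,
      sup_right_comm, ← rowSpan_update _ ha hj, Function.update_eq_self]
  · rcases Nat.lt_succ_iff_lt_or_eq.1 hk with hk | rfl
    · simp [h.zero k hk, h.tri j hj k hk]
    · simpa using hx0

/-- The columns before `a` need no treatment, since the inserted vector vanishes there. -/
theorem Inserting.skip {a W j : ℕ} {T T' : ℕ → ℕ → Z} {v v' : ℕ → Z}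
    (h : Inserting a W T v j T' v') (ha : j < a) (hv : ∀ k < a, v k = 0) (hvv : v' = v) :
    Inserting a W T v (j + 1) T' v' :=
  ⟨h.tri, h.below, h.span, fun k hk => hvv ▸ hv k (by omega)⟩

theorem Inserting.done {a W : ℕ} {T T' : ℕ → ℕ → Z} {v v' : ℕ → Z}
    (h : Inserting a W T v W T' v') (hv : ∀ k, W ≤ k → v' k = 0) : Inserted a W T v T' := by
  have h0 : v' = 0 := funext fun k => by
    rcases lt_or_ge k W with hk | hk
    · exact h.zero k hk
    · exact hv k hk
  refine ⟨h.tri, h.below, ?_⟩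
  rw [← h.span, h0]
  simp

/-- The first phase of the computation of a Howell basis: the rows span `G`. -/
structure HowellGen (T : ℕ → ℕ → Z) (W : ℕ) (G : Submodule Z (ℕ → Z)) (gen : ℕ → ℕ → Z)
    (r : ℕ) : Prop where
  tri : IsTriangular T W
  mem : ∀ i < W, T i ∈ G
  gen : ∀ l < r, gen l ∈ rowSpan T 0 W

theorem Inserted.mem {a W : ℕ} {T T' : ℕ → ℕ → Z} {v : ℕ → Z} {G : Submodule Z (ℕ → Z)}
    (hI : Inserted a W T v T') (hT : ∀ i < W, T i ∈ G) (hv : v ∈ G) : ∀ i < W, T' i ∈ G := by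
  intro i hi
  rcases lt_or_ge i a with h | h
  · rw [hI.below i h]; exact hT i hi
  · have h1 : T' i ∈ rowSpan T' a W := row_mem_rowSpan T' h hi
    rw [hI.span] at h1
    refine (sup_le (rowSpan_le T fun j _ hj => hT j hj) ?_ : _ ≤ G) h1
    exact (Submodule.span_singleton_le_iff_mem _ _).2 hv

theorem HowellGen.insert {T T' : ℕ → ℕ → Z} {W : ℕ} {G : Submodule Z (ℕ → Z)} {gen : ℕ → ℕ → Z}
    {r : ℕ} (h : HowellGen T W G gen r) (hr : gen r ∈ G) (hI : Inserted 0 W T (gen r) T') :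
    HowellGen T' W G gen (r + 1) := by
  refine ⟨hI.tri, hI.mem h.mem hr, fun l hl => ?_⟩
  rw [hI.span]
  rcases Nat.lt_succ_iff_lt_or_eq.1 hl with hl | rfl
  · exact Submodule.mem_sup_left (h.gen l hl)
  · exact Submodule.mem_sup_right (Submodule.mem_span_singleton_self _)

/-- The second phase: Howell's property holds for vectors that vanish in at most `r` leading
coordinates. -/
structure HowellUpTo (T : ℕ → ℕ → Z) (W : ℕ) (G : Submodule Z (ℕ → Z)) (r : ℕ) : Prop where
  tri : IsTriangular T W
  mem : ∀ i < W, T i ∈ G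
  span : ∀ i ≤ r, ∀ v ∈ G, (∀ j < i, v j = 0) → v ∈ rowSpan T i W

theorem HowellGen.howellUpTo {T : ℕ → ℕ → Z} {W : ℕ} {G : Submodule Z (ℕ → Z)} {gen : ℕ → ℕ → Z}
    {r : ℕ} (h : HowellGen T W G gen r) (hG : G ≤ Submodule.span Z (gen '' Set.Iio r)) :
    HowellUpTo T W G 0 := by
  refine ⟨h.tri, h.mem, fun i hi v hv _ => ?_⟩
  obtain rfl : i = 0 := by omega
  refine (Submodule.span_le.2 ?_ : Submodule.span Z (gen '' Set.Iio r) ≤ _) (hG hv)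
  rintro _ ⟨l, hl, rfl⟩
  exact h.gen l hl

/-- A vector of `G` that vanishes in the first `r + 1` coordinates is a combination `c • T r + u` of
the rows from `r` on, in which `c` annihilates the diagonal entry `T r r`. Hence `c • T r` is a
multiple of the vector that has been inserted into the rows below `r`. -/
theorem HowellUpTo.insert {T T' : ℕ → ℕ → Z} {W : ℕ} {G : Submodule Z (ℕ → Z)} {r : ℕ}
    (h : HowellUpTo T W G r) (hr : r < W) {a : Z} (ha : IsAnnResult (T r r) a)
    (hI : Inserted (r + 1) W T (a • T r) T') : HowellUpTo T' W G (r + 1) := by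
  have hle : ∀ i ≤ r + 1, rowSpan T i W ≤ rowSpan T' i W := by
    intro i hi
    refine rowSpan_le T fun j hij hj => ?_
    rcases lt_or_ge j (r + 1) with hjr | hjr
    · rw [← hI.below j hjr]; exact row_mem_rowSpan T' hij hj
    · refine rowSpan_mono T' hi ?_
      rw [hI.span]
      exact Submodule.mem_sup_left (row_mem_rowSpan T hjr hj)
  refine ⟨hI.tri, hI.mem h.mem (G.smul_mem _ (h.mem r hr)), fun i hi v hv h0 => ?_⟩
  rcases Nat.lt_succ_iff_lt_or_eq.1 (Nat.lt_succ_of_le hi) with hi' | rfl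
  · exact hle i hi (h.span i (by omega) v hv h0)
  · obtain ⟨c, u, hu, rfl⟩ := exists_of_mem_rowSpan hr
      (h.span r le_rfl v hv fun j hj => h0 j (by omega))
    have hc : c * T r r = 0 := by
      have := h0 r (by omega)
      simpa [h.tri.apply_eq_zero hu (Nat.lt_succ_self r)] using this
    obtain ⟨b, rfl⟩ := Ideal.mem_span_singleton'.1 ((ha c).2 hc)
    rw [hI.span, mul_smul, add_comm (b • _)]
    exact Submodule.add_mem_sup hu
      (Submodule.smul_mem _ _ (Submodule.mem_span_singleton_self _))

theorem HowellUpTo.isHowell {T : ℕ → ℕ → Z} {W : ℕ} {G : Submodule Z (ℕ → Z)}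
    (h : HowellUpTo T W G W) : IsHowell T W G := ⟨h.tri, h.mem, h.span⟩

end Howell

section Graph

variable {Z : Type*} [CommRing Z]

/-- The graph of the linear map `x ↦ x A` given by a matrix with `d` rows and columns, as vectors
`(x A, x)` of length `2 d`. -/
def graph (d : ℕ) (A : ℕ → ℕ → Z) : Submodule Z (ℕ → Z) where
  carrier := {v | (∀ k < d, v k = ∑ j ∈ Finset.range d, v (d + j) * A j k) ∧
    ∀ k, 2 * d ≤ k → v k = 0}
  zero_mem' := by simp
  add_mem' := by
    rintro v w ⟨hv, hv'⟩ ⟨hw, hw'⟩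
    refine ⟨fun k hk => ?_, fun k hk => ?_⟩
    · simp [hv k hk, hw k hk, add_mul, Finset.sum_add_distrib]
    · simp [hv' k hk, hw' k hk]
  smul_mem' := by
    rintro c v ⟨hv, hv'⟩
    refine ⟨fun k hk => ?_, fun k hk => ?_⟩
    · simp [hv k hk, Finset.mul_sum, mul_assoc]
    · simp [hv' k hk]

/-- The vector `(x A, x)`, for `x` the `r`-th unit vector. -/
def graphGen (d : ℕ) (A : ℕ → ℕ → Z) (r k : ℕ) : Z :=
  if k < d then A r k else if k = d + r then 1 else 0

theorem graphGen_mem (d : ℕ) (A : ℕ → ℕ → Z) {r : ℕ} (hr : r < d) : graphGen d A r ∈ graph d A := by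
  refine ⟨fun k hk => ?_, fun k hk => ?_⟩
  · rw [Finset.sum_eq_single r]
    · simp [graphGen, hk]
    · intro j _ hj
      simp [graphGen, hj]
    · simp [hr]
  · simp only [graphGen]
    rw [if_neg (by omega), if_neg (by omega)]

theorem graph_le_span (d : ℕ) (A : ℕ → ℕ → Z) :
    graph d A ≤ Submodule.span Z (graphGen d A '' Set.Iio d) := by
  rintro v ⟨hv, hv'⟩
  have h : v = ∑ j ∈ Finset.range d, v (d + j) • graphGen d A j := by
    funext k
    rw [Finset.sum_apply]
    rcases lt_or_ge k d with hk | hk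
    · rw [hv k hk]
      simp [graphGen, hk]
    · obtain ⟨l, rfl⟩ := Nat.exists_eq_add_of_le hk
      rcases lt_or_ge l d with hl | hl
      · rw [Finset.sum_eq_single l]
        · simp [graphGen]
        · intro j _ hj
          simp [graphGen, Ne.symm hj]
        · simp [hl]
      · rw [hv' _ (by omega)]
        refine (Finset.sum_eq_zero fun j hj => ?_).symm
        have := Finset.mem_range.1 hj
        have hne : l ≠ j := by omega
        simp [graphGen, hne]
  rw [h]
  exact Submodule.sum_mem _ fun j hj => Submodule.smul_mem _ _
    (Submodule.subset_span ⟨j, Finset.mem_range.1 hj, rfl⟩)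

/-- The equation `x A = y` is solvable. -/
def Solvable (d : ℕ) (A : ℕ → ℕ → Z) (y : ℕ → Z) : Prop :=
  ∃ x : ℕ → Z, ∀ k < d, y k = ∑ j ∈ Finset.range d, x j * A j k

/-- The state of the reduction of the vector `(y, 0)` by a Howell basis of the graph after `i`
steps. -/
structure Reducing (d : ℕ) (A : ℕ → ℕ → Z) (y : ℕ → Z) (i : ℕ) (v : ℕ → Z) : Prop where
  /-- The vector changes by elements of the graph only. -/
  sub_mem : (fun k => if k < d then y k else 0) - v ∈ graph d A
  zero : Solvable d A y → ∀ k < i, v k = 0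

/-- If the equation is solvable, then the leading entry of the reduced vector is a multiple of the
diagonal entry of the Howell basis, so that it can be cleared. -/
theorem Reducing.step {d : ℕ} {A : ℕ → ℕ → Z} {y v : ℕ → Z} {i : ℕ} {T : ℕ → ℕ → Z}
    (h : Reducing d A y i v) (hT : IsHowell T (2 * d) (graph d A)) (hi : i < d) {q : Z}
    (hq : T i i ∣ v i → IsDivResult (v i) (T i i) q) : Reducing d A y (i + 1) (v - q • T i) := by
  constructor
  · rw [← sub_add]
    exact Submodule.add_mem _ h.sub_mem (Submodule.smul_mem _ _ (hT.mem i (by omega)))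
  · rintro hs k hk
    have h0 := h.zero hs
    rcases Nat.lt_succ_iff_lt_or_eq.1 hk with hk | rfl
    · simp [h0 k hk, hT.tri i (by omega) k hk]
    · -- Subtracting from `(y, x)` the accumulated change gives an element of the graph.
      obtain ⟨x, hx⟩ := hs
      let z : ℕ → Z := fun l => if l < d then y l else if l < 2 * d then x (l - d) else 0
      have hz : z ∈ graph d A := by
        refine ⟨fun l hl => ?_, fun l hl => ?_⟩
        · simp only [z, if_pos hl, hx l hl]
          refine Finset.sum_congr rfl fun j hj => ?_
          have := Finset.mem_range.1 hj
          rw [if_neg (by omega), if_pos (by omega), Nat.add_sub_cancel_left]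
        · simp only [z]; rw [if_neg (by omega), if_neg (by omega)]
      have hz' := Submodule.sub_mem _ hz h.sub_mem
      set z' := z - ((fun l => if l < d then y l else 0) - v) with hz'def
      have hzv : ∀ l < d, z' l = v l := fun l hl => by simp [hz'def, z, hl]
      obtain ⟨c, u, hu, hcu⟩ := exists_of_mem_rowSpan (by omega)
        (hT.span k (by omega) z' hz' fun j hj => by rw [hzv j (by omega), h0 j hj])
      have hvk : v k = c * T k k := by
        rw [← hzv k hi, hcu]
        simp [hT.tri.apply_eq_zero hu (Nat.lt_succ_self k)]
      have hdiv := hq ⟨c, by rw [hvk, mul_comm]⟩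
      simp only [IsDivResult] at hdiv
      simp [← hdiv, mul_comm]

theorem Reducing.start (d : ℕ) (A : ℕ → ℕ → Z) (y : ℕ → Z) :
    Reducing d A y 0 (fun k => if k < d then y k else 0) :=
  ⟨by rw [sub_self]; exact Submodule.zero_mem _, fun _ k hk => absurd hk (Nat.not_lt_zero _)⟩

/-- When the reduction succeeds, the right half of the vector is minus a solution. -/
theorem Reducing.solution {d : ℕ} {A : ℕ → ℕ → Z} {y v : ℕ → Z} (h : Reducing d A y d v)
    (hv : ∀ k < d, v k = 0) (k : ℕ) (hk : k < d) :
    y k = ∑ j ∈ Finset.range d, -v (d + j) * A j k := by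
  have := h.sub_mem.1 k hk
  simpa [hk, hv k hk] using this

theorem Reducing.solvable_iff {d : ℕ} {A : ℕ → ℕ → Z} {y v : ℕ → Z} (h : Reducing d A y d v) :
    Solvable d A y ↔ ∀ k < d, v k = 0 :=
  ⟨fun hs => h.zero hs, fun hv => ⟨fun j => -v (d + j), h.solution hv⟩⟩

/-- The right halves of the last `d` rows of a Howell basis of the graph span the kernel. -/
theorem IsHowell.kernel {d : ℕ} {A : ℕ → ℕ → Z} {T : ℕ → ℕ → Z}
    (hT : IsHowell T (2 * d) (graph d A)) (x : ℕ → Z) :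
    (∀ k < d, ∑ j ∈ Finset.range d, x j * A j k = 0) ↔
      ∃ c : ℕ → Z, ∀ k < d, x k = ∑ l ∈ Finset.range d, c l * T (d + l) (d + k) := by
  constructor
  · intro hx
    let v : ℕ → Z := fun k => if k < d then 0 else if k < 2 * d then x (k - d) else 0
    have hvx : ∀ k < d, v (d + k) = x k := fun k hk => by
      simp only [v]; rw [if_neg (by omega), if_pos (by omega), Nat.add_sub_cancel_left]
    have hv : v ∈ graph d A := by
      refine ⟨fun k hk => ?_, fun k hk => ?_⟩
      · rw [show v k = 0 by simp [v, hk], ← hx k hk]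
        exact Finset.sum_congr rfl fun j hj => by rw [← hvx j (Finset.mem_range.1 hj)]
      · simp only [v]; rw [if_neg (by omega), if_neg (by omega)]
    have hs := hT.span d (by omega) v hv fun j hj => by simp [v, hj]
    have himg : T '' Set.Ico d (2 * d) = (fun l => T (d + l)) '' (Finset.range d : Set ℕ) := by
      ext w
      simp only [Set.mem_image, Set.mem_Ico, Finset.coe_range, Set.mem_Iio]
      constructor
      · rintro ⟨j, ⟨h1, h2⟩, rfl⟩
        exact ⟨j - d, by omega, by rw [Nat.add_sub_cancel' h1]⟩
      · rintro ⟨j, h1, rfl⟩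
        exact ⟨d + j, by omega, rfl⟩
    rw [rowSpan, himg] at hs
    obtain ⟨c, hc⟩ := (Submodule.mem_span_image_finset_iff_exists_fun' Z).1 hs
    refine ⟨c, fun k hk => ?_⟩
    rw [← hvx k hk, ← hc]
    simp [Finset.sum_apply]
  · rintro ⟨c, hc⟩ k hk
    have h1 : ∀ l < d, ∑ j ∈ Finset.range d, T (d + l) (d + j) * A j k = 0 := fun l hl => by
      rw [← (hT.mem (d + l) (by omega)).1 k hk]
      exact hT.tri (d + l) (by omega) k (by omega)
    calc _ = ∑ j ∈ Finset.range d, ∑ l ∈ Finset.range d, c l * (T (d + l) (d + j) * A j k) := by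
          refine Finset.sum_congr rfl fun j hj => ?_
          rw [hc j (Finset.mem_range.1 hj), Finset.sum_mul]
          simp only [mul_assoc]
      _ = 0 := by
          rw [Finset.sum_comm]
          refine Finset.sum_eq_zero fun l hl => ?_
          rw [← Finset.mul_sum, h1 l (Finset.mem_range.1 hl), mul_zero]

end Graph

/-! ### The building blocks of the programs -/

/-- Sequential composition. -/
infixr:65 " ;; " => Cmd.seq

/-- The numbers that embed `ℤ/n_iℤ` into `ℤ/Nℤ`. -/
notation "arrC" => Arr.work 0
/-- The Howell basis. -/
notation "arrT" => Arr.work 1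
/-- The vector that is being inserted or reduced. -/
notation "arrV" => Arr.work 2
/-- The random coefficients. -/
notation "arrX" => Arr.work 3
/-- The elements of which random combinations are formed. -/
notation "arrG" => Arr.work 4
/-- The element to which a random combination is added. -/
notation "arrB" => Arr.work 5
/-- The current element of the residue ring. -/
notation "arrE" => Arr.work 6
/-- The matrix of the multiplication by the current element. -/
notation "arrM" => Arr.work 7
/-- The right-hand side of a linear equation. -/
notation "arrY" => Arr.work 8
/-- The failure flag. -/
notation "arrF" => Arr.work 9
/-- The negative of the unit element. -/
notation "arrU" => Arr.work 10

/-- The cell holding `N`. -/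
abbrev refN : Ref := ⟨.modulus, []⟩

/-- The `t`-th scalar work cell. -/
abbrev tmp (t : ℕ) : Ref := ⟨.work (20 + t), []⟩

/-- The index expression `d`. -/
abbrev dimIx : Ix := .var 0

/-- The index expression `2 d`. -/
abbrev twoDim : Ix := .add (.var 0) (.var 0)

/-- Multiplication matrix `M` of the element `E`: the row `j` holds the coordinates of
`E * ω j`. -/
def mulMatrix : Cmd :=
  .for 1 dimIx <| .for 2 dimIx <|
    .prim (.const ⟨arrM, [.var 1, .var 2]⟩ 0) ;;
    .for 3 dimIx (
      .prim (.mul refN (tmp 0) ⟨arrE, [.var 3]⟩ ⟨.struct, [.var 3, .var 1, .var 2]⟩) ;;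
      .prim (.add refN ⟨arrM, [.var 1, .var 2]⟩ ⟨arrM, [.var 1, .var 2]⟩ (tmp 0)))

/-- `E := B + X G`. -/
def combine : Cmd :=
  .for 14 dimIx <|
    .prim (.copy ⟨arrE, [.var 14]⟩ ⟨arrB, [.var 14]⟩) ;;
    .for 15 dimIx (
      .prim (.mul refN (tmp 0) ⟨arrX, [.var 15]⟩ ⟨arrG, [.var 15, .var 14]⟩) ;;
      .prim (.add refN ⟨arrE, [.var 14]⟩ ⟨arrE, [.var 14]⟩ (tmp 0)))

/-- One step of the insertion of the vector `V` into the rows of `T` with numbers at least the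
value of index variable `7`: the entry in the current column is cleared. -/
def insertStep : Cmd :=
  .ifLt (.var 7) (.add (.var 5) (.lit 1))
    (.prim (.xgcd refN (tmp 0) (tmp 1) (tmp 2) (tmp 3) (tmp 4) ⟨arrT, [.var 5, .var 5]⟩
      ⟨arrV, [.var 5]⟩) ;;
    .for 6 twoDim (
      .prim (.mul refN (tmp 5) (tmp 1) ⟨arrT, [.var 5, .var 6]⟩) ;;
      .prim (.mul refN (tmp 6) (tmp 2) ⟨arrV, [.var 6]⟩) ;;
      .prim (.mul refN (tmp 7) (tmp 3) ⟨arrT, [.var 5, .var 6]⟩) ;;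
      .prim (.mul refN (tmp 8) (tmp 4) ⟨arrV, [.var 6]⟩) ;;
      .prim (.add refN ⟨arrT, [.var 5, .var 6]⟩ (tmp 5) (tmp 6)) ;;
      .prim (.add refN ⟨arrV, [.var 6]⟩ (tmp 7) (tmp 8))))
    .skip

/-- Insertion of the vector `V` into the rows of `T`. -/
def insertVec : Cmd := .for 5 twoDim insertStep

/-- Load the scaled row `r` of `M`, followed by the `r`-th unit vector, into `V`, where `r` is the
value of index variable `4`. -/
def loadRow : Cmd :=
  .for 8 dimIx (
    .prim (.mul refN ⟨arrV, [.var 8]⟩ ⟨arrM, [.var 4, .var 8]⟩ ⟨arrC, [.var 8]⟩) ;;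
    .prim (.const ⟨arrV, [.add (.var 0) (.var 8)]⟩ 0)) ;;
  .prim (.const ⟨arrV, [.add (.var 0) (.var 4)]⟩ 1) ;;
  .prim (.setIx 7 (.lit 0))

/-- Load a multiple of row `r` of `T` that vanishes in column `r` into `V`, where `r` is the value
of index variable `4`. -/
def loadAnn : Cmd :=
  .prim (.ann refN (tmp 0) ⟨arrT, [.var 4, .var 4]⟩) ;;
  .for 8 twoDim (.prim (.mul refN ⟨arrV, [.var 8]⟩ (tmp 0) ⟨arrT, [.var 4, .var 8]⟩)) ;;
  .prim (.setIx 7 (.add (.var 4) (.lit 1)))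

/-- `T := 0`. -/
def clearT : Cmd :=
  .for 4 twoDim <| .for 5 twoDim <| .prim (.const ⟨arrT, [.var 4, .var 5]⟩ 0)

/-- Computation of a Howell basis of the graph of the linear map given by the scaled matrix `M`. -/
def howell : Cmd :=
  clearT ;;
  .for 4 dimIx (loadRow ;; insertVec) ;;
  .for 4 twoDim (loadAnn ;; insertVec)

/-- Reduction of the vector `(Y, 0)`, scaled, by the Howell basis `T`. -/
def reduce : Cmd :=
  .for 9 dimIx (
    .prim (.mul refN ⟨arrV, [.var 9]⟩ ⟨arrY, [.var 9]⟩ ⟨arrC, [.var 9]⟩) ;;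
    .prim (.const ⟨arrV, [.add (.var 0) (.var 9)]⟩ 0)) ;;
  .for 10 dimIx (
    .prim (.div refN (tmp 0) ⟨arrV, [.var 10]⟩ ⟨arrT, [.var 10, .var 10]⟩) ;;
    .for 11 twoDim (
      .prim (.mul refN (tmp 1) (tmp 0) ⟨arrT, [.var 10, .var 11]⟩) ;;
      .prim (.sub refN ⟨arrV, [.var 11]⟩ ⟨arrV, [.var 11]⟩ (tmp 1))))

/-- Set the flag `F` if the reduction has left a non-zero entry. -/
def checkZero : Cmd :=
  .for 13 dimIx (.ifZero ⟨arrV, [.var 13]⟩ .skip (.prim (.const ⟨arrF, []⟩ 1)))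

/-- Set the flag `F` if and only if one of the rows of `G` is not a multiple of the element to which
`T` belongs. -/
def testAll : Cmd :=
  .prim (.const ⟨arrF, []⟩ 0) ;;
  .for 12 dimIx (
    .for 13 dimIx (.prim (.copy ⟨arrY, [.var 13]⟩ ⟨arrG, [.var 12, .var 13]⟩)) ;;
    reduce ;; checkZero)

/-- The deterministic part of a trial: form `E = B + X G` and test whether it divides all rows
of `G`. -/
def trial : Cmd := combine ;; mulMatrix ;; howell ;; testAll

/-- `X :=` random vector. -/
def randomX : Cmd := .for 16 dimIx (.prim (.rand refN ⟨arrX, [.var 16]⟩))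

/-- Repeat trials with random `X` until one of them is successful. -/
def search : Cmd := .prim (.const ⟨arrF, []⟩ 1) ;; .while ⟨arrF, []⟩ (randomX ;; trial)

/-- Computation of the scaling factors `C`. -/
def scaling : Cmd := .for 17 dimIx (.prim (.ann refN ⟨arrC, [.var 17]⟩ ⟨.diag, [.var 17]⟩))

/-- Copy a vector; the reference to its entries uses index variable `19`. -/
def loadVec (A : Arr) (x : Ref) : Cmd := .for 19 dimIx (.prim (.copy ⟨A, [.var 19]⟩ x))

/-- Copy a matrix into `G`; the reference to its entries uses index variables `19` and `20`. -/
def loadG (x : Ref) : Cmd :=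
  .for 19 dimIx <| .for 20 dimIx <| .prim (.copy ⟨arrG, [.var 19, .var 20]⟩ x)

/-- Write the canonical coordinates of the sum of two vectors to row `t` of the output; the
references to their entries use index variable `18`. -/
def writeSum (t : ℕ) (x y : Ref) : Cmd :=
  .for 18 dimIx (.prim (.add ⟨.diag, [.var 18]⟩ ⟨.output, [.lit t, .var 18]⟩ x y))

/-- Like `writeSum`, for the difference of two vectors. -/
def writeDiff (t : ℕ) (x y : Ref) : Cmd :=
  .for 18 dimIx (.prim (.sub ⟨.diag, [.var 18]⟩ ⟨.output, [.lit t, .var 18]⟩ x y))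

/-- Write the canonical coordinates of a vector to the output. -/
def writeOut (t : ℕ) (x : Ref) : Cmd := .prim (.const (tmp 9) 0) ;; writeSum t (tmp 9) x

/-- Write the canonical coordinates of the negative of a vector to the output. -/
def writeNeg (t : ℕ) (x : Ref) : Cmd := .prim (.const (tmp 9) 0) ;; writeDiff t (tmp 9) x

/-- `B := 0`. -/
def zeroB : Cmd := .for 19 dimIx (.prim (.const ⟨arrB, [.var 19]⟩ 0))

/-- Let the rows of `G` be the unit vectors. -/
def unitG : Cmd :=
  .for 19 dimIx <|
    .for 20 dimIx (.prim (.const ⟨arrG, [.var 19, .var 20]⟩ 0)) ;;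
    .prim (.const ⟨arrG, [.var 19, .var 19]⟩ 1)

/-! ### Reading and writing -/

section Memory

@[simp] theorem Store.write_ix (s : Store) (x : Ref) (z : ℤ) : (s.write x z).ix = s.ix := rfl

@[simp] theorem Ix.eval_write (e : Ix) (s : Store) (x : Ref) (z : ℤ) :
    e.eval (s.write x z) = e.eval s := by
  induction e with
  | lit c => rfl
  | var i => rfl
  | add e₁ e₂ h₁ h₂ => simp only [Ix.eval, h₁, h₂]
  | sub e₁ e₂ h₁ h₂ => simp only [Ix.eval, h₁, h₂]

theorem Store.mem_write (s : Store) (x : Ref) (z : ℤ) (A : Arr) (l : List ℕ) :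
    (s.write x z).mem A l =
      if A = x.arr ∧ l = x.idx.map (Ix.eval s) then z else s.mem A l := rfl

theorem Store.mem_write_of_ne (s : Store) {x : Ref} (z : ℤ) {A : Arr} (h : A ≠ x.arr) :
    (s.write x z).mem A = s.mem A := by
  funext l; simp [Store.mem_write, h]

variable {N : ℕ}

/-- The entries of a vector as residue classes. -/
def vec (N : ℕ) (m : Arr → List ℕ → ℤ) (A : Arr) (k : ℕ) : ZMod N := (m A [k] : ZMod N)

/-- The entries of a matrix as residue classes. -/
def mat (N : ℕ) (m : Arr → List ℕ → ℤ) (A : Arr) (i k : ℕ) : ZMod N := (m A [i, k] : ZMod N)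

/-- A scalar as a residue class. -/
def scal (N : ℕ) (m : Arr → List ℕ → ℤ) (t : ℕ) : ZMod N := (m (.work (20 + t)) [] : ZMod N)

theorem vec_congr {m m' : Arr → List ℕ → ℤ} {A : Arr} (h : m A = m' A) :
    vec N m A = vec N m' A := by
  funext k; simp only [vec, h]

theorem mat_congr {m m' : Arr → List ℕ → ℤ} {A : Arr} (h : m A = m' A) :
    mat N m A = mat N m' A := by
  funext i k; simp only [mat, h]

/-- The first `W` entries of a vector, as residue classes. -/
def row (N : ℕ) (m : Arr → List ℕ → ℤ) (A : Arr) (W k : ℕ) : ZMod N :=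
  if k < W then vec N m A k else 0

/-- The first `W` columns of a matrix, as residue classes. -/
def rows (N : ℕ) (m : Arr → List ℕ → ℤ) (A : Arr) (W i k : ℕ) : ZMod N :=
  if k < W then mat N m A i k else 0

theorem row_of_lt {m : Arr → List ℕ → ℤ} {A : Arr} {W k : ℕ} (h : k < W) :
    row N m A W k = vec N m A k := if_pos h

theorem rows_of_lt {m : Arr → List ℕ → ℤ} {A : Arr} {W i k : ℕ} (h : k < W) :
    rows N m A W i k = mat N m A i k := if_pos h

theorem row_of_ge {m : Arr → List ℕ → ℤ} {A : Arr} {W k : ℕ} (h : W ≤ k) :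
    row N m A W k = 0 := if_neg (by omega)

theorem row_congr {m m' : Arr → List ℕ → ℤ} {A : Arr} (h : m A = m' A) (W : ℕ) :
    row N m A W = row N m' A W := by
  funext k; simp only [row, vec_congr h]

theorem rows_congr {m m' : Arr → List ℕ → ℤ} {A : Arr} (h : m A = m' A) (W : ℕ) :
    rows N m A W = rows N m' A W := by
  funext i k; simp only [rows, mat_congr h]

end Memory

/-! ### Matrices and insertion of vectors by programs -/

section Blocks

variable {N d : ℕ} [NeZero N] {ops : (k : ℕ) → BasicOps k} {s : Store}

theorem mulMatrix_wp (hN : s.mem .modulus [] = N) (hd : s.ix 0 = d) :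
    mulMatrix.Wp N ops s fun s' => ∀ j < d, ∀ k < d, mat N s'.mem arrM j k =
      ∑ i ∈ Finset.range d, vec N s.mem arrE i * (s.mem .struct [i, j, k] : ZMod N) := by
  have h1 : 1 ≤ N := NeZero.one_le
  refine Cmd.wp_for (n := d) (Frame.refl mulMatrix.arrs mulMatrix.vars s) (by decide) (by decide)
    (by simp [Ix.eval, hd])
    (fun J m => ∀ j < J, ∀ k < d, mat N m arrM j k =
      ∑ i ∈ Finset.range d, vec N s.mem arrE i * (s.mem .struct [i, j, k] : ZMod N))
    (by simp) ?_ (fun s' _ _ h => h)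
  intro j s₁ hj hF₁ hj₁ hV₁ hI₁
  refine Cmd.wp_for (n := d) hF₁ (by decide) (by decide)
    (by simp [Ix.eval, hF₁.2 0 (by decide), hd])
    (fun K m => (∀ j' < j, ∀ k, mat N m arrM j' k = mat N s₁.mem arrM j' k) ∧
      ∀ k < K, mat N m arrM j k =
      ∑ i ∈ Finset.range d, vec N s.mem arrE i * (s.mem .struct [i, j, k] : ZMod N))
    (by simp) ?_ ?_
  · rintro k s₂ hk hF₂ hk₂ hV₂ ⟨hI, hI'⟩
    have hj₂ := (hV₂ 1 (by decide) (by decide)).trans hj₁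
    refine Cmd.wp_seq (Cmd.wp_const ?_)
    refine Cmd.wp_for (n := d) (hF₂.write (by decide) _) (by decide) (by decide)
      (by simp [Ix.eval, hF₂.2 0 (by decide), hd])
      (fun I m => (∀ j' k', j' ≠ j ∨ k' ≠ k → mat N m arrM j' k' = mat N s₂.mem arrM j' k') ∧
        mat N m arrM j k =
        ∑ i ∈ Finset.range I, vec N s.mem arrE i * (s.mem .struct [i, j, k] : ZMod N))
      ⟨?_, ?_⟩ ?_ ?_
    · rintro j' k' h
      have : ¬ (j' = j ∧ k' = k) := by tauto
      simp [mat, Store.mem_write, Ix.eval, hj₂, hk₂, this]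
    · simp [mat, Store.mem_write, Ix.eval, hj₂, hk₂]
    · rintro i s₃ hi hF₃ hi₃ hV₃ ⟨hI₃, hI₃'⟩
      have hj₃ := (hV₃ 1 (by decide) (by decide)).trans hj₂
      have hk₃ := (hV₃ 2 (by decide) (by decide)).trans hk₂
      have hN₃ : s₃.mem .modulus [] = N := by rw [hF₃.1 _ (by decide), hN]
      have hE := hF₃.1 arrE (by decide)
      have hS := hF₃.1 .struct (by decide)
      refine Cmd.wp_seq (Cmd.wp_mul (m := N) (by simp [Store.read, hN₃]) h1 le_rfl ?_)
      refine Cmd.wp_add (m := N) (by simp [Store.read, Store.writeResidue, Store.mem_write, hN₃])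
        h1 le_rfl ⟨?_, ?_⟩
      · intro j' k' h
        have : ¬ (j' = j ∧ k' = k) := by tauto
        rw [← hI₃ j' k' h]
        simp [mat, Store.writeResidue, Store.mem_write, Ix.eval, hj₃, hk₃, this]
      · rw [Finset.sum_range_succ, ← hI₃']
        simp [mat, vec, Store.writeResidue, Store.residue, Store.read, Store.mem_write, Ix.eval,
          hj₃, hk₃, hi₃, hE, hS]
    · rintro s₃ hF₃ hV₃ ⟨hI₃, hI₃'⟩
      refine ⟨fun j' hj' k' => ?_, fun k' hk' => ?_⟩
      · rw [hI₃ j' k' (Or.inl (by omega)), hI j' hj']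
      · rcases Nat.lt_succ_iff_lt_or_eq.1 hk' with h | rfl
        · rw [hI₃ j k' (Or.inr (by omega)), hI' k' h]
        · exact hI₃'
  · rintro s₂ hF₂ _ ⟨hI, hI'⟩ j' hj' k hk
    rcases Nat.lt_succ_iff_lt_or_eq.1 hj' with h | rfl
    · rw [hI j' h, hI₁ j' h k hk]
    · exact hI' k hk

theorem combine_wp (hN : s.mem .modulus [] = N) (hd : s.ix 0 = d) :
    combine.Wp N ops s fun s' => ∀ k < d, vec N s'.mem arrE k = vec N s.mem arrB k +
      ∑ i ∈ Finset.range d, vec N s.mem arrX i * mat N s.mem arrG i k := by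
  have h1 : 1 ≤ N := NeZero.one_le
  refine Cmd.wp_for (n := d) (Frame.refl combine.arrs combine.vars s) (by decide) (by decide)
    (by simp [Ix.eval, hd])
    (fun K m => ∀ k < K, vec N m arrE k = vec N s.mem arrB k +
      ∑ i ∈ Finset.range d, vec N s.mem arrX i * mat N s.mem arrG i k)
    (by simp) ?_ (fun s' _ _ h => h)
  intro k s₁ hk hF₁ hk₁ hV₁ hI₁
  refine Cmd.wp_seq (Cmd.wp_copy ?_)
  refine Cmd.wp_for (n := d) (hF₁.write (by decide) _) (by decide) (by decide)
    (by simp [Ix.eval, hF₁.2 0 (by decide), hd])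
    (fun I m => (∀ k', k' ≠ k → vec N m arrE k' = vec N s₁.mem arrE k') ∧
      vec N m arrE k = vec N s.mem arrB k +
        ∑ i ∈ Finset.range I, vec N s.mem arrX i * mat N s.mem arrG i k)
    ⟨?_, ?_⟩ ?_ ?_
  · intro k' h
    simp [vec, Store.mem_write, Ix.eval, hk₁, h]
  · simp [vec, Store.read, Store.mem_write, Ix.eval, hk₁, hF₁.1 arrB (by decide)]
  · rintro i s₂ hi hF₂ hi₂ hV₂ ⟨hI₂, hI₂'⟩
    have hk₂ := (hV₂ 14 (by decide) (by decide)).trans hk₁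
    have hN₂ : s₂.mem .modulus [] = N := by rw [hF₂.1 _ (by decide), hN]
    have hX := hF₂.1 arrX (by decide)
    have hG := hF₂.1 arrG (by decide)
    refine Cmd.wp_seq (Cmd.wp_mul (m := N) (by simp [Store.read, hN₂]) h1 le_rfl ?_)
    refine Cmd.wp_add (m := N) (by simp [Store.read, Store.writeResidue, Store.mem_write, hN₂])
      h1 le_rfl ⟨?_, ?_⟩
    · intro k' h
      rw [← hI₂ k' h]
      simp [vec, Store.writeResidue, Store.mem_write, Ix.eval, hk₂, h]
    · rw [Finset.sum_range_succ, ← add_assoc, ← hI₂']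
      simp [mat, vec, Store.writeResidue, Store.residue, Store.read, Store.mem_write, Ix.eval,
        hk₂, hi₂, hX, hG]
  · rintro s₂ hF₂ _ ⟨hI₂, hI₂'⟩ k' hk'
    rcases Nat.lt_succ_iff_lt_or_eq.1 hk' with h | rfl
    · rw [hI₂ k' (by omega), hI₁ k' h]
    · exact hI₂'

theorem insertStep_wp {a j : ℕ} (hN : s.mem .modulus [] = N) (hd : s.ix 0 = d) (hj : s.ix 5 = j)
    (ha : s.ix 7 = a) (hjd : j < 2 * d) :
    insertStep.Wp N ops s fun s' =>
      (j < a → s'.mem = s.mem) ∧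
      (a ≤ j → ∃ g x y u w,
        IsXgcdResult (rows N s.mem arrT (2 * d) j j) (row N s.mem arrV (2 * d) j) g x y u w ∧
        rows N s'.mem arrT (2 * d) = Function.update (rows N s.mem arrT (2 * d)) j
          (x • rows N s.mem arrT (2 * d) j + y • row N s.mem arrV (2 * d)) ∧
        row N s'.mem arrV (2 * d) =
          u • rows N s.mem arrT (2 * d) j + w • row N s.mem arrV (2 * d)) := by
  have h1 : 1 ≤ N := NeZero.one_le
  refine Cmd.wp_ifLt (fun h => ?_) (fun h => ?_)
  swap
  · simp only [Ix.eval, ha, hj] at h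
    exact Cmd.wp_skip ⟨fun _ => rfl, fun h' => absurd h' (by omega)⟩
  simp only [Ix.eval, ha, hj] at h
  refine Cmd.Wp.seq (Q₁ := fun s' => IsXgcdResult (mat N s.mem arrT j j) (vec N s.mem arrV j)
    (scal N s'.mem 0) (scal N s'.mem 1) (scal N s'.mem 2) (scal N s'.mem 3) (scal N s'.mem 4))
    (Cmd.wp_xgcd (m := N) (by simp [Store.read, hN]) h1 le_rfl fun w hw => ?_) fun s₁ hF₁ hx => ?_
  · have := (ops N).xgcd_spec (mat N s.mem arrT j j) (vec N s.mem arrV j)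
    have hw' : w = (ops N).xgcd (mat N s.mem arrT j j) (vec N s.mem arrV j) := by
      rw [hw]; simp [Store.residue, Store.read, mat, vec, Ix.eval, hj]
    rw [← hw'] at this
    simpa [scal, Store.writeResidue, Store.mem_write] using this
  have hT₁ : s₁.mem arrT = s.mem arrT := hF₁.1 _ (by decide)
  have hV₁ : s₁.mem arrV = s.mem arrV := hF₁.1 _ (by decide)
  have hj₁ : s₁.ix 5 = j := (hF₁.2 _ (by decide)).trans hj
  have hd₁ : s₁.ix 0 = d := (hF₁.2 _ (by decide)).trans hd
  have hN₁ : s₁.mem .modulus [] = N := by rw [hF₁.1 _ (by decide), hN]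
  rw [← rows_congr hT₁, ← row_congr hV₁]
  have hmat := mat_congr (N := N) hT₁.symm
  have hvec := vec_congr (N := N) hV₁.symm
  rw [hmat, hvec] at hx
  clear hT₁ hV₁ hmat hvec hF₁ hN hd hj ha
  set x := scal N s₁.mem 1 with hxdef
  set y := scal N s₁.mem 2 with hydef
  set u := scal N s₁.mem 3 with hudef
  set w := scal N s₁.mem 4 with hwdef
  refine Cmd.wp_for (n := 2 * d) (Frame.refl [arrT, arrV, .work 25, .work 26, .work 27, .work 28]
    [6] s₁) (by decide) (by decide) (by simp [Ix.eval, hd₁]; omega)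
    (fun K m => (∀ i k, i ≠ j ∨ K ≤ k → mat N m arrT i k = mat N s₁.mem arrT i k) ∧
      (∀ k < K, mat N m arrT j k = x * mat N s₁.mem arrT j k + y * vec N s₁.mem arrV k) ∧
      (∀ k, K ≤ k → vec N m arrV k = vec N s₁.mem arrV k) ∧
      (∀ k < K, vec N m arrV k = u * mat N s₁.mem arrT j k + w * vec N s₁.mem arrV k))
    (by simp) ?_ ?_
  · rintro k s₂ hk hF₂ hk₂ hV₂ ⟨hI1, hI2, hI3, hI4⟩
    have hj₂ : s₂.ix 5 = j := (hF₂.2 _ (by decide)).trans hj₁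
    have hN₂ : s₂.mem .modulus [] = N := by rw [hF₂.1 _ (by decide), hN₁]
    have hx₂ := hF₂.1 (.work 21) (by decide)
    have hy₂ := hF₂.1 (.work 22) (by decide)
    have hu₂ := hF₂.1 (.work 23) (by decide)
    have hw₂ := hF₂.1 (.work 24) (by decide)
    have e1 := hI1 j k (Or.inr le_rfl)
    have e2 := hI3 k le_rfl
    refine Cmd.wp_seq (Cmd.wp_mul (m := N) (by simp [Store.read, hN₂]) h1 le_rfl ?_)
    refine Cmd.wp_seq (Cmd.wp_mul (m := N)
      (by simp [Store.read, Store.writeResidue, Store.mem_write, hN₂]) h1 le_rfl ?_)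
    refine Cmd.wp_seq (Cmd.wp_mul (m := N)
      (by simp [Store.read, Store.writeResidue, Store.mem_write, hN₂]) h1 le_rfl ?_)
    refine Cmd.wp_seq (Cmd.wp_mul (m := N)
      (by simp [Store.read, Store.writeResidue, Store.mem_write, hN₂]) h1 le_rfl ?_)
    refine Cmd.wp_seq (Cmd.wp_add (m := N)
      (by simp [Store.read, Store.writeResidue, Store.mem_write, hN₂]) h1 le_rfl ?_)
    refine Cmd.wp_add (m := N)
      (by simp [Store.read, Store.writeResidue, Store.mem_write, hN₂]) h1 le_rfl ⟨?_, ?_, ?_, ?_⟩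
    · intro i k' h
      rw [← hI1 i k' (by omega)]
      have : ¬ (i = j ∧ k' = k) := by omega
      simp [mat, Store.writeResidue, Store.mem_write, Ix.eval, hj₂, hk₂, this]
    · intro k' hk'
      rcases Nat.lt_succ_iff_lt_or_eq.1 hk' with h | rfl
      · rw [← hI2 k' h]
        simp [mat, Store.writeResidue, Store.mem_write, Ix.eval, hj₂, hk₂, h.ne]
      · rw [← e1, ← e2, hxdef, hydef]
        simp [mat, vec, scal, Store.writeResidue, Store.residue, Store.read, Store.mem_write,
          Ix.eval, hj₂, hk₂, hx₂, hy₂]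
    · intro k' h
      rw [← hI3 k' (by omega)]
      have : ¬ k' = k := by omega
      simp [vec, Store.writeResidue, Store.mem_write, Ix.eval, hk₂, this]
    · intro k' hk'
      rcases Nat.lt_succ_iff_lt_or_eq.1 hk' with h | rfl
      · rw [← hI4 k' h]
        simp [vec, Store.writeResidue, Store.mem_write, Ix.eval, hk₂, h.ne]
      · rw [← e1, ← e2, hudef, hwdef]
        simp [mat, vec, scal, Store.writeResidue, Store.residue, Store.read, Store.mem_write,
          Ix.eval, hj₂, hk₂, hu₂, hw₂]
  · rintro s₂ hF₂ _ ⟨hI1, hI2, hI3, hI4⟩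
    refine ⟨fun h' => absurd h' (by omega), fun _ =>
      ⟨_, x, y, u, w, by rw [rows_of_lt hjd, row_of_lt hjd]; exact hx, ?_, ?_⟩⟩
    · funext i k
      by_cases hk : k < 2 * d
      · by_cases hi : i = j
        · subst hi
          simp [rows_of_lt hk, row_of_lt hk, hI2 k hk]
        · rw [Function.update_of_ne hi, rows_of_lt hk, rows_of_lt hk, hI1 i k (Or.inl hi)]
      · by_cases hi : i = j
        · subst hi; simp [rows, row, hk]
        · rw [Function.update_of_ne hi]; simp [rows, hk]
    · funext k
      by_cases hk : k < 2 * d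
      · simp [rows_of_lt hk, row_of_lt hk, hI4 k hk]
      · simp [rows, row, hk]

theorem insertVec_wp {a : ℕ} (hN : s.mem .modulus [] = N) (hd : s.ix 0 = d) (ha : s.ix 7 = a)
    (hT : IsTriangular (rows N s.mem arrT (2 * d)) (2 * d))
    (hv : ∀ k < a, row N s.mem arrV (2 * d) k = 0) :
    insertVec.Wp N ops s fun s' =>
      Inserted a (2 * d) (rows N s.mem arrT (2 * d)) (row N s.mem arrV (2 * d))
        (rows N s'.mem arrT (2 * d)) := by
  refine Cmd.wp_for (n := 2 * d) (Frame.refl insertVec.arrs insertVec.vars s) (by decide)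
    (by decide) (by simp [Ix.eval, hd]; omega)
    (fun j m => (j ≤ a → row N m arrV (2 * d) = row N s.mem arrV (2 * d)) ∧
      Inserting a (2 * d) (rows N s.mem arrT (2 * d)) (row N s.mem arrV (2 * d)) j
        (rows N m arrT (2 * d)) (row N m arrV (2 * d)))
    ⟨fun _ => rfl, hT, fun _ _ => rfl, rfl, by simp⟩ ?_ ?_
  · rintro j s₁ hj hF₁ hj₁ hV₁ ⟨hI, hI'⟩
    have ha₁ : s₁.ix 7 = a := (hF₁.2 _ (by decide)).trans ha
    have hN₁ : s₁.mem .modulus [] = N := by rw [hF₁.1 _ (by decide), hN]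
    refine (insertStep_wp hN₁ ((hF₁.2 _ (by decide)).trans hd) hj₁ ha₁ hj).mono ?_
    rintro s₂ _ ⟨h1, h2⟩
    rcases lt_or_ge j a with h | h
    · rw [h1 h]
      exact ⟨fun _ => hI h.le, hI'.skip h hv (hI h.le)⟩
    · obtain ⟨g, x, y, u, w, hx, e1, e2⟩ := h2 h
      refine ⟨fun h' => absurd h' (by omega), ?_⟩
      rw [e1, e2]
      exact hI'.step h hj hx
  · rintro s' _ _ ⟨_, h⟩
    exact h.done fun k hk => row_of_ge hk

end Blocks

/-! ### Howell bases and reduction by programs -/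

section Blocks

variable {N d : ℕ} {ops : (k : ℕ) → BasicOps k} {s : Store}

/-- The matrix `M` with its columns scaled by `C`. -/
def scaled (N : ℕ) (m : Arr → List ℕ → ℤ) (j k : ℕ) : ZMod N :=
  mat N m arrM j k * vec N m arrC k

theorem scaled_congr {m m' : Arr → List ℕ → ℤ} (hM : m arrM = m' arrM) (hC : m arrC = m' arrC) :
    scaled N m = scaled N m' := by
  funext j k; simp only [scaled, mat, vec, hM, hC]

theorem clearT_wp (hd : s.ix 0 = d) :
    clearT.Wp N ops s fun s' => ∀ i < 2 * d, rows N s'.mem arrT (2 * d) i = 0 := by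
  refine Cmd.wp_for (n := 2 * d) (Frame.refl clearT.arrs clearT.vars s) (by decide)
    (by decide) (by simp [Ix.eval, hd]; omega)
    (fun J m => ∀ i < J, ∀ k < 2 * d, mat N m arrT i k = 0) (by simp) ?_ ?_
  · intro i s₁ hi hF₁ hi₁ _ hI
    refine Cmd.wp_for (n := 2 * d) hF₁ (by decide) (by decide)
      (by simp [Ix.eval, (hF₁.2 0 (by decide)).trans hd]; omega)
      (fun K m => (∀ i' < i, ∀ k, mat N m arrT i' k = mat N s₁.mem arrT i' k) ∧
        ∀ k < K, mat N m arrT i k = 0) (by simp) ?_ ?_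
    · rintro k s₂ hk hF₂ hk₂ hV₂ ⟨hI₁, hI₂⟩
      have hi₂ := (hV₂ 4 (by decide) (by decide)).trans hi₁
      refine Cmd.wp_const ⟨fun i' hi' k' => ?_, fun k' hk' => ?_⟩
      · rw [← hI₁ i' hi' k']
        simp [mat, Store.mem_write, Ix.eval, hi₂, hk₂, hi'.ne]
      · rcases Nat.lt_succ_iff_lt_or_eq.1 hk' with h | rfl
        · rw [← hI₂ k' h]
          simp [mat, Store.mem_write, Ix.eval, hi₂, hk₂, h.ne]
        · simp [mat, Store.mem_write, Ix.eval, hi₂, hk₂]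
    · rintro s₂ _ _ ⟨hI₁, hI₂⟩ i' hi' k hk
      rcases Nat.lt_succ_iff_lt_or_eq.1 hi' with h | rfl
      · rw [hI₁ i' h, hI i' h k hk]
      · exact hI₂ k hk
  · intro s' _ _ h i hi
    funext k
    by_cases hk : k < 2 * d
    · rw [rows_of_lt hk]; exact h i hi k hk
    · simp [rows, hk]

theorem checkZero_wp (hd : s.ix 0 = d) :
    checkZero.Wp N ops s fun s' => s'.mem arrF [] = 0 ↔
      s.mem arrF [] = 0 ∧ ∀ k < d, s.mem arrV [k] = 0 := by
  refine Cmd.wp_for (n := d) (Frame.refl checkZero.arrs checkZero.vars s) (by decide) (by decide)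
    (by simp [Ix.eval, hd])
    (fun K m => m arrF [] = 0 ↔ s.mem arrF [] = 0 ∧ ∀ k < K, s.mem arrV [k] = 0)
    (by simp) ?_ fun s' _ _ h => h
  intro k s₁ hk hF₁ hk₁ _ hI
  have hV := hF₁.1 arrV (by decide)
  refine Cmd.wp_ifZero (fun h => Cmd.wp_skip ?_) (fun h => Cmd.wp_const ?_)
  all_goals simp only [Store.read, List.map, Ix.eval, hk₁, hV] at h
  · rw [hI]
    refine and_congr_right fun _ => ⟨fun h' k' hk' => ?_, fun h' k' hk' => h' k' (by omega)⟩
    rcases Nat.lt_succ_iff_lt_or_eq.1 hk' with h'' | rfl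
    · exact h' k' h''
    · exact h
  · simp only [Store.mem_write, List.map, and_self, if_true]
    simp only [one_ne_zero, false_iff, not_and]
    exact fun _ h' => h (h' k (by omega))

variable [NeZero N]

theorem loadRow_wp {r : ℕ} (hN : s.mem .modulus [] = N) (hd : s.ix 0 = d) (hr : s.ix 4 = r)
    (hrd : r < d) :
    loadRow.Wp N ops s fun s' => s'.ix 7 = 0 ∧
      row N s'.mem arrV (2 * d) = graphGen d (scaled N s.mem) r := by
  have h1 : 1 ≤ N := NeZero.one_le
  refine Cmd.wp_seq (Cmd.wp_for (n := d) (Frame.refl [arrV] [8] s) (by decide) (by decide)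
    (by simp [Ix.eval, hd])
    (fun K m => ∀ k < K, vec N m arrV k = scaled N s.mem r k ∧ vec N m arrV (d + k) = 0)
    (by simp) ?_ ?_)
  · rintro k s₁ hk hF₁ hk₁ hV₁ hI
    have hr₁ : s₁.ix 4 = r := (hF₁.2 _ (by decide)).trans hr
    have hd₁ : s₁.ix 0 = d := (hF₁.2 _ (by decide)).trans hd
    have hN₁ : s₁.mem .modulus [] = N := by rw [hF₁.1 _ (by decide), hN]
    have hM := hF₁.1 arrM (by decide)
    have hC := hF₁.1 arrC (by decide)
    refine Cmd.wp_seq (Cmd.wp_mul (m := N) (by simp [Store.read, hN₁]) h1 le_rfl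
      (Cmd.wp_const ?_))
    intro k' hk'
    rcases Nat.lt_succ_iff_lt_or_eq.1 hk' with h | rfl
    · rw [← (hI k' h).1]
      have e1 : k' ≠ d + k := by omega
      have e2 : d + k' ≠ k := by omega
      have := (hI k' h).2
      simpa [vec, Store.writeResidue, Store.mem_write, Ix.eval, hk₁, hd₁, h.ne, e1, e2] using this
    · have hd0 : d ≠ 0 := by omega
      simp [scaled, vec, mat, Store.writeResidue, Store.residue, Store.read, Store.mem_write,
        Ix.eval, hk₁, hd₁, hr₁, hd0, hM, hC]
  · intro s₁ hF₁ _ hI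
    have hr₁ : s₁.ix 4 = r := (hF₁.2 _ (by decide)).trans hr
    have hd₁ : s₁.ix 0 = d := (hF₁.2 _ (by decide)).trans hd
    refine Cmd.wp_seq (Cmd.wp_const (Cmd.wp_setIx ⟨rfl, ?_⟩))
    funext k
    rcases lt_or_ge k (2 * d) with hk | hk
    · rw [row_of_lt hk]
      rcases lt_or_ge k d with hkd | hkd
      · have e1 : k ≠ d + r := by omega
        have := (hI k hkd).1
        simpa [vec, graphGen, Store.setIx, Store.mem_write, Ix.eval, hd₁, hr₁, e1, hkd] using this
      · obtain ⟨l, rfl⟩ := Nat.exists_eq_add_of_le hkd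
        by_cases hl : l = r
        · subst hl
          simp [vec, graphGen, Store.setIx, Store.mem_write, Ix.eval, hd₁, hr₁]
        · have := (hI l (by omega)).2
          simpa [vec, graphGen, Store.setIx, Store.mem_write, Ix.eval, hd₁, hr₁, hl] using this
    · rw [row_of_ge hk, graphGen, if_neg (by omega), if_neg (by omega)]

theorem loadAnn_wp {r : ℕ} (hN : s.mem .modulus [] = N) (hd : s.ix 0 = d) (hr : s.ix 4 = r)
    (hrd : r < 2 * d) :
    loadAnn.Wp N ops s fun s' => s'.ix 7 = r + 1 ∧ ∃ a,
      IsAnnResult (rows N s.mem arrT (2 * d) r r) a ∧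
      row N s'.mem arrV (2 * d) = a • rows N s.mem arrT (2 * d) r := by
  have h1 : 1 ≤ N := NeZero.one_le
  refine Cmd.Wp.seq (Q₁ := fun s' => IsAnnResult (mat N s.mem arrT r r) (scal N s'.mem 0))
    (Cmd.wp_ann (m := N) (by simp [Store.read, hN]) h1 le_rfl ?_) fun s₁ hF₁ ha => ?_
  · have := (ops N).ann_spec (mat N s.mem arrT r r)
    simpa [scal, mat, Store.residue, Store.read, Ix.eval, Store.writeResidue, Store.mem_write, hr]
      using this
  have hd₁ : s₁.ix 0 = d := (hF₁.2 _ (by decide)).trans hd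
  refine Cmd.wp_seq (Cmd.wp_for (n := 2 * d) (hF₁.mono (A' := [arrV, .work 20]) (V' := [8])
    (by decide) (by decide)) (by decide) (by decide) (by simp [Ix.eval, hd₁]; omega)
    (fun K m => m (.work 20) = s₁.mem (.work 20) ∧
      ∀ k < K, vec N m arrV k = scal N s₁.mem 0 * mat N s.mem arrT r k)
    (by simp) ?_ ?_)
  · rintro k s₂ hk hF₂ hk₂ hV₂ ⟨ha₂, hI⟩
    have hr₂ : s₂.ix 4 = r := (hF₂.2 _ (by decide)).trans hr
    have hN₂ : s₂.mem .modulus [] = N := by rw [hF₂.1 _ (by decide), hN]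
    have hT := hF₂.1 arrT (by decide)
    refine Cmd.wp_mul (m := N) (by simp [Store.read, hN₂]) h1 le_rfl ⟨?_, fun k' hk' => ?_⟩
    · rw [← ha₂]
      funext l
      simp [Store.writeResidue, Store.mem_write]
    · rcases Nat.lt_succ_iff_lt_or_eq.1 hk' with h | rfl
      · rw [← hI k' h]
        simp [vec, Store.writeResidue, Store.mem_write, Ix.eval, hk₂, h.ne]
      · simp [scal, vec, mat, Store.writeResidue, Store.residue, Store.read, Store.mem_write,
          Ix.eval, hk₂, hr₂, ha₂, hT]
  · rintro s₂ hF₂ _ ⟨_, hI⟩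
    refine Cmd.wp_setIx ⟨?_, scal N s₁.mem 0, ?_, ?_⟩
    · simp [Store.setIx, Ix.eval, (hF₂.2 4 (by decide)).trans hr]
    · rwa [rows_of_lt hrd]
    · funext k
      by_cases hk : k < 2 * d
      · rw [row_of_lt hk, Pi.smul_apply, rows_of_lt hk]
        exact hI k hk
      · simp [row, rows, hk]

theorem howell_wp (hN : s.mem .modulus [] = N) (hd : s.ix 0 = d) :
    howell.Wp N ops s fun s' =>
      IsHowell (rows N s'.mem arrT (2 * d)) (2 * d) (graph d (scaled N s.mem)) := by
  have hF := Frame.refl howell.arrs howell.vars s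
  refine Cmd.Wp.seq (clearT_wp hd) fun s₁ hF₁ hT₁ => ?_
  have hF₁' : Frame howell.arrs howell.vars s s₁ := hF₁.mono (by decide) (by decide)
  have hd₁ : s₁.ix 0 = d := (hF₁.2 _ (by decide)).trans hd
  refine Cmd.wp_seq (Cmd.wp_for (n := d) hF₁' (by decide) (by decide) (by simp [Ix.eval, hd₁])
    (fun r m => HowellGen (rows N m arrT (2 * d)) (2 * d) (graph d (scaled N s.mem))
      (graphGen d (scaled N s.mem)) r) ⟨?_, ?_, by simp⟩ ?_ ?_)
  · intro i hi j _; rw [hT₁ i hi]; rfl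
  · intro i hi; rw [hT₁ i hi]; exact Submodule.zero_mem _
  · intro r s₂ hr hF₂ hr₂ _ hI
    have hN₂ : s₂.mem .modulus [] = N := by rw [hF₂.1 _ (by decide), hN]
    have hd₂ : s₂.ix 0 = d := (hF₂.2 _ (by decide)).trans hd
    refine Cmd.Wp.seq (loadRow_wp hN₂ hd₂ hr₂ hr) fun s₃ hF₃ ⟨h7, hrow⟩ => ?_
    have hT₃ := rows_congr (N := N) (hF₃.1 arrT (by decide)) (2 * d)
    refine (insertVec_wp (by rw [hF₃.1 _ (by decide), hN₂]) ((hF₃.2 _ (by decide)).trans hd₂) h7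
      (by rw [hT₃]; exact hI.tri) (by simp)).mono fun s₄ _ hins => ?_
    rw [hT₃, hrow, scaled_congr (hF₂.1 arrM (by decide)) (hF₂.1 arrC (by decide))] at hins
    exact hI.insert (graphGen_mem d _ hr) hins
  · intro s₂ hF₂ _ hgen
    have hd₂ : s₂.ix 0 = d := (hF₂.2 _ (by decide)).trans hd
    refine Cmd.wp_for (n := 2 * d) hF₂ (by decide) (by decide) (by simp [Ix.eval, hd₂]; omega)
      (fun r m => HowellUpTo (rows N m arrT (2 * d)) (2 * d) (graph d (scaled N s.mem)) r)
      (hgen.howellUpTo (graph_le_span d _)) ?_ fun s' _ _ h => h.isHowell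
    intro r s₃ hr hF₃ hr₃ _ hI
    have hN₃ : s₃.mem .modulus [] = N := by rw [hF₃.1 _ (by decide), hN]
    have hd₃ : s₃.ix 0 = d := (hF₃.2 _ (by decide)).trans hd
    refine Cmd.Wp.seq (loadAnn_wp hN₃ hd₃ hr₃ hr) fun s₄ hF₄ ⟨h7, a, ha, hrow⟩ => ?_
    have hT₄ := rows_congr (N := N) (hF₄.1 arrT (by decide)) (2 * d)
    refine (insertVec_wp (by rw [hF₄.1 _ (by decide), hN₃]) ((hF₄.2 _ (by decide)).trans hd₃) h7
      (by rw [hT₄]; exact hI.tri) ?_).mono fun s₅ _ hins => ?_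
    · intro k hk
      rw [hrow]
      rcases Nat.lt_succ_iff_lt_or_eq.1 hk with h | rfl
      · simp [hI.tri r hr k h]
      · have h2 : a * rows N s₃.mem arrT (2 * d) k k = 0 :=
          (ha a).1 (Ideal.mem_span_singleton_self a)
        simpa using h2
    · rw [hT₄, hrow] at hins
      exact hI.insert hr ha hins

/-- The entries of the first half of `V` are canonical representatives, so that they can be
compared with zero. -/
def Canonical (N d : ℕ) (m : Arr → List ℕ → ℤ) : Prop :=
  ∀ k < d, ∃ z : ZMod N, m arrV [k] = (z.val : ℤ)

theorem Canonical.eq_zero_iff {m : Arr → List ℕ → ℤ} (h : Canonical N d m) {k : ℕ} (hk : k < d) :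
    m arrV [k] = 0 ↔ row N m arrV (2 * d) k = 0 := by
  obtain ⟨z, hz⟩ := h k hk
  rw [row_of_lt (by omega), vec, hz, Int.cast_natCast, ZMod.natCast_zmod_val, Nat.cast_eq_zero,
    ZMod.val_eq_zero]

/-- The right-hand side `Y`, scaled by `C`. -/
def scaledVec (N : ℕ) (m : Arr → List ℕ → ℤ) (k : ℕ) : ZMod N := vec N m arrY k * vec N m arrC k

/-- The reduction clears the left half of the vector if the equation is solvable; its entries can
then be tested for zero because they are stored as canonical representatives. -/
theorem reduce_wp {A : ℕ → ℕ → ZMod N} (hN : s.mem .modulus [] = N) (hd : s.ix 0 = d)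
    (hT : IsHowell (rows N s.mem arrT (2 * d)) (2 * d) (graph d A)) :
    reduce.Wp N ops s fun s' => Canonical N d s'.mem ∧
      Reducing d A (scaledVec N s.mem) d (row N s'.mem arrV (2 * d)) := by
  have h1 : 1 ≤ N := NeZero.one_le
  refine Cmd.wp_seq (Cmd.wp_for (n := d) (Frame.refl reduce.arrs reduce.vars s) (by decide)
    (by decide) (by simp [Ix.eval, hd])
    (fun K m => Canonical N K m ∧
      ∀ k < K, vec N m arrV k = scaledVec N s.mem k ∧ vec N m arrV (d + k) = 0)
    (by simp [Canonical]) ?_ ?_)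
  · rintro k s₁ hk hF₁ hk₁ hV₁ ⟨hcan, hI⟩
    have hd₁ : s₁.ix 0 = d := (hF₁.2 _ (by decide)).trans hd
    have hN₁ : s₁.mem .modulus [] = N := by rw [hF₁.1 _ (by decide), hN]
    have hY := hF₁.1 arrY (by decide)
    have hC := hF₁.1 arrC (by decide)
    refine Cmd.wp_seq (Cmd.wp_mul (m := N) (by simp [Store.read, hN₁]) h1 le_rfl
      (Cmd.wp_const ⟨?_, ?_⟩))
    · intro k' hk'
      rcases Nat.lt_succ_iff_lt_or_eq.1 hk' with h | rfl
      · obtain ⟨z, hz⟩ := hcan k' h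
        have e1 : k' ≠ d + k := by omega
        exact ⟨z, by
          simpa [Store.writeResidue, Store.mem_write, Ix.eval, hk₁, hd₁, h.ne, e1] using hz⟩
      · have hd0 : d ≠ 0 := by omega
        refine ⟨s₁.residue N ⟨arrY, [.var 9]⟩ * s₁.residue N ⟨arrC, [.var 9]⟩, ?_⟩
        simp [Store.writeResidue, Store.mem_write, Ix.eval, hk₁, hd₁, hd0]
    · intro k' hk'
      rcases Nat.lt_succ_iff_lt_or_eq.1 hk' with h | rfl
      · rw [← (hI k' h).1]
        have e1 : k' ≠ d + k := by omega
        have e2 : d + k' ≠ k := by omega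
        have := (hI k' h).2
        simpa [vec, Store.writeResidue, Store.mem_write, Ix.eval, hk₁, hd₁, h.ne, e1, e2] using this
      · have hd0 : d ≠ 0 := by omega
        simp [scaledVec, vec, Store.writeResidue, Store.residue, Store.read, Store.mem_write,
          Ix.eval, hk₁, hd₁, hd0, hY, hC]
  · rintro s₁ hF₁ _ ⟨hcan, hI⟩
    have hstart : row N s₁.mem arrV (2 * d) =
        fun k => if k < d then scaledVec N s.mem k else 0 := by
      funext k
      split_ifs with hk
      · rw [row_of_lt (by omega), (hI k hk).1]
      · by_cases hk2 : k < 2 * d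
        · have := (hI (k - d) (by omega)).2
          rwa [Nat.add_sub_cancel' (by omega), ← row_of_lt hk2] at this
        · exact row_of_ge (by omega)
    refine Cmd.wp_for (n := d) hF₁ (by decide) (by decide)
      (by simp [Ix.eval, (hF₁.2 0 (by decide)).trans hd])
      (fun i m => Canonical N d m ∧
        Reducing d A (scaledVec N s.mem) i (row N m arrV (2 * d)))
      ⟨hcan, by rw [hstart]; exact Reducing.start _ _ _⟩ ?_ fun s' _ _ h => h
    rintro i s₂ hi hF₂ hi₂ _ ⟨hcan₂, hI₂⟩
    have hN₂ : s₂.mem .modulus [] = N := by rw [hF₂.1 _ (by decide), hN]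
    have hT₂ := hF₂.1 arrT (by decide)
    refine Cmd.Wp.seq (Q₁ := fun s' => mat N s.mem arrT i i ∣ vec N s₂.mem arrV i →
      IsDivResult (vec N s₂.mem arrV i) (mat N s.mem arrT i i) (scal N s'.mem 0))
      (Cmd.wp_div (m := N) (by simp [Store.read, hN₂]) h1 le_rfl ?_) fun s₃ hF₃ hq => ?_
    · intro hdvd
      have := (ops N).div_spec _ _ hdvd
      simpa [scal, mat, vec, Store.residue, Store.read, Ix.eval, Store.writeResidue,
        Store.mem_write, hi₂, hT₂] using this
    have hF₃' : Frame reduce.arrs reduce.vars s s₃ :=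
      hF₂.trans (hF₃.mono (by decide) (by decide))
    have hV₃ := hF₃.1 arrV (by decide)
    set q := scal N s₃.mem 0 with hqdef
    refine Cmd.wp_for (n := 2 * d) hF₃' (by decide) (by decide)
      (by simp [Ix.eval, (hF₃'.2 0 (by decide)).trans hd]; omega)
      (fun K m => Canonical N d m ∧ m (.work 20) = s₃.mem (.work 20) ∧
        (∀ k < K, vec N m arrV k = vec N s₂.mem arrV k - q * mat N s.mem arrT i k) ∧
        ∀ k, K ≤ k → vec N m arrV k = vec N s₂.mem arrV k)
      ⟨by simpa [Canonical, hV₃] using hcan₂, rfl, by simp, by simp [vec, hV₃]⟩ ?_ ?_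
    · rintro k s₄ hk hF₄ hk₄ hV₄ ⟨hcan₄, hq₄, hI1, hI2⟩
      have hi₄ : s₄.ix 10 = i :=
        ((hV₄ 10 (by decide) (by decide)).trans (hF₃.2 10 (by decide))).trans hi₂
      have hN₄ : s₄.mem .modulus [] = N := by rw [hF₄.1 _ (by decide), hN]
      have hT₄ := hF₄.1 arrT (by decide)
      refine Cmd.wp_seq (Cmd.wp_mul (m := N) (by simp [Store.read, hN₄]) h1 le_rfl
        (Cmd.wp_sub (m := N) (by simp [Store.read, Store.writeResidue, Store.mem_write, hN₄]) h1
          le_rfl ⟨fun k' hk' => ?_, ?_, fun k' hk' => ?_, fun k' hk' => ?_⟩))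
      · by_cases h : k' = k
        · subst h
          exact ⟨_, if_pos ⟨rfl, by simp [Store.writeResidue, Ix.eval, hk₄]⟩⟩
        · obtain ⟨z, hz⟩ := hcan₄ k' hk'
          exact ⟨z, by simpa [Store.writeResidue, Store.mem_write, Ix.eval, hk₄, h] using hz⟩
      · rw [← hq₄]
        funext l
        simp [Store.writeResidue, Store.mem_write]
      · rcases Nat.lt_succ_iff_lt_or_eq.1 hk' with h | rfl
        · rw [← hI1 k' h]
          simp [vec, Store.writeResidue, Store.mem_write, Ix.eval, hk₄, h.ne]
        · rw [← hI2 k' le_rfl, hqdef]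
          simp [scal, vec, mat, Store.writeResidue, Store.residue, Store.read, Store.mem_write,
            Ix.eval, hk₄, hi₄, hq₄, hT₄]
      · rw [← hI2 k' (by omega)]
        have : k' ≠ k := by omega
        simp [vec, Store.writeResidue, Store.mem_write, Ix.eval, hk₄, this]
    · rintro s₄ _ _ ⟨hcan₄, _, hI1, _⟩
      refine ⟨hcan₄, ?_⟩
      have hv : row N s₄.mem arrV (2 * d) =
          row N s₂.mem arrV (2 * d) - q • rows N s.mem arrT (2 * d) i := by
        funext k
        by_cases hk : k < 2 * d
        · simp [row_of_lt hk, rows_of_lt hk, hI1 k hk]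
        · simp [row, rows, hk]
      rw [hv]
      refine hI₂.step hT hi ?_
      rw [rows_of_lt (by omega), row_of_lt (by omega)]
      exact hq

theorem testAll_wp {A : ℕ → ℕ → ZMod N} (hN : s.mem .modulus [] = N) (hd : s.ix 0 = d)
    (hT : IsHowell (rows N s.mem arrT (2 * d)) (2 * d) (graph d A)) :
    testAll.Wp N ops s fun s' => s'.mem arrF [] = 0 ↔
      ∀ g < d, Solvable d A fun k => mat N s.mem arrG g k * vec N s.mem arrC k := by
  refine Cmd.wp_seq (Cmd.wp_const ?_)
  have hF := (Frame.refl testAll.arrs testAll.vars s).write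
    (x := ⟨arrF, []⟩) (by decide) 0
  refine Cmd.wp_for (n := d) hF (by decide) (by decide) (by simp [Ix.eval, hd])
    (fun K m => m arrF [] = 0 ↔
      ∀ g < K, Solvable d A fun k => mat N s.mem arrG g k * vec N s.mem arrC k)
    (by simp [Store.mem_write]) ?_ fun s' _ _ h => h
  intro g s₁ hg hF₁ hg₁ _ hI
  have hd₁ : s₁.ix 0 = d := (hF₁.2 _ (by decide)).trans hd
  refine Cmd.Wp.seq (Q₁ := fun s' => ∀ k < d, vec N s'.mem arrY k = mat N s.mem arrG g k)
    (Cmd.wp_for (n := d) hF₁ (by decide) (by decide) (by simp [Ix.eval, hd₁])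
      (fun K m => ∀ k < K, vec N m arrY k = mat N s.mem arrG g k) (by simp) ?_
      fun s' _ _ h => h) fun s₂ hF₂ hY => ?_
  · intro k s₂ hk hF₂ hk₂ hV₂ hI₂
    have hg₂ := (hV₂ 12 (by decide) (by decide)).trans hg₁
    refine Cmd.wp_copy fun k' hk' => ?_
    rcases Nat.lt_succ_iff_lt_or_eq.1 hk' with h | rfl
    · rw [← hI₂ k' h]
      simp [vec, Store.mem_write, Ix.eval, hk₂, h.ne]
    · simp [vec, mat, Store.mem_write, Store.read, Ix.eval, hk₂, hg₂, hF₂.1 arrG (by decide)]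
  · have hF₂' : Frame testAll.arrs testAll.vars s s₂ :=
      hF₁.trans (hF₂.mono (by decide) (by decide))
    have hd₂ : s₂.ix 0 = d := (hF₂'.2 _ (by decide)).trans hd
    have hT₂ := rows_congr (N := N) (hF₂'.1 arrT (by decide)) (2 * d)
    refine Cmd.Wp.seq (reduce_wp (A := A) (by rw [hF₂'.1 _ (by decide), hN]) hd₂
      (by rw [hT₂]; exact hT)) fun s₃ hF₃ ⟨hcan, hred⟩ => ?_
    refine (checkZero_wp ((hF₃.2 _ (by decide)).trans hd₂)).mono fun s₄ _ h => ?_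
    have hsol : (∀ k < d, s₃.mem arrV [k] = 0) ↔
        Solvable d A fun k => mat N s.mem arrG g k * vec N s.mem arrC k := by
      have h2 : Solvable d A (scaledVec N s₂.mem) ↔
          Solvable d A fun k => mat N s.mem arrG g k * vec N s.mem arrC k := by
        refine exists_congr fun x => forall₂_congr fun k hk => ?_
        rw [scaledVec, hY k hk]
        simp only [vec, hF₂'.1 arrC (by decide)]
      rw [← h2, hred.solvable_iff]
      exact forall₂_congr fun k hk => hcan.eq_zero_iff hk
    have hF₀ : s₃.mem arrF [] = s₁.mem arrF [] := by
      rw [hF₃.1 arrF (by decide), hF₂.1 arrF (by decide)]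
    rw [h, hsol, hF₀, hI]
    constructor
    · rintro ⟨h1, h2⟩ g' hg'
      rcases Nat.lt_succ_iff_lt_or_eq.1 hg' with h' | rfl
      · exact h1 g' h'
      · exact h2
    · exact fun h' => ⟨fun g' hg' => h' g' (by omega), h' g (by omega)⟩

end Blocks

/-! ### Residue rings in coordinates -/

/-- The combination `∑ φ (x k) * w k` of the first `d` elements of `w`. -/
def combo {Z R : Type*} [CommRing Z] [CommRing R] (φ : Z →+* R) (w : ℕ → R) (d : ℕ) (x : ℕ → Z) :
    R := ∑ k ∈ Finset.range d, φ (x k) * w k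

/-- A ring generated as an abelian group by `w 0, …, w (d - 1)`, with relations `n k * w k = 0` and
structure constants `Γ`; the canonical coordinates of an element are given by `co`. Since `N` is a
multiple of all `n k`, vectors of elements of `ℤ/Nℤ` represent elements of the ring. -/
structure Coordinates (N d : ℕ) (R : Type*) [CommRing R] where
  φ : ZMod N →+* R
  w : ℕ → R
  n : ℕ → ℕ
  Γ : ℕ → ℕ → ℕ → ℤ
  co : R → ℕ → ℤ
  mul_w : ∀ i < d, ∀ j < d, w i * w j = combo φ w d fun k => (Γ i j k : ZMod N)
  surj : ∀ r, ∃ x, combo φ w d x = r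
  n_pos : ∀ k < d, 1 ≤ n k
  n_dvd : ∀ k < d, n k ∣ N
  eq_zero_iff : ∀ z : ℕ → ℤ,
    combo φ w d (fun k => (z k : ZMod N)) = 0 ↔ ∀ k < d, (n k : ℤ) ∣ z k
  co_eq : ∀ z : ℕ → ℤ, ∀ k < d, co (combo φ w d fun k => (z k : ZMod N)) k = z k % n k

/-- Multiplication by a generator of the annihilator of `n` embeds `ℤ/nℤ` into `ℤ/Nℤ`; thus a
congruence modulo `n` becomes an equation in `ℤ/Nℤ`. -/
theorem isAnnResult_mul_eq_zero_iff {N n : ℕ} [NeZero N] (hn : n ∣ N) {c : ZMod N}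
    (hc : IsAnnResult (n : ZMod N) c) (z : ℤ) : (z : ZMod N) * c = 0 ↔ (n : ℤ) ∣ z := by
  obtain ⟨e, he⟩ := hn
  have he0 : (e : ℤ) ≠ 0 := by
    rintro h
    have : e = 0 := by exact_mod_cast h
    exact NeZero.ne N (by rw [he, this, mul_zero])
  constructor
  · intro h
    have h1 : (e : ZMod N) * n = 0 := by
      rw [← Nat.cast_mul, mul_comm, ← he, ZMod.natCast_self]
    obtain ⟨r, hr⟩ := Ideal.mem_span_singleton'.1 ((hc _).2 h1)
    have h2 : ((z * e : ℤ) : ZMod N) = 0 := by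
      push_cast
      rw [← hr, mul_left_comm, h, mul_zero]
    rw [ZMod.intCast_zmod_eq_zero_iff_dvd, he] at h2
    push_cast at h2
    exact Int.dvd_of_mul_dvd_mul_right he0 h2
  · rintro ⟨t, rfl⟩
    have h1 : c * n = 0 := (hc c).1 (Ideal.mem_span_singleton_self c)
    push_cast
    rw [mul_right_comm, mul_comm (n : ZMod N), h1, zero_mul]

namespace Coordinates

variable {N d : ℕ} {R : Type*} [CommRing R] (D : Coordinates N d R)

/-- The element with given coordinates. -/
def elt (x : ℕ → ZMod N) : R := combo D.φ D.w d x

theorem elt_congr {x y : ℕ → ZMod N} (h : ∀ k < d, x k = y k) : D.elt x = D.elt y := by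
  unfold elt combo
  exact Finset.sum_congr rfl fun k hk => by rw [h k (Finset.mem_range.1 hk)]

theorem elt_add (x y : ℕ → ZMod N) : D.elt (fun k => x k + y k) = D.elt x + D.elt y := by
  simp only [elt, combo, map_add, add_mul, Finset.sum_add_distrib]

theorem elt_neg (x : ℕ → ZMod N) : D.elt (fun k => -x k) = -D.elt x := by
  simp only [elt, combo, map_neg, neg_mul, Finset.sum_neg_distrib]

theorem elt_zero : D.elt (fun _ => 0) = 0 := by simp [elt, combo]

theorem elt_sum (x : ℕ → ZMod N) (a : ℕ → ℕ → ZMod N) (e : ℕ) :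
    D.elt (fun k => ∑ i ∈ Finset.range e, x i * a i k) =
      ∑ i ∈ Finset.range e, D.φ (x i) * D.elt (a i) := by
  simp only [elt, combo, map_sum, map_mul, Finset.sum_mul, Finset.mul_sum]
  rw [Finset.sum_comm]
  simp only [mul_assoc]

theorem elt_eq_zero_iff [NeZero N] {C : ℕ → ZMod N}
    (hC : ∀ k < d, IsAnnResult ((D.n k : ℕ) : ZMod N) (C k)) (x : ℕ → ZMod N) :
    D.elt x = 0 ↔ ∀ k < d, x k * C k = 0 := by
  have h := D.eq_zero_iff fun k => ((x k).val : ℤ)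
  simp only [Int.cast_natCast, ZMod.natCast_zmod_val] at h
  refine h.trans (forall₂_congr fun k hk => ?_)
  rw [← isAnnResult_mul_eq_zero_iff (D.n_dvd k hk) (hC k hk)]
  simp

/-- The rows of the matrix computed from the structure constants are the coordinates of the
products with the generators. -/
theorem elt_mul_w (x : ℕ → ZMod N) {j : ℕ} (hj : j < d) :
    D.elt (fun k => ∑ i ∈ Finset.range d, x i * (D.Γ i j k : ZMod N)) = D.elt x * D.w j := by
  rw [elt_sum, elt, combo, Finset.sum_mul]
  refine Finset.sum_congr rfl fun i hi => ?_
  rw [mul_assoc, D.mul_w i (Finset.mem_range.1 hi) j hj]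
  rfl

/-- The linear system belonging to a multiplication matrix expresses an equation in the ring. -/
theorem system_iff [NeZero N] {C : ℕ → ZMod N}
    (hC : ∀ k < d, IsAnnResult ((D.n k : ℕ) : ZMod N) (C k)) {e : R} {M : ℕ → ℕ → ZMod N}
    (hM : ∀ j < d, D.elt (M j) = e * D.w j) (x y : ℕ → ZMod N) :
    (∀ k < d, y k * C k = ∑ j ∈ Finset.range d, x j * (M j k * C k)) ↔
      D.elt x * e = D.elt y := by
  have h1 : D.elt (fun k => ∑ j ∈ Finset.range d, x j * M j k) = D.elt x * e := by
    rw [elt_sum, elt, combo, Finset.sum_mul]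
    refine Finset.sum_congr rfl fun j hj => ?_
    rw [hM j (Finset.mem_range.1 hj)]
    ring
  have h2 := D.elt_eq_zero_iff hC (fun k => y k + -∑ j ∈ Finset.range d, x j * M j k)
  rw [elt_add, elt_neg, h1] at h2
  rw [eq_comm (a := D.elt x * e), ← sub_eq_zero, sub_eq_add_neg, h2]
  refine forall₂_congr fun k _ => ?_
  rw [← sub_eq_zero, ← sub_eq_add_neg, sub_mul, Finset.sum_mul]
  simp only [mul_assoc]

end Coordinates

/-! ### Correctness of the building blocks -/

section Correctness

variable {N d : ℕ} {R : Type*} [CommRing R] {D : Coordinates N d R}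
  {ops : (k : ℕ) → BasicOps k} {s s' : Store}

/-- The memory describes the ring. -/
structure Describes (D : Coordinates N d R) (s : Store) : Prop where
  dim : s.ix 0 = d
  modulus : s.mem .modulus [] = N
  diag : ∀ k < d, s.mem .diag [k] = D.n k
  struct : ∀ i < d, ∀ j < d, ∀ k < d, s.mem .struct [i, j, k] = D.Γ i j k

/-- The memory describes the ring, and the scaling factors have been computed. -/
structure Ready (D : Coordinates N d R) (s : Store) : Prop extends Describes D s where
  scale : ∀ k < d, IsAnnResult ((D.n k : ℕ) : ZMod N) (vec N s.mem arrC k)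

theorem Describes.frame {A : List Arr} {V : List ℕ} (h : Describes D s) (hF : Frame A V s s')
    (hA : Arr.modulus ∉ A ∧ Arr.diag ∉ A ∧ Arr.struct ∉ A) (hV : 0 ∉ V) : Describes D s' where
  dim := (hF.2 0 hV).trans h.dim
  modulus := by rw [hF.1 _ hA.1]; exact h.modulus
  diag := by rw [hF.1 _ hA.2.1]; exact h.diag
  struct := by rw [hF.1 _ hA.2.2]; exact h.struct

theorem Ready.frame {A : List Arr} {V : List ℕ} (h : Ready D s) (hF : Frame A V s s')
    (hA : Arr.modulus ∉ A ∧ Arr.diag ∉ A ∧ Arr.struct ∉ A) (hC : arrC ∉ A) (hV : 0 ∉ V) :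
    Ready D s' where
  toDescribes := h.toDescribes.frame hF hA hV
  scale := by simpa only [vec, hF.1 _ hC] using h.scale

/-- The array `T` holds a Howell basis by which equations `z * e = y` can be solved for `z`. -/
def HowellOf (D : Coordinates N d R) (s : Store) (e : R) : Prop :=
  ∃ A : ℕ → ℕ → ZMod N, IsHowell (rows N s.mem arrT (2 * d)) (2 * d) (graph d A) ∧
    ∀ x y : ℕ → ZMod N, (∀ k < d, y k * vec N s.mem arrC k = ∑ j ∈ Finset.range d, x j * A j k) ↔
      D.elt x * e = D.elt y

theorem HowellOf.congr {e : R} (h : HowellOf D s e) (hT : s'.mem arrT = s.mem arrT)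
    (hC : s'.mem arrC = s.mem arrC) : HowellOf D s' e := by
  obtain ⟨A, h₁, h₂⟩ := h
  exact ⟨A, by rwa [rows_congr hT], by simpa only [vec, hC] using h₂⟩

variable (D) in
/-- The element whose coordinates are stored in an array. -/
def eltIn (s : Store) (A : Arr) : R := D.elt (vec N s.mem A)

variable (D) in
/-- The element whose coordinates are stored in a row of a two-dimensional array. -/
def eltRow (s : Store) (A : Arr) (i : ℕ) : R := D.elt (mat N s.mem A i)

theorem eltIn_congr {A : Arr} (h : s'.mem A = s.mem A) : eltIn D s' A = eltIn D s A := by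
  rw [eltIn, vec_congr h, eltIn]

theorem eltRow_congr {A : Arr} (h : s'.mem A = s.mem A) (i : ℕ) :
    eltRow D s' A i = eltRow D s A i := by
  rw [eltRow, mat_congr h, eltRow]

theorem combo_congr_row {A : Arr} (h : s'.mem A = s.mem A) (x : ℕ → ZMod N) :
    combo D.φ (eltRow D s' A) d x = combo D.φ (eltRow D s A) d x := by
  rw [funext (eltRow_congr h)]

theorem HowellOf.solvable_iff {e : R} {A : ℕ → ℕ → ZMod N} {c : ℕ → ZMod N}
    (h : ∀ x y : ℕ → ZMod N, (∀ k < d, y k * c k = ∑ j ∈ Finset.range d, x j * A j k) ↔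
      D.elt x * e = D.elt y) (y : ℕ → ZMod N) :
    Solvable d A (fun k => y k * c k) ↔ D.elt y ∈ Ideal.span {e} := by
  rw [Ideal.mem_span_singleton']
  constructor
  · rintro ⟨x, hx⟩
    exact ⟨_, (h x y).1 hx⟩
  · rintro ⟨r, hr⟩
    obtain ⟨x, rfl⟩ := D.surj r
    exact ⟨x, (h x y).2 hr⟩

variable [NeZero N]

theorem scaling_wp (h : Describes D s) :
    scaling.Wp N ops s fun s' => ∀ k < d, IsAnnResult ((D.n k : ℕ) : ZMod N)
      (vec N s'.mem arrC k) := by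
  have h1 : 1 ≤ N := NeZero.one_le
  refine Cmd.wp_for (n := d) (Frame.refl scaling.arrs scaling.vars s) (by decide) (by decide)
    (by simp [Ix.eval, h.dim])
    (fun K m => ∀ k < K, IsAnnResult ((D.n k : ℕ) : ZMod N) (vec N m arrC k))
    (by simp) ?_ fun s' _ _ h => h
  intro k s₁ hk hF₁ hk₁ _ hI
  have h₁ := h.frame hF₁ (by decide) (by decide)
  refine Cmd.wp_ann (m := N) (by simp [Store.read, h₁.modulus]) h1 le_rfl fun k' hk' => ?_
  rcases Nat.lt_succ_iff_lt_or_eq.1 hk' with hlt | rfl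
  · have := hI k' hlt
    simpa [vec, Store.writeResidue, Store.mem_write, Ix.eval, hk₁, hlt.ne] using this
  · have := (ops N).ann_spec ((D.n k' : ℕ) : ZMod N)
    simpa [vec, Store.writeResidue, Store.residue, Store.read, Store.mem_write, Ix.eval, hk₁,
      h₁.diag k' hk] using this

/-- Preparation for divisions by the element `E`. -/
def prepare : Cmd := mulMatrix ;; howell

theorem prepare_wp (h : Ready D s) :
    prepare.Wp N ops s fun s' => HowellOf D s' (eltIn D s arrE) ∧
      ∀ j < d, eltRow D s' arrM j = eltIn D s arrE * D.w j := by
  refine Cmd.Wp.seq (mulMatrix_wp h.modulus h.dim) fun s₁ hF₁ hM₁ => ?_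
  have h₁ := h.frame hF₁ (by decide) (by decide) (by decide)
  have hM : ∀ j < d, eltRow D s₁ arrM j = eltIn D s arrE * D.w j := by
    intro j hj
    rw [eltIn, ← D.elt_mul_w _ hj]
    refine D.elt_congr fun k hk => ?_
    rw [hM₁ j hj k hk]
    refine Finset.sum_congr rfl fun i hi => ?_
    rw [h.struct i (Finset.mem_range.1 hi) j hj k hk]
  refine (howell_wp h₁.modulus h₁.dim).mono fun s₂ hF₂ hT =>
    ⟨⟨_, hT, fun x y => ?_⟩, fun j hj => ?_⟩
  · rw [← D.system_iff (h₁.frame hF₂ (by decide) (by decide) (by decide)).scale hM]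
    simp only [scaled, vec, hF₂.1 arrC (by decide)]
  · rw [eltRow_congr (hF₂.1 _ (by decide)), hM j hj]

/-- The reduction of `Y` decides whether `Y` is a multiple of `e`; if so, the right half of `V` is
minus a quotient. -/
theorem solve_wp {e : R} (h : Ready D s) (hT : HowellOf D s e) :
    reduce.Wp N ops s fun s' =>
      ((∀ k < d, s'.mem arrV [k] = 0) ↔ eltIn D s arrY ∈ Ideal.span {e}) ∧
      (eltIn D s arrY ∈ Ideal.span {e} →
        D.elt (fun k => -vec N s'.mem arrV (d + k)) * e = eltIn D s arrY) := by
  obtain ⟨A, hA, hsys⟩ := hT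
  refine (reduce_wp h.modulus h.dim hA).mono fun s' hF hs' => ?_
  obtain ⟨hcan, hred⟩ := hs'
  have h1 := HowellOf.solvable_iff hsys (vec N s.mem arrY)
  have h2 := hred.solvable_iff
  have h3 : (∀ k < d, s'.mem arrV [k] = 0) ↔ eltIn D s arrY ∈ Ideal.span {e} := by
    refine Iff.trans ?_ (h2.symm.trans h1)
    exact forall₂_congr fun k hk => hcan.eq_zero_iff hk
  refine ⟨h3, fun hmem => (hsys _ _).1 fun k hk => ?_⟩
  have h4 := hred.solution (h2.1 (h1.2 hmem)) k hk
  rw [scaledVec] at h4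
  rw [h4]
  refine Finset.sum_congr rfl fun j hj => ?_
  rw [row_of_lt (by have := Finset.mem_range.1 hj; omega)]

theorem testAll_correct {e : R} (h : Ready D s) (hT : HowellOf D s e) :
    testAll.Wp N ops s fun s' => s'.mem arrF [] = 0 ↔
      ∀ g < d, eltRow D s arrG g ∈ Ideal.span {e} := by
  obtain ⟨A, hA, hsys⟩ := hT
  refine (testAll_wp h.modulus h.dim hA).mono fun s' _ hs' => ?_
  rw [hs']
  exact forall₂_congr fun g _ => HowellOf.solvable_iff hsys _

theorem combine_correct (h : Ready D s) :
    combine.Wp N ops s fun s' => eltIn D s' arrE =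
      eltIn D s arrB + combo D.φ (eltRow D s arrG) d (vec N s.mem arrX) := by
  refine (combine_wp h.modulus h.dim).mono fun s' _ hs' => ?_
  rw [eltIn, D.elt_congr hs', D.elt_add, D.elt_sum]
  rfl

/-- What is known after a successful trial: `E` differs from `B` by a combination of the rows of
`G`, generates an ideal that contains these rows, and can be divided by. -/
structure Found (D : Coordinates N d R) (s : Store) : Prop where
  howell : HowellOf D s (eltIn D s arrE)
  eq : eltIn D s arrE = eltIn D s arrB + combo D.φ (eltRow D s arrG) d (vec N s.mem arrX)
  mem : ∀ g < d, eltRow D s arrG g ∈ Ideal.span {eltIn D s arrE}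

/-- A trial without failure has found a suitable element, and there is no failure if the random
combination generates an ideal that contains the rows of `G`. -/
theorem trial_wp (h : Ready D s) :
    trial.Wp N ops s fun s' => (s'.mem arrF [] = 0 → Found D s') ∧
      ((∀ g < d, eltRow D s arrG g ∈ Ideal.span
        {eltIn D s arrB + combo D.φ (eltRow D s arrG) d (vec N s.mem arrX)}) →
        s'.mem arrF [] = 0) := by
  refine Cmd.Wp.seq (combine_correct h) fun s₁ hF₁ hE => ?_
  have h₁ := h.frame hF₁ (by decide) (by decide) (by decide)
  have hp := prepare_wp (ops := ops) h₁
  obtain ⟨s₂, hs₂, hT, _⟩ := hp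
  have hF₂ := Cmd.frame_of_eval hs₂
  have h₂ := h₁.frame hF₂ (by decide) (by decide) (by decide)
  obtain ⟨s₃, hs₃, hF⟩ := testAll_correct (ops := ops) h₂ hT
  have hF₃ := Cmd.frame_of_eval hs₃
  refine ⟨s₃, ?_, fun h0 => ?_, fun hg => hF.2 fun g hgd => ?_⟩
  · simp only [prepare, Cmd.eval] at hs₂ ⊢
    rw [← Option.bind_assoc, hs₂, Option.bind_some, hs₃]
  · have hG : s₃.mem arrG = s.mem arrG := by
      rw [hF₃.1 _ (by decide), hF₂.1 _ (by decide), hF₁.1 _ (by decide)]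
    have hB : s₃.mem arrB = s.mem arrB := by
      rw [hF₃.1 _ (by decide), hF₂.1 _ (by decide), hF₁.1 _ (by decide)]
    have hX : s₃.mem arrX = s.mem arrX := by
      rw [hF₃.1 _ (by decide), hF₂.1 _ (by decide), hF₁.1 _ (by decide)]
    have hE₃ : s₃.mem arrE = s₁.mem arrE := by
      rw [hF₃.1 _ (by decide), hF₂.1 _ (by decide)]
    refine ⟨?_, ?_, ?_⟩
    · rw [eltIn_congr hE₃]
      exact hT.congr (hF₃.1 _ (by decide)) (hF₃.1 _ (by decide))
    · rw [eltIn_congr hE₃, hE, eltIn_congr hB, combo_congr_row hG,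
        vec_congr hX]
    · intro g hg
      rw [eltIn_congr hE₃, eltRow_congr (hF₃.1 _ (by decide))]
      exact hF.1 h0 g hg
  · rw [hE, eltRow_congr (s := s) (by rw [hF₂.1 _ (by decide), hF₁.1 _ (by decide)])]
    exact hg g hgd

end Correctness

/-! ### Random vectors -/

section Random

variable {N : ℕ} {ops : (k : ℕ) → BasicOps k}

/-- The memory after the first `n` random choices of `randomX`. -/
def fillX (s : Store) : (n : ℕ) → (Fin n → ZMod N) → Store
  | 0, _ => s
  | n + 1, x => ((fillX s n (Fin.init x)).setIx 16 n).write ⟨arrX, [.var 16]⟩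
      ((x (Fin.last n)).val : ℤ)

theorem fillX_frame (s : Store) : ∀ (n : ℕ) (x : Fin n → ZMod N),
    Frame [arrX] [16] s (fillX s n x)
  | 0, _ => Frame.refl _ _ _
  | n + 1, x => ((fillX_frame s n (Fin.init x)).setIx (by decide) n).write (by decide) _

variable [NeZero N]

/-- A uniformly distributed vector is obtained by choosing its entries independently. -/
theorem uniform_snoc (n : ℕ) :
    PMF.uniformOfFintype (Fin (n + 1) → ZMod N) =
      (PMF.uniformOfFintype (Fin n → ZMod N)).bind fun x =>
        (PMF.uniformOfFintype (ZMod N)).map fun v => Fin.snoc x v := by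
  classical
  ext y
  rw [PMF.bind_apply, tsum_eq_single (Fin.init y), PMF.map_apply, tsum_eq_single (y (Fin.last n))]
  · simp only [Fin.snoc_init_self, if_true, PMF.uniformOfFintype_apply, Fintype.card_fun, ZMod.card,
      Fintype.card_fin, Nat.cast_pow]
    rw [pow_succ, ENNReal.mul_inv (Or.inr (by simp)) (Or.inr (by simp [NeZero.ne N]))]
  · intro v hv
    rw [if_neg]
    rintro h
    exact hv (by rw [h, Fin.snoc_last])
  · intro x hx
    rw [PMF.map_apply, ENNReal.tsum_eq_zero.2, mul_zero]
    intro v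
    rw [if_neg]
    rintro h
    exact hx (by rw [h, Fin.init_snoc])

theorem Instr.exec_rand {s : Store} {k x : Ref} (hk : s.read k = N) :
    (Instr.rand k x).exec N ops s =
      (PMF.uniformOfFintype (ZMod N)).map fun v => some (s.write x (v.val : ℤ)) := by
  classical
  have hne : (Finset.range N).Nonempty := Finset.nonempty_range_iff.2 (NeZero.ne N)
  have h1 : PMF.uniformOfFinset (Finset.range N) hne =
      (PMF.uniformOfFintype (ZMod N)).map ZMod.val := by
    ext v
    rw [PMF.map_apply, PMF.uniformOfFinset_apply]
    by_cases hv : v < N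
    · rw [if_pos (Finset.mem_range.2 hv), tsum_eq_single (v : ZMod N)]
      · simp [ZMod.val_natCast_of_lt hv]
      · intro a ha
        rw [if_neg]
        rintro rfl
        exact ha (by simp)
    · rw [if_neg (by simpa using hv), ENNReal.tsum_eq_zero.2]
      intro a
      rw [if_neg]
      rintro rfl
      exact hv (ZMod.val_lt a)
  have h2 : (s.read k).toNat = N := by rw [hk, Int.toNat_natCast]
  simp only [Instr.exec, h2]
  rw [dif_pos hne, h1, PMF.map_comp]
  rfl

theorem vec_fillX (s : Store) : ∀ (n : ℕ) (x : Fin n → ZMod N) (i : Fin n),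
    vec N (fillX s n x).mem arrX i = x i
  | n + 1, x, i => by
    refine Fin.lastCases ?_ (fun j => ?_) i
    · simp [fillX, vec, Store.mem_write, Store.setIx, Ix.eval]
    · have := vec_fillX s n (Fin.init x) j
      have hj : (j : ℕ) ≠ n := j.2.ne
      simpa [fillX, vec, Store.mem_write, Store.setIx, Ix.eval, hj, Fin.init] using this

/-- The only randomized part of the programs, as an image of the uniform distribution on vectors. -/
theorem exec_randomX (fuel : ℕ) {s : Store} {d : ℕ} (hN : s.mem .modulus [] = N)
    (hd : s.ix 0 = d) :
    randomX.exec N ops fuel s =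
      (PMF.uniformOfFintype (Fin d → ZMod N)).map fun x => (some (fillX s d x), 2 * d) := by
  have key : ∀ n, Outcome.forLoop
      ((Cmd.prim (.rand refN ⟨arrX, [.var 16]⟩)).exec N ops fuel) 16 n s =
      (PMF.uniformOfFintype (Fin n → ZMod N)).map fun x => (some (fillX s n x), 2 * n) := by
    intro n
    induction n with
    | zero =>
      have h : (fun x : Fin 0 → ZMod N => (some (fillX s 0 x), 2 * 0)) =
          Function.const _ (some s, 0) := rfl
      rw [h, PMF.map_const]
      rfl
    | succ n ih =>
      rw [Outcome.forLoop, ih, Outcome.andThen, PMF.bind_map, uniform_snoc, PMF.map_bind]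
      congr 1
      funext x
      simp only [Function.comp_apply, Cmd.exec]
      rw [Instr.exec_rand (N := N) (by
        simp [Store.read, Store.setIx, (fillX_frame s n x).1 .modulus (by decide), hN])]
      simp only [Outcome.tick, PMF.map_comp]
      congr 1
      funext v
      simp [fillX, Fin.init_snoc, mul_add]
  rw [randomX, Cmd.exec]
  simp only [Ix.eval, hd]
  exact key d

end Random

/-! ### The search for a generator -/

section Search

variable {N d : ℕ} {R : Type*} [CommRing R] {D : Coordinates N d R}
  {ops : (k : ℕ) → BasicOps k} {s : Store}

/-- The proportion of units in a finite ring. -/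
noncomputable def unitRatio (R : Type*) [CommRing R] : ℝ≥0∞ :=
  (Nat.card Rˣ : ℝ≥0∞) / (Nat.card R : ℝ≥0∞)

theorem unitRatio_ne_zero [Finite R] : unitRatio R ≠ 0 :=
  ENNReal.div_ne_zero.2 ⟨by simpa using (Nat.card_pos (α := Rˣ)).ne', by simp⟩

theorem unitRatio_le_one [Finite R] : unitRatio R ≤ 1 := by
  refine ENNReal.div_le_of_le_mul ?_
  rw [one_mul]
  exact_mod_cast Nat.card_le_card_of_injective _ (Units.val_injective (α := R))

/-- Random combinations as a homomorphism. -/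
def comboHom (φ : ZMod N →+* R) (w : ℕ → R) (d : ℕ) : (Fin d → ZMod N) →+ R where
  toFun x := ∑ i : Fin d, φ (x i) * w i
  map_zero' := by simp
  map_add' x y := by simp [add_mul, Finset.sum_add_distrib]

theorem combo_eq_comboHom (φ : ZMod N →+* R) (w : ℕ → R) {d : ℕ} {x : ℕ → ZMod N}
    {y : Fin d → ZMod N} (h : ∀ i : Fin d, x i = y i) : combo φ w d x = comboHom φ w d y := by
  rw [combo, Finset.sum_range]
  exact Finset.sum_congr rfl fun i _ => by rw [h i]

theorem trial_bounded : trial.Bounded := by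
  simp [trial, combine, mulMatrix, howell, testAll, clearT, loadRow, loadAnn, insertVec, insertStep,
    reduce, checkZero, Cmd.Bounded, Instr.vars]

variable [NeZero N]

/-- The search terminates after an expected number of at most `1 / p` trials, where `p` is the
proportion of units, and finds a generator of the ideal of all combinations of the rows of `G`,
together with the element `B`. -/
theorem search_runs [Finite R] [IsPrincipalIdealRing R] (h : Ready D s) (b : R)
    (hb : ∀ y, (∃ x, combo D.φ (eltRow D s arrG) d x = y) ↔ y ∈ Ideal.span {b}) :
    search.Runs N ops s
      (fun s' => Frame search.arrs search.vars s s' ∧ Found D s')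
      (2 + ((trial.cost d + 2 * d : ℕ) + 2) / unitRatio R) := by
  have hF : Frame search.arrs search.vars s (s.write ⟨arrF, []⟩ 1) :=
    (Frame.refl _ _ _).write (by decide) _
  have hstart : (Cmd.prim (.const ⟨arrF, []⟩ 1)).Runs N ops s
      (fun s' => Frame search.arrs search.vars s s' ∧ (s'.mem arrF [] = 0 → Found D s')) 1 := by
    have h1 : (Cmd.prim (.const ⟨arrF, []⟩ 1)).Wp N ops s
        (fun s' => Frame search.arrs search.vars s s' ∧ (s'.mem arrF [] = 0 → Found D s')) :=
      Cmd.wp_const ⟨hF, fun h0 => absurd h0 (by simp [Store.mem_write])⟩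
    exact (h1.runs (d := d) (by simp [Cmd.Bounded, Instr.vars]) h.dim).mono (fun _ h => h.2)
      (by simp [Cmd.cost])
  refine (hstart.seq fun s₁ h₁ => (Cmd.runs_while
    (Inv := fun s' => Frame search.arrs search.vars s s' ∧ (s'.mem arrF [] = 0 → Found D s'))
    (B := ((trial.cost d + 2 * d : ℕ) : ℝ≥0∞))
    (p := unitRatio R) unitRatio_ne_zero unitRatio_le_one ?_ h₁).mono (Q' := fun s' =>
      Frame search.arrs search.vars s s' ∧ Found D s') ?_ le_rfl).mono (fun _ h => h) ?_
  · rintro s₁ fuel ⟨hF₁, _⟩ _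
    have h₁ := h.frame hF₁ (by decide) (by decide) (by decide)
    -- The outcome of a trial is a function of the random coefficients.
    have hfill : ∀ x : Fin d → ZMod N, Frame search.arrs search.vars s (fillX s₁ d x) := fun x =>
      hF₁.trans ((fillX_frame s₁ d x).mono (by decide) (by decide))
    have hrdy : ∀ x : Fin d → ZMod N, Ready D (fillX s₁ d x) := fun x =>
      h.frame (hfill x) (by decide) (by decide) (by decide)
    have hrun : ∀ x : Fin d → ZMod N, ∃ s₂, ∃ n ≤ trial.cost d,
        trial.exec N ops fuel (fillX s₁ d x) = PMF.pure (some s₂, n) ∧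
        Frame search.arrs search.vars s s₂ ∧ (s₂.mem arrF [] = 0 → Found D s₂) ∧
        ((∀ y ∈ (comboHom D.φ (eltRow D s arrG) d).range,
          y ∈ Ideal.span {eltIn D s arrB + comboHom D.φ (eltRow D s arrG) d x}) →
          s₂.mem arrF [] = 0) := by
      intro x
      obtain ⟨s₂, hs₂, hfound, hsucc⟩ := trial_wp (ops := ops) (hrdy x)
      obtain ⟨n, hn, he⟩ := Cmd.exec_of_eval fuel d trial_bounded (hrdy x).dim hs₂
      refine ⟨s₂, n, hn, he, (hfill x).trans ((Cmd.frame_of_eval hs₂).mono (by decide) (by decide)),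
        hfound, fun hy => hsucc fun g hg => ?_⟩
      have hG : (fillX s₁ d x).mem arrG = s.mem arrG := (hfill x).1 _ (by decide)
      have hB : (fillX s₁ d x).mem arrB = s.mem arrB := (hfill x).1 _ (by decide)
      rw [combo_congr_row hG, eltRow_congr hG, eltIn_congr hB,
        combo_eq_comboHom D.φ _ (vec_fillX s₁ d x)]
      refine hy _ ⟨Pi.single ⟨g, hg⟩ 1, ?_⟩
      change ∑ i : Fin d, _ = _
      rw [Finset.sum_eq_single ⟨g, hg⟩]
      · simp
      · intro i _ hi; simp [hi]
      · simp
    choose S n hn hex hfr hfound hsucc using hrun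
    refine ⟨Fin d → ZMod N, PMF.uniformOfFintype _, S, fun x => 2 * d + n x, ?_,
      fun x => ⟨hfr x, hfound x⟩, fun x => ?_, ?_⟩
    · rw [Cmd.exec, exec_randomX fuel h₁.modulus h₁.dim, Outcome.andThen, PMF.bind_map,
        ← PMF.bind_pure_comp]
      congr 1
      funext x
      simp [hex, PMF.pure_map]
    · have := hn x
      exact_mod_cast (by omega : 2 * d + n x ≤ trial.cost d + 2 * d)
    · -- Compare the number of successful choices with the number of units.
      classical
      have hcount := card_units_mul_card_le (comboHom D.φ (eltRow D s arrG) d) (eltIn D s arrB) b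
        (fun y => by
          rw [← hb]
          constructor
          · rintro ⟨x, rfl⟩
            exact ⟨fun i => if hi : i < d then x ⟨i, hi⟩ else 0,
              combo_eq_comboHom _ _ fun i => by simp⟩
          · rintro ⟨x, rfl⟩
            exact ⟨fun i => x i, (combo_eq_comboHom _ _ fun i => rfl).symm⟩)
      have hle : Nat.card {x : Fin d → ZMod N // ∀ y ∈ (comboHom D.φ (eltRow D s arrG) d).range,
          y ∈ Ideal.span {eltIn D s arrB + comboHom D.φ (eltRow D s arrG) d x}} ≤
          Nat.card {x : Fin d → ZMod N // (S x).mem arrF [] = 0} :=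
        Nat.card_le_card_of_injective (fun x => ⟨x.1, hsucc x.1 x.2⟩) fun x y hxy =>
          Subtype.ext (Subtype.mk.inj hxy)
      have hcard := hcount.trans (Nat.mul_le_mul_right _ hle)
      have hsum : ∑' x, PMF.uniformOfFintype (Fin d → ZMod N) x *
          (if (S x).read ⟨arrF, []⟩ = 0 then (1 : ℝ≥0∞) else 0) =
          (Nat.card {x : Fin d → ZMod N // (S x).mem arrF [] = 0} : ℝ≥0∞) /
            (Nat.card (Fin d → ZMod N) : ℝ≥0∞) := by
        simp only [PMF.uniformOfFintype_apply, ENNReal.tsum_mul_left]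
        rw [tsum_fintype, Finset.sum_ite, Finset.sum_const_zero, add_zero, Finset.sum_const,
          nsmul_one, mul_comm, ← div_eq_mul_inv, Nat.card_eq_fintype_card,
          Nat.card_eq_fintype_card, Fintype.card_subtype]
        rfl
      rw [hsum, unitRatio]
      have hA : (Nat.card (Fin d → ZMod N) : ℝ≥0∞) ≠ 0 := by
        simpa using (Nat.card_pos (α := Fin d → ZMod N)).ne'
      have hR : (Nat.card R : ℝ≥0∞) ≠ 0 := by
        simpa using (Nat.card_pos (α := R)).ne'
      rw [ENNReal.div_le_iff hR (by simp), ENNReal.mul_comm_div, ← mul_div_assoc,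
        ENNReal.le_div_iff_mul_le (Or.inl hA) (Or.inl (by simp))]
      exact_mod_cast hcard
  · rintro s₂ ⟨⟨hF₂, hfound⟩, h0⟩
    exact ⟨hF₂, hfound h0⟩
  · rw [← add_assoc, one_add_one_eq_two]

end Search

/-! ### Input and output -/

section InputOutput

variable {N d : ℕ} {R : Type*} [CommRing R] {D : Coordinates N d R}
  {ops : (k : ℕ) → BasicOps k} {s : Store}

theorem loadVec_wp {A : Arr} {x : Ref} {f : ℕ → ℤ} (hd : s.ix 0 = d)
    (hx : ∀ s', Frame [A] [19] s s' → s'.read x = f (s'.ix 19)) :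
    (loadVec A x).Wp N ops s fun s' => ∀ k < d, s'.mem A [k] = f k := by
  refine Cmd.wp_for (n := d) (Frame.refl [A] [19] s) (by simp [Cmd.arrs, Instr.arrs])
    (by simp [Cmd.vars, Instr.vars]) (by simp [Ix.eval, hd])
    (fun K m => ∀ k < K, m A [k] = f k) (by simp) ?_ fun s' _ _ h => h
  intro k s₁ hk hF₁ hk₁ _ hI
  refine Cmd.wp_copy fun k' hk' => ?_
  rcases Nat.lt_succ_iff_lt_or_eq.1 hk' with h | rfl
  · rw [← hI k' h]
    simp [Store.mem_write, Ix.eval, hk₁, h.ne]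
  · simp [Store.mem_write, Ix.eval, hk₁, hx s₁ hF₁]

theorem zeroB_wp (hd : s.ix 0 = d) :
    zeroB.Wp N ops s fun s' => eltIn D s' arrB = 0 := by
  refine Cmd.wp_for (n := d) (Frame.refl zeroB.arrs zeroB.vars s) (by decide) (by decide)
    (by simp [Ix.eval, hd]) (fun K m => ∀ k < K, m arrB [k] = 0) (by simp) ?_ fun s' _ _ h => ?_
  · intro k s₁ hk hF₁ hk₁ _ hI
    refine Cmd.wp_const fun k' hk' => ?_
    rcases Nat.lt_succ_iff_lt_or_eq.1 hk' with h | rfl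
    · rw [← hI k' h]
      simp [Store.mem_write, Ix.eval, hk₁, h.ne]
    · simp [Store.mem_write, Ix.eval, hk₁]
  · rw [eltIn, ← D.elt_zero]
    exact D.elt_congr fun k hk => by simp [vec, h k hk]

theorem loadG_wp {x : Ref} {f : ℕ → ℕ → ℤ} (hd : s.ix 0 = d)
    (hx : ∀ s', Frame [arrG] [19, 20] s s' → s'.read x = f (s'.ix 19) (s'.ix 20)) :
    (loadG x).Wp N ops s fun s' => ∀ i < d, ∀ k < d, s'.mem arrG [i, k] = f i k := by
  refine Cmd.wp_for (n := d) (Frame.refl [arrG] [19, 20] s) (by simp [Cmd.arrs, Instr.arrs])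
    (by simp [Cmd.vars, Instr.vars]) (by simp [Ix.eval, hd])
    (fun J m => ∀ i < J, ∀ k < d, m arrG [i, k] = f i k) (by simp) ?_ fun s' _ _ h => h
  intro i s₁ hi hF₁ hi₁ _ hI
  refine Cmd.wp_for (n := d) hF₁ (by simp [Cmd.arrs, Instr.arrs])
    (by simp [Cmd.vars, Instr.vars]) (by simp [Ix.eval, (hF₁.2 0 (by decide)).trans hd])
    (fun K m => (∀ i' < i, ∀ k < d, m arrG [i', k] = f i' k) ∧ ∀ k < K, m arrG [i, k] = f i k)
    ⟨hI, by simp⟩ ?_ ?_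
  · rintro k s₂ hk hF₂ hk₂ hV₂ ⟨hI₁, hI₂⟩
    have hi₂ := (hV₂ 19 (by decide) (by simp [Cmd.vars, Instr.vars])).trans hi₁
    refine Cmd.wp_copy ⟨fun i' hi' k' hk' => ?_, fun k' hk' => ?_⟩
    · rw [← hI₁ i' hi' k' hk']
      simp [Store.mem_write, Ix.eval, hi₂, hk₂, hi'.ne]
    · rcases Nat.lt_succ_iff_lt_or_eq.1 hk' with h | rfl
      · rw [← hI₂ k' h]
        simp [Store.mem_write, Ix.eval, hi₂, hk₂, h.ne]
      · simp [Store.mem_write, Ix.eval, hi₂, hk₂, hx s₂ hF₂]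
  · rintro s₂ _ _ ⟨hI₁, hI₂⟩ i' hi' k hk
    rcases Nat.lt_succ_iff_lt_or_eq.1 hi' with h | rfl
    · exact hI₁ i' h k hk
    · exact hI₂ k hk

theorem unitG_wp (hd : s.ix 0 = d) :
    unitG.Wp N ops s fun s' => ∀ i < d, eltRow D s' arrG i = D.w i := by
  refine Cmd.wp_for (n := d) (Frame.refl unitG.arrs unitG.vars s) (by decide)
    (by decide) (by simp [Ix.eval, hd])
    (fun J m => ∀ i < J, ∀ k < d, m arrG [i, k] = if k = i then 1 else 0) (by simp) ?_
    fun s' _ _ h i hi => ?_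
  · intro i s₁ hi hF₁ hi₁ _ hI
    have hd₁ := (hF₁.2 0 (by decide)).trans hd
    refine Cmd.wp_seq (Cmd.wp_for (n := d) hF₁ (by decide) (by decide) (by simp [Ix.eval, hd₁])
      (fun K m => (∀ i' < i, ∀ k < d, m arrG [i', k] = if k = i' then 1 else 0) ∧
        ∀ k < K, m arrG [i, k] = 0) ⟨hI, by simp⟩ ?_ ?_)
    · rintro k s₂ hk hF₂ hk₂ hV₂ ⟨hI₁, hI₂⟩
      have hi₂ := (hV₂ 19 (by decide) (by decide)).trans hi₁
      refine Cmd.wp_const ⟨fun i' hi' k' hk' => ?_, fun k' hk' => ?_⟩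
      · rw [← hI₁ i' hi' k' hk']
        simp [Store.mem_write, Ix.eval, hi₂, hk₂, hi'.ne]
      · rcases Nat.lt_succ_iff_lt_or_eq.1 hk' with h | rfl
        · rw [← hI₂ k' h]
          simp [Store.mem_write, Ix.eval, hi₂, hk₂, h.ne]
        · simp [Store.mem_write, Ix.eval, hi₂, hk₂]
    · rintro s₂ _ hV₂ ⟨hI₁, hI₂⟩
      have hi₂ := (hV₂ 19 (by decide) (by decide)).trans hi₁
      refine Cmd.wp_const fun i' hi' k hk => ?_
      rcases Nat.lt_succ_iff_lt_or_eq.1 hi' with h | rfl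
      · rw [← hI₁ i' h k hk]
        simp [Store.mem_write, Ix.eval, hi₂, h.ne]
      · by_cases hki : k = i'
        · simp [Store.mem_write, Ix.eval, hi₂, hki]
        · simp [Store.mem_write, Ix.eval, hi₂, hki, hI₂ k hk]
  · rw [eltRow, Coordinates.elt, combo, Finset.sum_eq_single i]
    · simp [mat, h i hi i hi]
    · intro k hk hki
      simp [mat, h i hi k (Finset.mem_range.1 hk), hki]
    · simp [hi]

/-- Row `t` of the output holds the canonical coordinates of `c`. -/
def OutputIs (D : Coordinates N d R) (s : Store) (t : ℕ) (c : R) : Prop :=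
  ∀ k < d, s.mem .output [t, k] = D.co c k

variable [NeZero N]

theorem writeSum_wp {t : ℕ} {x y : Ref} {f g : ℕ → ℤ} (h : Describes D s)
    (hx : ∀ s', Frame [.output] [18] s s' → s'.read x = f (s'.ix 18))
    (hy : ∀ s', Frame [.output] [18] s s' → s'.read y = g (s'.ix 18)) :
    (writeSum t x y).Wp N ops s fun s' =>
      OutputIs D s' t (D.elt fun k => (f k : ZMod N) + g k) ∧
      ∀ t' c, t' ≠ t → OutputIs D s t' c → OutputIs D s' t' c := by
  refine Cmd.wp_for (n := d) (Frame.refl [.output] [18] s) (by simp [Cmd.arrs, Instr.arrs])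
    (by simp [Cmd.vars, Instr.vars]) (by simp [Ix.eval, h.dim])
    (fun K m => (∀ k < K, m .output [t, k] = (f k + g k) % D.n k) ∧
      ∀ t' k, t' ≠ t → m .output [t', k] = s.mem .output [t', k]) (by simp) ?_ ?_
  · rintro k s₁ hk hF₁ hk₁ _ ⟨hI₁, hI₂⟩
    have h₁ := h.frame hF₁ (by decide) (by decide)
    have hn := D.n_pos k hk
    have : NeZero (D.n k) := ⟨by omega⟩
    refine Cmd.wp_add (m := D.n k) (by simp [Store.read, Ix.eval, hk₁, h₁.diag k hk]) hn
      (Nat.le_of_dvd (NeZero.pos N) (D.n_dvd k hk)) ⟨fun k' hk' => ?_, fun t' k' ht' => ?_⟩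
    · rcases Nat.lt_succ_iff_lt_or_eq.1 hk' with h' | rfl
      · rw [← hI₁ k' h']
        simp [Store.writeResidue, Store.mem_write, Ix.eval, hk₁, h'.ne]
      · have := ZMod.val_intCast (n := D.n k') (f k' + g k')
        simp only [Int.cast_add] at this
        simp [Store.writeResidue, Store.mem_write, Store.residue, Ix.eval, hk₁, hx s₁ hF₁,
          hy s₁ hF₁, ← this]
    · rw [← hI₂ t' k' ht']
      simp [Store.writeResidue, Store.mem_write, Ix.eval, ht']
  · rintro s' _ _ ⟨h₁, h₂⟩
    refine ⟨fun k hk => ?_, fun t' c ht' hc k hk => by rw [h₂ t' k ht', hc k hk]⟩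
    have := D.co_eq (fun k => f k + g k) k hk
    simp only [Int.cast_add] at this
    rw [h₁ k hk, ← this, Coordinates.elt]

theorem writeDiff_wp {t : ℕ} {x y : Ref} {f g : ℕ → ℤ} (h : Describes D s)
    (hx : ∀ s', Frame [.output] [18] s s' → s'.read x = f (s'.ix 18))
    (hy : ∀ s', Frame [.output] [18] s s' → s'.read y = g (s'.ix 18)) :
    (writeDiff t x y).Wp N ops s fun s' =>
      OutputIs D s' t (D.elt fun k => (f k : ZMod N) - g k) ∧
      ∀ t' c, t' ≠ t → OutputIs D s t' c → OutputIs D s' t' c := by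
  refine Cmd.wp_for (n := d) (Frame.refl [.output] [18] s) (by simp [Cmd.arrs, Instr.arrs])
    (by simp [Cmd.vars, Instr.vars]) (by simp [Ix.eval, h.dim])
    (fun K m => (∀ k < K, m .output [t, k] = (f k - g k) % D.n k) ∧
      ∀ t' k, t' ≠ t → m .output [t', k] = s.mem .output [t', k]) (by simp) ?_ ?_
  · rintro k s₁ hk hF₁ hk₁ _ ⟨hI₁, hI₂⟩
    have h₁ := h.frame hF₁ (by decide) (by decide)
    have hn := D.n_pos k hk
    have : NeZero (D.n k) := ⟨by omega⟩
    refine Cmd.wp_sub (m := D.n k) (by simp [Store.read, Ix.eval, hk₁, h₁.diag k hk]) hn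
      (Nat.le_of_dvd (NeZero.pos N) (D.n_dvd k hk)) ⟨fun k' hk' => ?_, fun t' k' ht' => ?_⟩
    · rcases Nat.lt_succ_iff_lt_or_eq.1 hk' with h' | rfl
      · rw [← hI₁ k' h']
        simp [Store.writeResidue, Store.mem_write, Ix.eval, hk₁, h'.ne]
      · have := ZMod.val_intCast (n := D.n k') (f k' - g k')
        simp only [Int.cast_sub] at this
        simp [Store.writeResidue, Store.mem_write, Store.residue, Ix.eval, hk₁, hx s₁ hF₁,
          hy s₁ hF₁, ← this]
    · rw [← hI₂ t' k' ht']
      simp [Store.writeResidue, Store.mem_write, Ix.eval, ht']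
  · rintro s' _ _ ⟨h₁, h₂⟩
    refine ⟨fun k hk => ?_, fun t' c ht' hc k hk => by rw [h₂ t' k ht', hc k hk]⟩
    have := D.co_eq (fun k => f k - g k) k hk
    simp only [Int.cast_sub] at this
    rw [h₁ k hk, ← this, Coordinates.elt]

theorem writeOut_wp {t : ℕ} {x : Ref} {f : ℕ → ℤ} (h : Describes D s)
    (hx : ∀ s', Frame [.output, .work 29] [18] s s' → s'.read x = f (s'.ix 18)) :
    (writeOut t x).Wp N ops s fun s' =>
      OutputIs D s' t (D.elt fun k => (f k : ZMod N)) ∧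
      ∀ t' c, t' ≠ t → OutputIs D s t' c → OutputIs D s' t' c := by
  have hF : Frame [.output, .work 29] [18] s (s.write (tmp 9) 0) :=
    (Frame.refl _ _ _).write (by decide) _
  refine Cmd.wp_seq (Cmd.wp_const ?_)
  refine (writeSum_wp (f := fun _ => 0) (g := f) (h.frame hF (by decide) (by decide))
    (fun s' hF' => ?_) (fun s' hF' => hx s' (hF.trans (hF'.mono (by decide) (by decide))))).mono ?_
  · have := hF'.1 (.work 29) (by decide)
    simp [Store.read, this, Store.mem_write]
  · rintro s' _ ⟨h₁, h₂⟩
    refine ⟨by simpa using h₁, fun t' c ht' hc => h₂ t' c ht' fun k hk => ?_⟩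
    rw [← hc k hk, Store.mem_write_of_ne _ _ (by decide)]

theorem writeNeg_wp {t : ℕ} {x : Ref} {f : ℕ → ℤ} (h : Describes D s)
    (hx : ∀ s', Frame [.output, .work 29] [18] s s' → s'.read x = f (s'.ix 18)) :
    (writeNeg t x).Wp N ops s fun s' =>
      OutputIs D s' t (D.elt fun k => -(f k : ZMod N)) ∧
      ∀ t' c, t' ≠ t → OutputIs D s t' c → OutputIs D s' t' c := by
  have hF : Frame [.output, .work 29] [18] s (s.write (tmp 9) 0) :=
    (Frame.refl _ _ _).write (by decide) _
  refine Cmd.wp_seq (Cmd.wp_const ?_)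
  refine (writeDiff_wp (f := fun _ => 0) (g := f) (h.frame hF (by decide) (by decide))
    (fun s' hF' => ?_) (fun s' hF' => hx s' (hF.trans (hF'.mono (by decide) (by decide))))).mono ?_
  · have := hF'.1 (.work 29) (by decide)
    simp [Store.read, this, Store.mem_write]
  · rintro s' _ ⟨h₁, h₂⟩
    refine ⟨by simpa using h₁, fun t' c ht' hc => h₂ t' c ht' fun k hk => ?_⟩
    rw [← hc k hk, Store.mem_write_of_ne _ _ (by decide)]

end InputOutput

/-! ### The programs -/

/-- Prepare for divisions by operand `t`, and let the rows of `G` generate the ideal of its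
multiples. -/
def divisor (t : ℕ) : Cmd :=
  scaling ;; loadVec arrE ⟨.input, [.lit t, .var 19]⟩ ;; prepare ;;
    loadG ⟨arrM, [.var 19, .var 20]⟩

/-- Row `0` of the output is the sum of the operands. -/
def progAdd : Cmd := writeSum 0 ⟨.input, [.lit 0, .var 18]⟩ ⟨.input, [.lit 1, .var 18]⟩

/-- Row `0` of the output is the difference of the operands. -/
def progSub : Cmd := writeDiff 0 ⟨.input, [.lit 0, .var 18]⟩ ⟨.input, [.lit 1, .var 18]⟩

/-- Row `0` of the output is the product of the operands, as a combination of the rows of the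
multiplication matrix of the first one. -/
def progMul : Cmd :=
  divisor 0 ;; loadVec arrX ⟨.input, [.lit 1, .var 19]⟩ ;; zeroB ;; combine ;;
    writeOut 0 ⟨arrE, [.var 18]⟩

/-- Row `0` of the output is a quotient of the operands, from the solution of a linear equation. -/
def progDiv : Cmd :=
  divisor 1 ;; loadVec arrY ⟨.input, [.lit 0, .var 19]⟩ ;; reduce ;;
    writeNeg 0 ⟨arrV, [.add (.var 0) (.var 18)]⟩

/-- The first part of Euclidean division: set the flag unless the division is exact. -/
def eudivTest : Cmd :=
  divisor 1 ;; loadVec arrY ⟨.input, [.lit 0, .var 19]⟩ ;; .prim (.const ⟨arrF, []⟩ 0) ;;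
    reduce ;; checkZero

/-- The output of an exact division; the remainder zero is written as the difference of a vector
with itself. -/
def eudivExact : Cmd :=
  writeNeg 0 ⟨arrV, [.add (.var 0) (.var 18)]⟩ ;; writeDiff 1 ⟨arrX, [.var 18]⟩ ⟨arrX, [.var 18]⟩

/-- Load the first operand into `B`. -/
def loadB : Cmd := loadVec arrB ⟨.input, [.lit 0, .var 19]⟩

/-- The output of a division with remainder. -/
def eudivEnd : Cmd := writeNeg 0 ⟨arrX, [.var 18]⟩ ;; writeOut 1 ⟨arrE, [.var 18]⟩

/-- Rows `0` and `1` of the output are quotient and remainder. If the division is not exact, the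
remainder is a generator `a + x * b` of `(a, b)`, and the quotient is `-x`. -/
def progEudiv : Cmd :=
  eudivTest ;; .ifZero ⟨arrF, []⟩ eudivExact (loadB ;; search ;; eudivEnd)

/-- Preparation for the search of a unit. -/
def unitStart : Cmd := scaling ;; unitG ;; zeroB

/-- The unit element is obtained by dividing a unit by itself. -/
def unitEnd : Cmd :=
  loadVec arrY ⟨arrE, [.var 19]⟩ ;; reduce ;;
    loadVec arrU ⟨arrV, [.add (.var 0) (.var 19)]⟩ ;;
    divisor 1 ;; loadB

/-- From a generator `g = a + x * b` of `(a, b)`, compute the transformation matrix. -/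
def xgcdEnd : Cmd :=
  writeOut 0 ⟨arrE, [.var 18]⟩ ;; writeNeg 1 ⟨arrU, [.var 18]⟩ ;; writeOut 2 ⟨arrX, [.var 18]⟩ ;;
    loadVec arrY ⟨.input, [.lit 1, .var 19]⟩ ;; reduce ;;
    writeOut 3 ⟨arrV, [.add (.var 0) (.var 18)]⟩ ;;
    loadVec arrE ⟨arrV, [.add (.var 0) (.var 19)]⟩ ;; prepare ;;
    loadG ⟨arrM, [.var 19, .var 20]⟩ ;; zeroB ;; combine ;;
    writeDiff 4 ⟨arrE, [.var 18]⟩ ⟨arrU, [.var 18]⟩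

/-- Rows `0` to `4` of the output are the gcd and the entries of the transformation matrix. The
coordinates of the unit element, which the matrix requires, are not part of the input; therefore a
unit is searched for first. -/
def progXgcd : Cmd := unitStart ;; search ;; unitEnd ;; search ;; xgcdEnd

/-- Preparation for the search of a generator of an annihilator. -/
def annStart : Cmd :=
  divisor 0 ;; loadG ⟨arrT, [.add (.var 0) (.var 19), .add (.var 0) (.var 20)]⟩ ;; zeroB

/-- Row `0` of the output generates the annihilator of the operand. -/
def progAnn : Cmd := annStart ;; search ;; writeOut 0 ⟨arrE, [.var 18]⟩

/-- Preparation for the search of a generator of an ideal. -/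
def genStart : Cmd := scaling ;; loadG ⟨.input, [.var 19, .var 20]⟩ ;; zeroB

/-- Row `0` of the output generates the ideal whose generators as a group are the rows of the
input. -/
def progGen : Cmd := genStart ;; search ;; writeOut 0 ⟨arrE, [.var 18]⟩

/-! ### Correctness of the programs -/

section Programs

variable {N d : ℕ} {R : Type*} [CommRing R] {D : Coordinates N d R}
  {ops : (k : ℕ) → BasicOps k} {s : Store}

/-- Combinations of the multiples `e * ω i` are the multiples of `e`. -/
theorem combo_mul {e : R} {g : ℕ → R} (h : ∀ i < d, g i = e * D.w i) (x : ℕ → ZMod N) :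
    combo D.φ g d x = e * D.elt x := by
  rw [combo, Coordinates.elt, combo, Finset.mul_sum]
  refine Finset.sum_congr rfl fun i hi => ?_
  rw [h i (Finset.mem_range.1 hi)]
  ring

theorem combo_eq_iff {e : R} {g : ℕ → R} (h : ∀ i < d, g i = e * D.w i) (y : R) :
    (∃ x, combo D.φ g d x = y) ↔ y ∈ Ideal.span {e} := by
  rw [Ideal.mem_span_singleton']
  constructor
  · rintro ⟨x, rfl⟩
    exact ⟨D.elt x, by rw [combo_mul h, mul_comm]⟩
  · rintro ⟨r, rfl⟩
    obtain ⟨x, rfl⟩ := D.surj r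
    exact ⟨x, by rw [combo_mul h, mul_comm]; rfl⟩

/-- If the rows of `G` span the ideal `(b)`, then `b` is a multiple of the element found. -/
theorem Found.mem_span (h : Found D s) {b : R}
    (hb : ∀ y, (∃ x, combo D.φ (eltRow D s arrG) d x = y) ↔ y ∈ Ideal.span {b}) :
    b ∈ Ideal.span {eltIn D s arrE} := by
  obtain ⟨x, hx⟩ := (hb b).2 (Ideal.mem_span_singleton_self b)
  rw [← hx, combo]
  exact Ideal.sum_mem _ fun i hi => Ideal.mul_mem_left _ _ (h.mem i (Finset.mem_range.1 hi))

/-- With `B = 0` the element that is found generates the ideal. -/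
theorem Found.span_eq (h : Found D s) {b : R}
    (hb : ∀ y, (∃ x, combo D.φ (eltRow D s arrG) d x = y) ↔ y ∈ Ideal.span {b})
    (h0 : eltIn D s arrB = 0) : Ideal.span {eltIn D s arrE} = Ideal.span {b} := by
  refine le_antisymm ?_ ?_ <;> rw [Ideal.span_singleton_le_iff_mem]
  · rw [h.eq, h0, zero_add]
    exact (hb _).1 ⟨_, rfl⟩
  · exact h.mem_span hb

theorem Cmd.Wp.runs_ready {c : Cmd} {Q : Store → Prop} (h : c.Wp N ops s Q)
    (hc : c.Bounded) (hs : Describes D s) :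
    c.Runs N ops s (fun s' => Frame c.arrs c.vars s s' ∧ Q s') (c.cost d) := h.runs hc hs.dim

theorem OutputIs.congr {s' : Store} {t : ℕ} {c : R} (h : OutputIs D s t c)
    (hs : s'.mem .output = s.mem .output) : OutputIs D s' t c := fun k hk => by rw [hs, h k hk]

theorem loadOperand_wp {A : Arr} {t : ℕ} (hd : s.ix 0 = d) (hA : A ≠ .input) :
    (loadVec A ⟨.input, [.lit t, .var 19]⟩).Wp N ops s fun s' =>
      eltIn D s' A = eltRow D s .input t := by
  refine (loadVec_wp (f := fun k => s.mem .input [t, k]) hd fun s' hF => by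
    simp [Store.read, Ix.eval, hF.1 .input (by simpa using hA.symm)]).mono fun s' _ h => ?_
  exact D.elt_congr fun k hk => by rw [vec, h k hk, mat]

theorem copyVec_wp {A B : Arr} (hd : s.ix 0 = d) (hA : A ≠ B) :
    (loadVec A ⟨B, [.var 19]⟩).Wp N ops s fun s' => eltIn D s' A = eltIn D s B := by
  refine (loadVec_wp (f := fun k => s.mem B [k]) hd fun s' hF => by
    simp [Store.read, Ix.eval, hF.1 B (by simpa using hA.symm)]).mono fun s' _ h => ?_
  exact D.elt_congr fun k hk => by rw [vec, h k hk, vec]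

/-- The right half of `V` holds minus the solution of a linear equation. -/
theorem loadSolution_wp {A : Arr} (hd : s.ix 0 = d) (hA : A ≠ arrV) :
    (loadVec A ⟨arrV, [.add (.var 0) (.var 19)]⟩).Wp N ops s fun s' =>
      eltIn D s' A = D.elt fun k => vec N s.mem arrV (d + k) := by
  refine (loadVec_wp (f := fun k => s.mem arrV [d + k]) hd fun s' hF => by
    simp [Store.read, Ix.eval, hF.1 arrV (by simpa using hA.symm),
      (hF.2 0 (by simp)).trans hd]).mono fun s' _ h => ?_
  exact D.elt_congr fun k hk => by rw [vec, h k hk, vec]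

theorem copyRows_wp {A : Arr} (hd : s.ix 0 = d) (hA : A ≠ arrG) :
    (loadG ⟨A, [.var 19, .var 20]⟩).Wp N ops s fun s' =>
      ∀ i < d, eltRow D s' arrG i = eltRow D s A i := by
  refine (loadG_wp (f := fun i k => s.mem A [i, k]) hd fun s' hF => by
    simp [Store.read, Ix.eval, hF.1 A (by simpa using hA)]).mono fun s' _ h i hi => ?_
  exact D.elt_congr fun k hk => by rw [mat, h i hi k hk, mat]

variable [NeZero N]

theorem writeElt_wp {t : ℕ} {A : Arr} (h : Describes D s) (hA : A ∉ [Arr.output, .work 29]) :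
    (writeOut t ⟨A, [.var 18]⟩).Wp N ops s fun s' => OutputIs D s' t (eltIn D s A) ∧
      ∀ t' c, t' ≠ t → OutputIs D s t' c → OutputIs D s' t' c :=
  writeOut_wp (f := fun k => s.mem A [k]) h fun s' hF => by
    simp [Store.read, Ix.eval, hF.1 A hA]

theorem writeNegElt_wp {t : ℕ} {A : Arr} (h : Describes D s) (hA : A ∉ [Arr.output, .work 29]) :
    (writeNeg t ⟨A, [.var 18]⟩).Wp N ops s fun s' => OutputIs D s' t (-eltIn D s A) ∧
      ∀ t' c, t' ≠ t → OutputIs D s t' c → OutputIs D s' t' c := by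
  rw [eltIn, ← D.elt_neg]
  exact writeNeg_wp (f := fun k => s.mem A [k]) h fun s' hF => by
    simp [Store.read, Ix.eval, hF.1 A hA]

theorem divisor_wp {t : ℕ} {b : R} (h : Describes D s) (hb : eltRow D s .input t = b) :
    (divisor t).Wp N ops s fun s' => Ready D s' ∧ HowellOf D s' b ∧
      ∀ j < d, eltRow D s' arrG j = b * D.w j := by
  refine Cmd.Wp.seq (scaling_wp h) fun s₁ hF₁ hC => ?_
  have h₁ : Ready D s₁ := ⟨h.frame hF₁ (by decide) (by decide), hC⟩
  refine Cmd.Wp.seq (loadOperand_wp (D := D) h₁.dim (by decide)) fun s₂ hF₂ hE => ?_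
  have h₂ : Ready D s₂ := h₁.frame hF₂ (by simp [loadVec, Cmd.arrs, Instr.arrs])
    (by simp [loadVec, Cmd.arrs, Instr.arrs]) (by simp [loadVec, Cmd.vars, Instr.vars])
  rw [eltRow_congr (hF₁.1 .input (by decide)), hb] at hE
  refine Cmd.Wp.seq (prepare_wp h₂) fun s₃ hF₃ ⟨hT, hM⟩ => ?_
  have h₃ : Ready D s₃ := h₂.frame hF₃ (by decide) (by decide) (by decide)
  rw [hE] at hT hM
  refine (copyRows_wp (D := D) h₃.dim (by decide)).mono fun s₄ hF₄ hG => ⟨?_, ?_, fun j hj => ?_⟩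
  · exact h₃.frame hF₄ (by decide) (by decide) (by decide)
  · exact hT.congr (hF₄.1 _ (by decide)) (hF₄.1 _ (by decide))
  · rw [hG j hj, hM j hj]

theorem progAdd_wp {a b : R} (h : Describes D s) (ha : eltRow D s .input 0 = a)
    (hb : eltRow D s .input 1 = b) :
    progAdd.Wp N ops s fun s' => OutputIs D s' 0 (a + b) := by
  refine (writeSum_wp (f := fun k => s.mem .input [0, k]) (g := fun k => s.mem .input [1, k]) h
    (fun s' hF => ?_) (fun s' hF => ?_)).mono fun s' _ h' => ?_
  · simp [Store.read, Ix.eval, hF.1 .input (by decide)]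
  · simp [Store.read, Ix.eval, hF.1 .input (by decide)]
  · rw [← ha, ← hb]
    have := h'.1
    rwa [D.elt_add] at this

theorem progSub_wp {a b : R} (h : Describes D s) (ha : eltRow D s .input 0 = a)
    (hb : eltRow D s .input 1 = b) :
    progSub.Wp N ops s fun s' => OutputIs D s' 0 (a - b) := by
  refine (writeDiff_wp (f := fun k => s.mem .input [0, k]) (g := fun k => s.mem .input [1, k]) h
    (fun s' hF => ?_) (fun s' hF => ?_)).mono fun s' _ h' => ?_
  · simp [Store.read, Ix.eval, hF.1 .input (by decide)]
  · simp [Store.read, Ix.eval, hF.1 .input (by decide)]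
  · rw [← ha, ← hb]
    have := h'.1
    simp only [sub_eq_add_neg] at this ⊢
    rwa [D.elt_add, D.elt_neg] at this

theorem progMul_wp {a b : R} (h : Describes D s) (ha : eltRow D s .input 0 = a)
    (hb : eltRow D s .input 1 = b) :
    progMul.Wp N ops s fun s' => OutputIs D s' 0 (a * b) := by
  refine Cmd.Wp.seq (divisor_wp h ha) fun s₁ hF₁ ⟨h₁, _, hG₁⟩ => ?_
  refine Cmd.Wp.seq (loadOperand_wp (D := D) h₁.dim (by decide)) fun s₂ hF₂ hX => ?_
  rw [eltRow_congr (hF₁.1 .input (by decide)), hb] at hX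
  have h₂ : Ready D s₂ := h₁.frame hF₂ (by decide) (by decide) (by decide)
  refine Cmd.Wp.seq (zeroB_wp (D := D) h₂.dim) fun s₃ hF₃ hB => ?_
  have h₃ : Ready D s₃ := h₂.frame hF₃ (by decide) (by decide) (by decide)
  refine Cmd.Wp.seq (combine_correct h₃) fun s₄ hF₄ hE => ?_
  have h₄ : Ready D s₄ := h₃.frame hF₄ (by decide) (by decide) (by decide)
  refine (writeElt_wp h₄.toDescribes (by decide)).mono fun s₅ _ h₅ => ?_
  have hE₄ : eltIn D s₄ arrE = a * b := by
    rw [hE, hB, zero_add, combo_mul (e := a), ← hX, ← eltIn_congr (hF₃.1 arrX (by decide))]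
    · rfl
    · intro i hi
      rw [eltRow_congr (hF₃.1 _ (by decide)), eltRow_congr (hF₂.1 _ (by decide)), hG₁ i hi]
  rw [← hE₄]
  exact h₅.1

theorem progDiv_wp {a b : R} (h : Describes D s) (ha : eltRow D s .input 0 = a)
    (hb : eltRow D s .input 1 = b) (hab : b ∣ a) :
    progDiv.Wp N ops s fun s' => ∃ c, IsDivResult a b c ∧ OutputIs D s' 0 c := by
  refine Cmd.Wp.seq (divisor_wp h hb) fun s₁ hF₁ ⟨h₁, hT₁, _⟩ => ?_
  refine Cmd.Wp.seq (loadOperand_wp (D := D) h₁.dim (by decide)) fun s₂ hF₂ hY => ?_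
  rw [eltRow_congr (hF₁.1 .input (by decide)), ha] at hY
  have h₂ : Ready D s₂ := h₁.frame hF₂ (by decide) (by decide) (by decide)
  have hT₂ : HowellOf D s₂ b := hT₁.congr (hF₂.1 _ (by decide)) (hF₂.1 _ (by decide))
  refine Cmd.Wp.seq (solve_wp h₂ hT₂) fun s₃ hF₃ ⟨_, hsol⟩ => ?_
  have h₃ : Ready D s₃ := h₂.frame hF₃ (by decide) (by decide) (by decide)
  refine (writeNeg_wp (f := fun k => s₃.mem arrV [d + k]) h₃.toDescribes fun s' hF => by
    simp [Store.read, Ix.eval, hF.1 arrV (by decide), (hF.2 0 (by decide)).trans h₃.dim]).mono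
    fun s₄ _ h₄ => ⟨_, ?_, h₄.1⟩
  rw [hY] at hsol
  rw [IsDivResult, mul_comm]
  exact hsol (Ideal.mem_span_singleton.2 hab)

theorem eudivTest_wp {a b : R} (h : Describes D s) (ha : eltRow D s .input 0 = a)
    (hb : eltRow D s .input 1 = b) :
    eudivTest.Wp N ops s fun s' => Ready D s' ∧ (∀ j < d, eltRow D s' arrG j = b * D.w j) ∧
      (s'.mem arrF [] = 0 ↔ a ∈ Ideal.span {b}) ∧
      (a ∈ Ideal.span {b} → D.elt (fun k => -vec N s'.mem arrV (d + k)) * b = a) := by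
  refine Cmd.Wp.seq (divisor_wp h hb) fun s₁ hF₁ ⟨h₁, hT₁, hG₁⟩ => ?_
  refine Cmd.Wp.seq (loadOperand_wp (D := D) h₁.dim (by decide)) fun s₂ hF₂ hY => ?_
  rw [eltRow_congr (hF₁.1 .input (by decide)), ha] at hY
  refine Cmd.Wp.seq (Q₁ := fun s' => s'.mem arrF [] = 0)
    (Cmd.wp_const (by simp [Store.mem_write])) fun s₃ hF₃ h0 => ?_
  have h₂ : Ready D s₂ := h₁.frame hF₂ (by decide) (by decide) (by decide)
  have h₃ : Ready D s₃ := h₂.frame hF₃ (by decide) (by decide) (by decide)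
  have hT₂ : HowellOf D s₂ b := hT₁.congr (hF₂.1 _ (by decide)) (hF₂.1 _ (by decide))
  have hT₃ : HowellOf D s₃ b := hT₂.congr (hF₃.1 _ (by decide)) (hF₃.1 _ (by decide))
  refine Cmd.Wp.seq (solve_wp h₃ hT₃) fun s₄ hF₄ ⟨hz, hsol⟩ => ?_
  rw [eltIn_congr (hF₃.1 _ (by decide)), hY] at hz hsol
  have h₄ : Ready D s₄ := h₃.frame hF₄ (by decide) (by decide) (by decide)
  refine (checkZero_wp h₄.dim).mono fun s₅ hF₅ h₅ => ⟨?_, fun j hj => ?_, ?_, ?_⟩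
  · exact h₄.frame hF₅ (by decide) (by decide) (by decide)
  · rw [eltRow_congr (hF₅.1 _ (by decide)), eltRow_congr (hF₄.1 _ (by decide)),
      eltRow_congr (hF₃.1 _ (by decide)), eltRow_congr (hF₂.1 _ (by decide)), hG₁ j hj]
  · rw [h₅, hF₄.1 _ (by decide), hz]
    simp [h0]
  · rw [vec_congr (hF₅.1 _ (by decide))]
    exact hsol

theorem eudivExact_wp (h : Describes D s) :
    eudivExact.Wp N ops s fun s' =>
      OutputIs D s' 0 (D.elt fun k => -vec N s.mem arrV (d + k)) ∧ OutputIs D s' 1 0 := by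
  refine Cmd.Wp.seq (writeNeg_wp (f := fun k => s.mem arrV [d + k]) h fun s' hF => by
    simp [Store.read, Ix.eval, hF.1 arrV (by decide), (hF.2 0 (by decide)).trans h.dim])
    fun s₁ hF₁ ⟨h0, _⟩ => ?_
  have h₁ : Describes D s₁ := h.frame hF₁ (by decide) (by decide)
  refine (writeDiff_wp (f := fun k => s₁.mem arrX [k]) (g := fun k => s₁.mem arrX [k]) h₁
    (fun s' hF => ?_) (fun s' hF => ?_)).mono fun s₂ _ ⟨h1, h2⟩ => ⟨h2 0 _ (by decide) h0, ?_⟩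
  · simp [Store.read, Ix.eval, hF.1 arrX (by decide)]
  · simp [Store.read, Ix.eval, hF.1 arrX (by decide)]
  · simpa [D.elt_zero] using h1

theorem eudivEnd_wp (h : Describes D s) :
    eudivEnd.Wp N ops s fun s' =>
      OutputIs D s' 0 (-eltIn D s arrX) ∧ OutputIs D s' 1 (eltIn D s arrE) := by
  refine Cmd.Wp.seq (writeNegElt_wp h (by decide)) fun s₁ hF₁ ⟨h0, _⟩ => ?_
  refine (writeElt_wp (h.frame hF₁ (by decide) (by decide)) (by decide)).mono
    fun s₂ _ ⟨h1, h2⟩ => ⟨h2 0 _ (by decide) h0, ?_⟩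
  rwa [eltIn_congr (hF₁.1 _ (by decide))] at h1

theorem unitStart_wp (h : Describes D s) :
    unitStart.Wp N ops s fun s' => Ready D s' ∧ (∀ j < d, eltRow D s' arrG j = 1 * D.w j) ∧
      eltIn D s' arrB = 0 := by
  refine Cmd.Wp.seq (scaling_wp h) fun s₁ hF₁ hC => ?_
  have h₁ : Ready D s₁ := ⟨h.frame hF₁ (by decide) (by decide), hC⟩
  refine Cmd.Wp.seq (unitG_wp (D := D) h₁.dim) fun s₂ hF₂ hG => ?_
  have h₂ : Ready D s₂ := h₁.frame hF₂ (by decide) (by decide) (by decide)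
  refine (zeroB_wp (D := D) h₂.dim).mono fun s₃ hF₃ hB => ⟨?_, fun j hj => ?_, hB⟩
  · exact h₂.frame hF₃ (by decide) (by decide) (by decide)
  · rw [eltRow_congr (hF₃.1 _ (by decide)), hG j hj, one_mul]

/-- The solution of `z * e = e` for a unit `e` is `z = 1`. -/
theorem unitEnd_wp {a b : R} (h : Ready D s) (hT : HowellOf D s (eltIn D s arrE))
    (hE : IsUnit (eltIn D s arrE)) (ha : eltRow D s .input 0 = a) (hb : eltRow D s .input 1 = b) :
    unitEnd.Wp N ops s fun s' => Ready D s' ∧ (∀ j < d, eltRow D s' arrG j = b * D.w j) ∧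
      eltIn D s' arrB = a ∧ eltIn D s' arrU = -1 := by
  refine Cmd.Wp.seq (copyVec_wp (D := D) h.dim (by decide)) fun s₁ hF₁ hY => ?_
  have h₁ : Ready D s₁ := h.frame hF₁ (by decide) (by decide) (by decide)
  refine Cmd.Wp.seq (solve_wp h₁ (hT.congr (hF₁.1 _ (by decide)) (hF₁.1 _ (by decide))))
    fun s₂ hF₂ ⟨_, hsol⟩ => ?_
  have h₂ : Ready D s₂ := h₁.frame hF₂ (by decide) (by decide) (by decide)
  rw [hY, D.elt_neg] at hsol
  have hV := hE.mul_right_cancel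
    ((hsol (Ideal.mem_span_singleton_self _)).trans (one_mul (eltIn D s arrE)).symm)
  refine Cmd.Wp.seq (loadSolution_wp (D := D) h₂.dim (by decide)) fun s₃ hF₃ hU => ?_
  have h₃ : Ready D s₃ := h₂.frame hF₃ (by decide) (by decide) (by decide)
  have hin : s₃.mem .input = s.mem .input := by
    rw [hF₃.1 _ (by decide), hF₂.1 _ (by decide), hF₁.1 _ (by decide)]
  refine Cmd.Wp.seq (divisor_wp (b := b) h₃.toDescribes (by rw [eltRow_congr hin, hb]))
    fun s₄ hF₄ ⟨h₄, _, hG⟩ => ?_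
  refine (loadOperand_wp (D := D) h₄.dim (by decide)).mono fun s₅ hF₅ hB =>
    ⟨?_, fun j hj => ?_, ?_, ?_⟩
  · exact h₄.frame hF₅ (by decide) (by decide) (by decide)
  · rw [eltRow_congr (hF₅.1 _ (by decide)), hG j hj]
  · rw [hB, eltRow_congr (hF₄.1 _ (by decide)), eltRow_congr hin, ha]
  · rw [eltIn_congr (hF₅.1 _ (by decide)), eltIn_congr (hF₄.1 _ (by decide)), hU, ← hV, neg_neg]

/-- The transformation that belongs to a generator of the form `g = a + b * x`, where `-u` is the
cofactor of `b`. -/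
theorem isXgcdResult_of_eq {a b g x u : R} (hg : g = a + b * x) (hb : -u * g = b) :
    IsXgcdResult a b g 1 x u (u * x + 1) := by
  refine ⟨le_antisymm ?_ ?_, ?_, ?_, ?_⟩
  · rw [Ideal.span_singleton_le_iff_mem, Ideal.mem_span_pair]
    exact ⟨1, x, by rw [hg]; ring⟩
  · rw [Ideal.span_le]
    rintro y (rfl | rfl)
    · exact Ideal.mem_span_singleton'.2 ⟨1 + u * x, by linear_combination -x * hb + hg⟩
    · exact Ideal.mem_span_singleton'.2 ⟨-u, hb⟩
  · rw [hg]; ring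
  · linear_combination -u * hg - hb
  · ring

theorem xgcdEnd_wp {a b : R} (h : Ready D s) (hs : Found D s)
    (hG : ∀ j < d, eltRow D s arrG j = b * D.w j) (hB : eltIn D s arrB = a)
    (hU : eltIn D s arrU = -1) (hb : eltRow D s .input 1 = b) :
    xgcdEnd.Wp N ops s fun s' => ∃ c : Fin 5 → R,
      IsXgcdResult a b (c 0) (c 1) (c 2) (c 3) (c 4) ∧ ∀ t : Fin 5, OutputIs D s' t (c t) := by
  have hg : eltIn D s arrE = a + b * eltIn D s arrX := by
    rw [hs.eq, hB, combo_mul hG]; rfl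
  have hmem := hs.mem_span (combo_eq_iff hG)
  refine Cmd.Wp.seq (writeElt_wp h.toDescribes (by decide)) fun s₁ hF₁ ⟨o0, _⟩ => ?_
  have h₁ : Ready D s₁ := h.frame hF₁ (by decide) (by decide) (by decide)
  refine Cmd.Wp.seq (writeNegElt_wp h₁.toDescribes (by decide)) fun s₂ hF₂ ⟨o1, p1⟩ => ?_
  have h₂ : Ready D s₂ := h₁.frame hF₂ (by decide) (by decide) (by decide)
  rw [eltIn_congr (hF₁.1 _ (by decide)), hU, neg_neg] at o1
  have o0 := p1 0 _ (by decide) o0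
  refine Cmd.Wp.seq (writeElt_wp h₂.toDescribes (by decide)) fun s₃ hF₃ ⟨o2, p2⟩ => ?_
  have h₃ : Ready D s₃ := h₂.frame hF₃ (by decide) (by decide) (by decide)
  have hF₀₃ : Frame [.output, .work 29] [18] s s₃ := ((hF₁.mono (by decide) (by decide)).trans
    (hF₂.mono (by decide) (by decide))).trans (hF₃.mono (by decide) (by decide))
  rw [eltIn_congr ((hF₂.1 _ (by decide)).trans (hF₁.1 _ (by decide)))] at o2
  have o0 := p2 0 _ (by decide) o0
  have o1 := p2 1 _ (by decide) o1
  refine Cmd.Wp.seq (loadOperand_wp (D := D) h₃.dim (by decide)) fun s₄ hF₄ hY => ?_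
  have h₄ : Ready D s₄ := h₃.frame hF₄ (by decide) (by decide) (by decide)
  rw [eltRow_congr (hF₀₃.1 _ (by decide)), hb] at hY
  have hT : HowellOf D s₄ (eltIn D s arrE) := hs.howell.congr
    ((hF₄.1 _ (by decide)).trans (hF₀₃.1 _ (by decide)))
    ((hF₄.1 _ (by decide)).trans (hF₀₃.1 _ (by decide)))
  refine Cmd.Wp.seq (solve_wp h₄ hT) fun s₅ hF₅ ⟨_, hsol⟩ => ?_
  have h₅ : Ready D s₅ := h₄.frame hF₅ (by decide) (by decide) (by decide)
  rw [hY, D.elt_neg] at hsol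
  have hsol := hsol hmem
  refine Cmd.Wp.seq (writeOut_wp (f := fun k => s₅.mem arrV [d + k]) h₅.toDescribes fun s' hF => by
    simp [Store.read, Ix.eval, hF.1 arrV (by decide), (hF.2 0 (by decide)).trans h₅.dim])
    fun s₆ hF₆ ⟨o3, p3⟩ => ?_
  have h₆ : Ready D s₆ := h₅.frame hF₆ (by decide) (by decide) (by decide)
  have hout : s₅.mem .output = s₃.mem .output := by
    rw [hF₅.1 _ (by decide), hF₄.1 _ (by decide)]
  have o0 := p3 0 _ (by decide) (o0.congr hout)
  have o1 := p3 1 _ (by decide) (o1.congr hout)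
  have o2 := p3 2 _ (by decide) (o2.congr hout)
  set u : R := D.elt fun k => vec N s₅.mem arrV (d + k) with hu
  refine Cmd.Wp.seq (loadSolution_wp (D := D) h₆.dim (by decide)) fun s₇ hF₇ hE => ?_
  have h₇ : Ready D s₇ := h₆.frame hF₇ (by decide) (by decide) (by decide)
  rw [vec_congr (hF₆.1 _ (by decide)), ← hu] at hE
  refine Cmd.Wp.seq (prepare_wp h₇) fun s₈ hF₈ ⟨_, hM⟩ => ?_
  have h₈ : Ready D s₈ := h₇.frame hF₈ (by decide) (by decide) (by decide)
  rw [hE] at hM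
  refine Cmd.Wp.seq (copyRows_wp (D := D) h₈.dim (by decide)) fun s₉ hF₉ hG₉ => ?_
  have h₉ : Ready D s₉ := h₈.frame hF₉ (by decide) (by decide) (by decide)
  refine Cmd.Wp.seq (zeroB_wp (D := D) h₉.dim) fun s₁₀ hF₁₀ hB₁₀ => ?_
  have h₁₀ : Ready D s₁₀ := h₉.frame hF₁₀ (by decide) (by decide) (by decide)
  refine Cmd.Wp.seq (combine_correct h₁₀) fun s₁₁ hF₁₁ hE₁₁ => ?_
  have h₁₁ : Ready D s₁₁ := h₁₀.frame hF₁₁ (by decide) (by decide) (by decide)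
  have hX : s₁₀.mem arrX = s.mem arrX := by
    rw [hF₁₀.1 _ (by decide), hF₉.1 _ (by decide), hF₈.1 _ (by decide), hF₇.1 _ (by decide),
      hF₆.1 _ (by decide), hF₅.1 _ (by decide), hF₄.1 _ (by decide), hF₀₃.1 _ (by decide)]
  have hU₁₁ : s₁₁.mem arrU = s.mem arrU := by
    rw [hF₁₁.1 _ (by decide), hF₁₀.1 _ (by decide), hF₉.1 _ (by decide), hF₈.1 _ (by decide),
      hF₇.1 _ (by decide), hF₆.1 _ (by decide), hF₅.1 _ (by decide), hF₄.1 _ (by decide),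
      hF₀₃.1 _ (by decide)]
  have hout : s₁₁.mem .output = s₆.mem .output := by
    rw [hF₁₁.1 _ (by decide), hF₁₀.1 _ (by decide), hF₉.1 _ (by decide), hF₈.1 _ (by decide),
      hF₇.1 _ (by decide)]
  have hux : eltIn D s₁₁ arrE = u * eltIn D s arrX := by
    rw [hE₁₁, hB₁₀, zero_add, combo_mul (e := u), vec_congr hX]
    · rfl
    · intro j hj
      rw [eltRow_congr (hF₁₀.1 _ (by decide)), hG₉ j hj, hM j hj]
  refine (writeDiff_wp (f := fun k => s₁₁.mem arrE [k]) (g := fun k => s₁₁.mem arrU [k])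
    h₁₁.toDescribes (fun s' hF => ?_) (fun s' hF => ?_)).mono fun s₁₂ _ ⟨o4, p4⟩ =>
    ⟨![_, _, _, _, _], isXgcdResult_of_eq hg hsol, ?_⟩
  · simp [Store.read, Ix.eval, hF.1 arrE (by decide)]
  · simp [Store.read, Ix.eval, hF.1 arrU (by decide)]
  · have hv : (D.elt fun k => ((s₁₁.mem arrE [k] : ℤ) : ZMod N) - (s₁₁.mem arrU [k] : ℤ)) =
        u * eltIn D s arrX + 1 := by
      have : eltIn D s₁₁ arrU = -1 := by rw [eltIn_congr hU₁₁, hU]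
      rw [← hux, ← neg_neg (1 : R), ← this, eltIn, eltIn, ← D.elt_neg, ← D.elt_add]
      exact D.elt_congr fun k _ => sub_eq_add_neg _ _
    rw [hv] at o4
    intro t
    fin_cases t
    · exact p4 0 _ (by decide) (o0.congr hout)
    · exact p4 1 _ (by decide) (o1.congr hout)
    · exact p4 2 _ (by decide) (o2.congr hout)
    · exact p4 3 _ (by decide) (o3.congr hout)
    · exact o4

/-- The rows of `G` become the right halves of the last `d` rows of the Howell basis, whose
combinations form the kernel of the multiplication by `a`. -/
theorem annStart_wp {a : R} (h : Describes D s) (ha : eltRow D s .input 0 = a) :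
    annStart.Wp N ops s fun s' => Ready D s' ∧
      (∀ y, (∃ x, combo D.φ (eltRow D s' arrG) d x = y) ↔ y * a = 0) ∧
      eltIn D s' arrB = 0 := by
  refine Cmd.Wp.seq (divisor_wp h ha) fun s₁ hF₁ ⟨h₁, ⟨A, hA, hsys⟩, _⟩ => ?_
  refine Cmd.Wp.seq (loadG_wp (f := fun i k => s₁.mem arrT [d + i, d + k]) h₁.dim fun s' hF => by
    simp [Store.read, Ix.eval, hF.1 arrT (by decide), (hF.2 0 (by decide)).trans h₁.dim])
    fun s₂ hF₂ hG => ?_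
  have h₂ : Ready D s₂ := h₁.frame hF₂ (by decide) (by decide) (by decide)
  refine (zeroB_wp (D := D) h₂.dim).mono fun s₃ hF₃ hB => ⟨?_, fun y => ?_, hB⟩
  · exact h₂.frame hF₃ (by decide) (by decide) (by decide)
  have hcombo : ∀ c, combo D.φ (eltRow D s₃ arrG) d c = D.elt fun k =>
      ∑ l ∈ Finset.range d, c l * rows N s₁.mem arrT (2 * d) (d + l) (d + k) := by
    intro c
    rw [D.elt_sum c fun l k => rows N s₁.mem arrT (2 * d) (d + l) (d + k), combo]
    refine Finset.sum_congr rfl fun l hl => ?_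
    rw [eltRow_congr (hF₃.1 _ (by decide)), eltRow]
    congr 1
    refine D.elt_congr fun k hk => ?_
    rw [mat, hG l (Finset.mem_range.1 hl) k hk, rows_of_lt (by omega), mat]
  have hker : ∀ x, D.elt x * a = 0 ↔ ∃ c : ℕ → ZMod N, ∀ k < d,
      x k = ∑ l ∈ Finset.range d, c l * rows N s₁.mem arrT (2 * d) (d + l) (d + k) := by
    intro x
    rw [← hA.kernel x, ← D.elt_zero, ← hsys x fun _ => 0]
    exact forall₂_congr fun k _ => by rw [zero_mul, eq_comm]
  constructor
  · rintro ⟨c, rfl⟩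
    rw [hcombo]
    exact (hker _).2 ⟨c, fun _ _ => rfl⟩
  · intro hy
    obtain ⟨x, rfl⟩ := D.surj y
    obtain ⟨c, hc⟩ := (hker x).1 hy
    exact ⟨c, (hcombo c).trans (D.elt_congr fun k hk => (hc k hk).symm)⟩

theorem genStart_wp (h : Describes D s) :
    genStart.Wp N ops s fun s' => Ready D s' ∧
      (∀ i < d, eltRow D s' arrG i = eltRow D s .input i) ∧ eltIn D s' arrB = 0 := by
  refine Cmd.Wp.seq (scaling_wp h) fun s₁ hF₁ hC => ?_
  have h₁ : Ready D s₁ := ⟨h.frame hF₁ (by decide) (by decide), hC⟩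
  refine Cmd.Wp.seq (copyRows_wp (D := D) h₁.dim (by decide)) fun s₂ hF₂ hG => ?_
  have h₂ : Ready D s₂ := h₁.frame hF₂ (by decide) (by decide) (by decide)
  refine (zeroB_wp (D := D) h₂.dim).mono fun s₃ hF₃ hB => ⟨?_, fun j hj => ?_, hB⟩
  · exact h₂.frame hF₃ (by decide) (by decide) (by decide)
  · rw [eltRow_congr (hF₃.1 _ (by decide)), hG j hj, eltRow_congr (hF₁.1 _ (by decide))]

end Programs

/-! ### Expected cost -/

/-- A bound for an expected cost, as a function of the dimension `d` and the proportion `p` of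
units, is cubic if it is at most a constant multiple of `d ^ 3 / p`. -/
def IsCubic (B : ℕ → ℝ≥0∞ → ℝ≥0∞) : Prop :=
  ∃ C : ℕ, ∀ d p, 1 ≤ d → p ≤ 1 → B d p ≤ C * (d ^ 3 / p)

theorem IsCubic.add {B₁ B₂ : ℕ → ℝ≥0∞ → ℝ≥0∞} (h₁ : IsCubic B₁) (h₂ : IsCubic B₂) :
    IsCubic fun d p => B₁ d p + B₂ d p := by
  obtain ⟨C₁, h₁⟩ := h₁
  obtain ⟨C₂, h₂⟩ := h₂
  refine ⟨C₁ + C₂, fun d p hd hp => (add_le_add (h₁ d p hd hp) (h₂ d p hd hp)).trans ?_⟩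
  rw [Nat.cast_add, add_mul]

theorem isCubic_natCast {f : ℕ → ℕ} {C : ℕ} (h : ∀ d, 1 ≤ d → f d ≤ C * d ^ 3) :
    IsCubic fun d _ => f d := by
  refine ⟨C, fun d p hd hp => ?_⟩
  calc (f d : ℝ≥0∞) ≤ ((C * d ^ 3 : ℕ) : ℝ≥0∞) := by exact_mod_cast h d hd
    _ = C * (d ^ 3 / 1) := by simp
    _ ≤ C * (d ^ 3 / p) := by gcongr

theorem isCubic_cost {c : Cmd} (hc : c.depth ≤ 3) : IsCubic fun d _ => c.cost d := by
  obtain ⟨C, hC⟩ := c.cost_le_cube hc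
  exact isCubic_natCast hC

theorem isCubic_one : IsCubic fun _ _ => 1 := by
  have := isCubic_natCast (f := fun _ => 1) (C := 1) fun d hd => by
    simpa using Nat.one_le_pow 3 d hd
  simpa using this

/-- An upper bound for the expected cost of the search. -/
noncomputable def searchCost (d : ℕ) (p : ℝ≥0∞) : ℝ≥0∞ := 2 + ((trial.cost d + 2 * d : ℕ) + 2) / p

theorem isCubic_searchCost : IsCubic searchCost := by
  obtain ⟨C, hC⟩ := trial.cost_le_cube (by decide)
  refine IsCubic.add (B₁ := fun _ _ => 2) (B₂ := fun d p => ((trial.cost d + 2 * d : ℕ) + 2) / p)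
    ?_ ⟨C + 4, fun d p hd _ => ?_⟩
  · simpa [one_add_one_eq_two] using isCubic_one.add isCubic_one
  · rw [← mul_div_assoc]
    dsimp only
    gcongr
    have h1 : d ≤ d ^ 3 := Nat.le_self_pow (by norm_num) d
    have h2 := hC d hd
    exact_mod_cast (by nlinarith : trial.cost d + 2 * d + 2 ≤ (C + 4) * d ^ 3)

/-! ### The programs with a search -/

section Searching

variable {N d : ℕ} {R : Type*} [CommRing R] {D : Coordinates N d R}
  {ops : (k : ℕ) → BasicOps k} {s : Store}

/-- The rows of the output are the coordinates of elements that satisfy `Post`. -/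
def Returns (D : Coordinates N d R) {r : ℕ} (Post : (Fin r → R) → Prop) (s : Store) : Prop :=
  ∃ c : Fin r → R, Post c ∧ ∀ t : Fin r, OutputIs D s t (c t)

theorem Returns.one {Post : R → Prop} {c : R} (h : Post c) (hs : OutputIs D s 0 c) :
    Returns D (fun c : Fin 1 → R => Post (c 0)) s :=
  ⟨fun _ => c, h, fun t => by rwa [Subsingleton.elim t 0]⟩

variable [NeZero N] [Finite R] [IsPrincipalIdealRing R]

/-- The remainder is zero if `b` divides `a`. Otherwise it is a generator of the ideal `(a, b)`,
found among the elements `a + x b`, so that the ideal it generates is strictly larger than `(b)`. -/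
theorem progEudiv_runs {a b : R} (h : Describes D s) (ha : eltRow D s .input 0 = a)
    (hb : eltRow D s .input 1 = b) :
    progEudiv.Runs N ops s (Returns D fun c : Fin 2 → R =>
        a = c 0 * b + c 1 ∧ (c 1 = 0 ∨ Ideal.span {b} < Ideal.span {c 1}))
      (eudivTest.cost d + (1 + (eudivExact.cost d + (loadB.cost d +
        (searchCost d (unitRatio R) + eudivEnd.cost d))))) := by
  refine Cmd.Runs.seq ((eudivTest_wp h ha hb).runs_ready
    (by simp [eudivTest, divisor, scaling, loadVec, prepare, mulMatrix, howell, clearT, loadRow,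
      insertVec, insertStep, loadAnn, reduce, checkZero, loadG, Cmd.Bounded, Instr.vars]) h)
    fun s₁ ⟨hF₁, h₁, hG, hflag, hsol⟩ => Cmd.Runs.ifZero (fun h0 => ?_) (fun h0 => ?_)
  · refine ((eudivExact_wp h₁.toDescribes).runs_ready (by
      simp [eudivExact, writeNeg, writeDiff, Cmd.Bounded, Instr.vars]) h₁.toDescribes).mono ?_
      le_self_add
    rintro s₂ ⟨_, o0, o1⟩
    refine ⟨![D.elt fun k => -vec N s₁.mem arrV (d + k), 0], ⟨?_, Or.inl rfl⟩, fun t => ?_⟩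
    · simpa using (hsol (hflag.1 h0)).symm
    · fin_cases t
      · exact o0
      · exact o1
  refine Cmd.Runs.mono (B := loadB.cost d + (searchCost d (unitRatio R) + eudivEnd.cost d))
    (Cmd.Runs.seq ((loadOperand_wp (D := D) h₁.dim (by decide)).runs_ready
      (by simp [loadVec, Cmd.Bounded, Instr.vars]) h₁.toDescribes) fun s₂ ⟨hF₂, hB⟩ => ?_)
    (fun _ h => h) le_add_self
  have h₂ : Ready D s₂ := h₁.frame hF₂ (by decide) (by decide) (by decide)
  refine Cmd.Runs.seq (search_runs h₂ b (combo_eq_iff fun j hj => by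
    rw [eltRow_congr (hF₂.1 _ (by decide)), hG j hj])) fun s₃ ⟨hF₃, hs₃⟩ => ?_
  have h₃ : Ready D s₃ := h₂.frame hF₃ (by decide) (by decide) (by decide)
  refine ((eudivEnd_wp h₃.toDescribes).runs_ready (by
    simp [eudivEnd, writeNeg, writeOut, writeSum, writeDiff, Cmd.Bounded, Instr.vars])
    h₃.toDescribes).mono ?_ le_rfl
  rintro s₄ ⟨_, o0, o1⟩
  have hG₃ : ∀ j < d, eltRow D s₃ arrG j = b * D.w j := fun j hj => by
    rw [eltRow_congr (hF₃.1 _ (by decide)), eltRow_congr (hF₂.1 _ (by decide)), hG j hj]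
  have hE : eltIn D s₃ arrE = a + b * eltIn D s₃ arrX := by
    rw [hs₃.eq, combo_mul hG₃, eltIn_congr (hF₃.1 arrB (by decide)), hB,
      eltRow_congr (hF₁.1 _ (by decide)), ha]
    rfl
  have hle := (Ideal.span_singleton_le_iff_mem _).2 (hs₃.mem_span (combo_eq_iff hG₃))
  refine ⟨![-eltIn D s₃ arrX, eltIn D s₃ arrE],
    ⟨?_, Or.inr (lt_of_le_of_ne hle fun heq => h0 (hflag.2 ?_))⟩, fun t => ?_⟩
  · change a = -eltIn D s₃ arrX * b + eltIn D s₃ arrE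
    rw [hE]; ring
  · have h1 : eltIn D s₃ arrE ∈ Ideal.span {b} := heq ▸ Ideal.mem_span_singleton_self _
    rw [hE] at h1
    exact (Ideal.add_mem_iff_left _
      (Ideal.mul_mem_right _ _ (Ideal.mem_span_singleton_self b))).1 h1
  · fin_cases t
    · exact o0
    · exact o1

/-- First a unit is searched for, from which the unit element is obtained, then a generator of
`(a, b)` among the elements `a + x b`. -/
theorem progXgcd_runs {a b : R} (h : Describes D s) (ha : eltRow D s .input 0 = a)
    (hb : eltRow D s .input 1 = b) :
    progXgcd.Runs N ops s
      (Returns D fun c : Fin 5 → R => IsXgcdResult a b (c 0) (c 1) (c 2) (c 3) (c 4))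
      (unitStart.cost d + (searchCost d (unitRatio R) + (unitEnd.cost d +
        (searchCost d (unitRatio R) + xgcdEnd.cost d)))) := by
  refine Cmd.Runs.seq ((unitStart_wp h).runs_ready (by
    simp [unitStart, scaling, unitG, zeroB, Cmd.Bounded, Instr.vars]) h)
    fun s₁ ⟨hF₁, h₁, hG₁, hB₁⟩ =>
    Cmd.Runs.seq (search_runs h₁ 1 (combo_eq_iff hG₁)) fun s₂ ⟨hF₂, hs₂⟩ => ?_
  have h₂ : Ready D s₂ := h₁.frame hF₂ (by decide) (by decide) (by decide)
  have hE : IsUnit (eltIn D s₂ arrE) := by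
    rw [← Ideal.span_singleton_eq_top, hs₂.span_eq (b := 1), Ideal.span_singleton_one]
    · exact combo_eq_iff fun j hj => by rw [eltRow_congr (hF₂.1 _ (by decide)), hG₁ j hj]
    · rw [eltIn_congr (hF₂.1 _ (by decide)), hB₁]
  have hin : s₂.mem .input = s.mem .input := by rw [hF₂.1 _ (by decide), hF₁.1 _ (by decide)]
  refine Cmd.Runs.seq ((unitEnd_wp h₂ hs₂.howell hE ((eltRow_congr hin _).trans ha)
    ((eltRow_congr hin _).trans hb)).runs_ready (by
      simp [unitEnd, divisor, scaling, loadB, loadVec, prepare, mulMatrix, howell, clearT, loadRow,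
        insertVec, insertStep, loadAnn, reduce, loadG, Cmd.Bounded, Instr.vars]) h₂.toDescribes)
    fun s₃ ⟨hF₃, h₃, hG₃, hB₃, hU₃⟩ =>
    Cmd.Runs.seq (search_runs h₃ b (combo_eq_iff hG₃)) fun s₄ ⟨hF₄, hs₄⟩ => ?_
  have h₄ : Ready D s₄ := h₃.frame hF₄ (by decide) (by decide) (by decide)
  refine ((xgcdEnd_wp (a := a) (b := b) h₄ hs₄ (fun j hj => ?_) ?_ ?_ ?_).runs_ready (by
    simp [xgcdEnd, writeOut, writeNeg, writeSum, writeDiff, loadVec, prepare, mulMatrix, howell,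
      clearT, loadRow, insertVec, insertStep, loadAnn, reduce, loadG, zeroB, combine, Cmd.Bounded,
      Instr.vars]) h₄.toDescribes).mono (fun _ h => h.2) le_rfl
  · rw [eltRow_congr (hF₄.1 _ (by decide)), hG₃ j hj]
  · rw [eltIn_congr (hF₄.1 _ (by decide)), hB₃]
  · rw [eltIn_congr (hF₄.1 _ (by decide)), hU₃]
  · rw [eltRow_congr (hF₄.1 _ (by decide)), eltRow_congr (hF₃.1 _ (by decide)),
      eltRow_congr hin, hb]

/-- A search with `B = 0`, for a generator of an ideal. -/
theorem search_writeOut_runs (h : Ready D s) (hB : eltIn D s arrB = 0) {b : R}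
    (hb : ∀ y, (∃ x, combo D.φ (eltRow D s arrG) d x = y) ↔ y ∈ Ideal.span {b}) :
    (search ;; writeOut 0 ⟨arrE, [.var 18]⟩).Runs N ops s
      (Returns D fun c : Fin 1 → R => Ideal.span {c 0} = Ideal.span {b})
      (searchCost d (unitRatio R) + (writeOut 0 ⟨arrE, [.var 18]⟩).cost d) := by
  refine Cmd.Runs.seq (search_runs h b hb) fun s₁ ⟨hF₁, hs₁⟩ => ?_
  have h₁ : Describes D s₁ := h.toDescribes.frame hF₁ (by decide) (by decide)
  refine ((writeElt_wp h₁ (by decide)).runs_ready (by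
    simp [writeOut, writeSum, Cmd.Bounded, Instr.vars]) h₁).mono ?_ le_rfl
  rintro s₂ ⟨_, o, _⟩
  refine Returns.one (Post := fun c => Ideal.span {c} = _) (hs₁.span_eq (fun y => ?_) ?_) o
  · rw [funext (eltRow_congr (hF₁.1 arrG (by decide)))]
    exact hb y
  · rw [eltIn_congr (hF₁.1 _ (by decide)), hB]

theorem progAnn_runs {a : R} (h : Describes D s) (ha : eltRow D s .input 0 = a) :
    progAnn.Runs N ops s (Returns D fun c : Fin 1 → R => IsAnnResult a (c 0))
      (annStart.cost d + (searchCost d (unitRatio R) +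
        (writeOut 0 ⟨arrE, [.var 18]⟩).cost d)) := by
  obtain ⟨b, hb⟩ := IsPrincipalIdealRing.principal (LinearMap.ker (LinearMap.mulRight R a))
  have hb' : ∀ y, y ∈ Ideal.span {b} ↔ y * a = 0 := fun y => by
    rw [← Ideal.submodule_span_eq, ← hb]; rfl
  refine Cmd.Runs.seq ((annStart_wp h ha).runs_ready (by
    simp [annStart, divisor, scaling, loadVec, prepare, mulMatrix, howell, clearT, loadRow,
      insertVec, insertStep, loadAnn, loadG, zeroB, Cmd.Bounded, Instr.vars]) h)
    fun s₁ ⟨hF₁, h₁, hG₁, hB₁⟩ => (search_writeOut_runs h₁ hB₁ (b := b) fun y => ?_).mono ?_ le_rfl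
  · rw [hG₁, hb']
  · rintro s₂ ⟨c, hc, hs⟩
    exact ⟨c, fun y => by rw [hc, hb'], hs⟩

theorem progGen_runs {I : Ideal R} (h : Describes D s)
    (hI : ∀ y, (∃ x, combo D.φ (eltRow D s .input) d x = y) ↔ y ∈ I) :
    progGen.Runs N ops s (Returns D fun c : Fin 1 → R => Ideal.span {c 0} = I)
      (genStart.cost d + (searchCost d (unitRatio R) +
        (writeOut 0 ⟨arrE, [.var 18]⟩).cost d)) := by
  obtain ⟨b, hb⟩ := IsPrincipalIdealRing.principal I
  rw [Ideal.submodule_span_eq] at hb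
  subst hb
  refine Cmd.Runs.seq ((genStart_wp h).runs_ready (by
    simp [genStart, scaling, loadG, zeroB, Cmd.Bounded, Instr.vars]) h)
    fun s₁ ⟨hF₁, h₁, hG₁, hB₁⟩ => search_writeOut_runs h₁ hB₁ fun y => ?_
  rw [← hI]
  refine exists_congr fun x => ?_
  rw [combo, combo, Finset.sum_congr rfl fun i hi => by rw [hG₁ i (Finset.mem_range.1 hi)]]

end Searching

/-! ### Residue rings of rings of integers in coordinates -/

section NumberField

variable {K : Type*} [Field K] {d : ℕ}

/-- An element of `𝔪` is recognized by its coordinates. -/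
theorem mem_iff_dvd_repr {ω : Module.Basis (Fin d) ℤ (𝓞 K)} {n : Fin d → ℕ} {𝔪 : Ideal (𝓞 K)}
    {ν : Module.Basis (Fin d) ℤ 𝔪} (hν : ∀ i, (ν i : 𝓞 K) = (n i : ℤ) • ω i) (a : 𝓞 K) :
    a ∈ 𝔪 ↔ ∀ i, (n i : ℤ) ∣ ω.repr a i := by
  constructor
  · intro ha i
    have h1 : a = ∑ j, (ν.repr ⟨a, ha⟩ j * (n j : ℤ)) • ω j := by
      have h2 := congrArg Subtype.val (ν.sum_repr ⟨a, ha⟩)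
      rw [AddSubmonoidClass.coe_finsetSum] at h2
      refine h2.symm.trans (Finset.sum_congr rfl fun j _ => ?_)
      rw [mul_smul, ← hν]
      rfl
    have h2 := congrArg (fun z => ω.repr z i) h1
    simp only [Module.Basis.repr_sum_self] at h2
    exact ⟨_, h2.trans (mul_comm _ _)⟩
  · intro h
    rw [← ω.sum_repr a]
    refine Ideal.sum_mem _ fun i _ => ?_
    obtain ⟨c, hc⟩ := h i
    rw [hc, mul_comm, mul_smul, ← hν]
    exact Submodule.smul_of_tower_mem 𝔪 c (ν i).2

theorem mk_sum_coords {ω : Module.Basis (Fin d) ℤ (𝓞 K)} {n : Fin d → ℕ} {𝔪 : Ideal (𝓞 K)}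
    {ν : Module.Basis (Fin d) ℤ 𝔪} (hν : ∀ i, (ν i : 𝓞 K) = (n i : ℤ) • ω i) (a : 𝓞 K ⧸ 𝔪) :
    Ideal.Quotient.mk 𝔪 (∑ i, coords ω n 𝔪 a i • ω i) = a := by
  obtain ⟨a, rfl⟩ := Ideal.Quotient.mk_surjective a
  rw [Ideal.Quotient.mk_eq_mk_iff_sub_mem, mem_iff_dvd_repr hν]
  intro i
  rw [map_sub, Finsupp.sub_apply, Module.Basis.repr_sum_self, coords_mk ω n 𝔪 ν hν]
  exact (Int.emod_emod_of_dvd _ dvd_rfl |> Int.ModEq.symm).dvd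

theorem unitRatio_eq_ofReal {𝔪 : Ideal (𝓞 K)} [Finite (𝓞 K ⧸ 𝔪)] :
    unitRatio (𝓞 K ⧸ 𝔪) = ENNReal.ofReal (unitDensity 𝔪) := by
  rw [unitRatio, unitDensity, ENNReal.ofReal_div_of_pos (by exact_mod_cast Nat.card_pos),
    ENNReal.ofReal_natCast, ENNReal.ofReal_natCast]

variable [NumberField K]

variable (𝔪 : Ideal (𝓞 K))

/-- The homomorphism `ℤ/Nℤ → 𝓞 K ⧸ 𝔪`, where `N` is the norm of `𝔪`. -/
noncomputable def zmodHom : ZMod (Ideal.absNorm 𝔪) →+* 𝓞 K ⧸ 𝔪 :=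
  ZMod.castHom ((ringChar.spec (𝓞 K ⧸ 𝔪) _).1
    (by rw [← map_natCast (Ideal.Quotient.mk 𝔪)]
        exact Ideal.Quotient.eq_zero_iff_mem.2 (Ideal.absNorm_mem 𝔪))) (𝓞 K ⧸ 𝔪)

variable {𝔪}

/-- Extension of a family by zero. -/
def extend {M : Type*} [Zero M] (f : Fin d → M) (k : ℕ) : M := if h : k < d then f ⟨k, h⟩ else 0

theorem extend_of_lt {M : Type*} [Zero M] (f : Fin d → M) {k : ℕ} (h : k < d) :
    extend f k = f ⟨k, h⟩ := dif_pos h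

@[simp] theorem extend_coe {M : Type*} [Zero M] (f : Fin d → M) (i : Fin d) :
    extend f i = f i := dif_pos i.2

theorem combo_extend (α : Fin d → 𝓞 K) (z : ℕ → ℤ) :
    combo (zmodHom 𝔪) (extend fun i => Ideal.Quotient.mk 𝔪 (α i)) d
      (fun k => (z k : ZMod (Ideal.absNorm 𝔪))) = Ideal.Quotient.mk 𝔪 (∑ i : Fin d, z i • α i) := by
  rw [combo, Finset.sum_range, map_sum]
  refine Finset.sum_congr rfl fun i _ => ?_
  rw [extend_coe, map_intCast, zsmul_eq_mul, map_mul, map_intCast]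

/-- The residue ring with the coordinates given by a basis `ω` of `𝓞 K` such that the `n i * ω i`
form a basis of `𝔪`. -/
noncomputable def quotientCoordinates (ω : Module.Basis (Fin d) ℤ (𝓞 K)) (n : Fin d → ℕ)
    (ν : Module.Basis (Fin d) ℤ 𝔪) (hn : ∀ i, 1 ≤ n i)
    (hν : ∀ i, (ν i : 𝓞 K) = (n i : ℤ) • ω i) :
    Coordinates (Ideal.absNorm 𝔪) d (𝓞 K ⧸ 𝔪) where
  φ := zmodHom 𝔪
  w := extend fun i => Ideal.Quotient.mk 𝔪 (ω i)
  n := extend n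
  Γ i j k := if h : i < d ∧ j < d ∧ k < d then
    ω.repr (ω ⟨i, h.1⟩ * ω ⟨j, h.2.1⟩) ⟨k, h.2.2⟩ else 0
  co x := extend (coords ω n 𝔪 x)
  mul_w i hi j hj := by
    rw [combo_extend, extend_of_lt _ hi, extend_of_lt _ hj, ← map_mul]
    congr 1
    rw [← ω.sum_repr (ω ⟨i, hi⟩ * ω ⟨j, hj⟩)]
    exact Finset.sum_congr rfl fun k _ => by rw [dif_pos ⟨hi, hj, k.2⟩]
  surj r := by
    obtain ⟨a, rfl⟩ := Ideal.Quotient.mk_surjective r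
    refine ⟨_, (combo_extend (fun i => ω i) (extend fun i => ω.repr a i)).trans ?_⟩
    simp only [extend_coe, ω.sum_repr]
  n_pos k hk := by rw [extend_of_lt _ hk]; exact hn _
  n_dvd k hk := by
    rw [extend_of_lt _ hk]
    have h := (mem_iff_dvd_repr hν ((Ideal.absNorm 𝔪 : ℤ) • ω ⟨k, hk⟩)).1 (by
      rw [zsmul_eq_mul, Int.cast_natCast]
      exact Ideal.mul_mem_right _ _ (Ideal.absNorm_mem 𝔪)) ⟨k, hk⟩
    rw [map_zsmul, Finsupp.smul_apply, ω.repr_self, Finsupp.single_eq_same, smul_eq_mul,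
      mul_one] at h
    exact_mod_cast h
  eq_zero_iff z := by
    rw [combo_extend, Ideal.Quotient.eq_zero_iff_mem, mem_iff_dvd_repr hν]
    simp only [Module.Basis.repr_sum_self]
    exact ⟨fun h k hk => by rw [extend_of_lt _ hk]; exact h ⟨k, hk⟩,
      fun h i => by rw [← extend_coe n i]; exact h i i.2⟩
  co_eq z k hk := by
    rw [combo_extend, extend_of_lt _ hk, extend_of_lt _ hk, coords_mk ω n 𝔪 ν hν,
      Module.Basis.repr_sum_self]

section

variable {ω : Module.Basis (Fin d) ℤ (𝓞 K)} {n : Fin d → ℕ} {ν : Module.Basis (Fin d) ℤ 𝔪}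
  (hn : ∀ i, 1 ≤ n i) (hν : ∀ i, (ν i : 𝓞 K) = (n i : ℤ) • ω i) {r : ℕ} (X : Fin r → Fin d → ℤ)

theorem describes_initialStore :
    Describes (quotientCoordinates ω n ν hn hν) (initialStore ω n (Ideal.absNorm 𝔪) X) where
  dim := rfl
  modulus := rfl
  diag k hk := by simp [initialStore, quotientCoordinates, extend, hk]
  struct _ _ _ _ _ _ := rfl

theorem eltRow_initialStore {t : ℕ} (ht : t < r) :
    eltRow (quotientCoordinates ω n ν hn hν) (initialStore ω n (Ideal.absNorm 𝔪) X) .input t =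
      Ideal.Quotient.mk 𝔪 (∑ i, X ⟨t, ht⟩ i • ω i) := by
  have h := combo_extend (𝔪 := 𝔪) (fun i => ω i) (extend (X ⟨t, ht⟩))
  simp only [extend_coe] at h
  rw [← h]
  refine Coordinates.elt_congr _ fun k hk => ?_
  simp [mat, initialStore, ht, hk, extend]

/-- Modulo `𝔪`, the ideal `𝔞` consists of the combinations of its generators with coefficients in
`ℤ/Nℤ`. -/
theorem combo_input_iff {𝔞 : Ideal (𝓞 K)} {α : Fin d → 𝓞 K}
    (hα : Submodule.span ℤ (Set.range α) = 𝔞.restrictScalars ℤ) (y : 𝓞 K ⧸ 𝔪) :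
    (∃ x, combo (quotientCoordinates ω n ν hn hν).φ (eltRow (quotientCoordinates ω n ν hn hν)
      (initialStore ω n (Ideal.absNorm 𝔪) fun i j => ω.repr (α i) j) .input) d x = y) ↔
      y ∈ 𝔞.map (Ideal.Quotient.mk 𝔪) := by
  have hrow : ∀ x, combo (quotientCoordinates ω n ν hn hν).φ
      (eltRow (quotientCoordinates ω n ν hn hν)
        (initialStore ω n (Ideal.absNorm 𝔪) fun i j => ω.repr (α i) j) .input) d x =
      combo (zmodHom 𝔪) (extend fun i => Ideal.Quotient.mk 𝔪 (α i)) d x := fun x => by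
    refine Finset.sum_congr rfl fun i hi => ?_
    rw [eltRow_initialStore hn hν _ (Finset.mem_range.1 hi), ω.sum_repr,
      extend_of_lt _ (Finset.mem_range.1 hi)]
    rfl
  simp only [hrow]
  constructor
  · rintro ⟨x, rfl⟩
    refine Ideal.sum_mem _ fun i hi => Ideal.mul_mem_left _ _ ?_
    rw [extend_of_lt _ (Finset.mem_range.1 hi)]
    refine Ideal.mem_map_of_mem _ ?_
    have : α ⟨i, Finset.mem_range.1 hi⟩ ∈ 𝔞.restrictScalars ℤ :=
      hα ▸ Submodule.subset_span ⟨_, rfl⟩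
    exact this
  · intro hy
    obtain ⟨a, ha, rfl⟩ := (Ideal.mem_map_iff_of_surjective _ Ideal.Quotient.mk_surjective).1 hy
    have ha' : a ∈ Submodule.span ℤ (Set.range α) := by rw [hα]; exact ha
    obtain ⟨c, rfl⟩ := (Submodule.mem_span_range_iff_exists_fun ℤ).1 ha'
    refine ⟨_, (combo_extend α (extend c)).trans ?_⟩
    simp only [extend_coe]

end

/-! ### Ideals of residue rings -/

/-- An ideal of a Dedekind domain that contains `𝔪 ≠ 0` is generated by `𝔪` and one more element. -/
theorem isPrincipalIdealRing_quotient (h𝔪 : 𝔪 ≠ ⊥) : IsPrincipalIdealRing (𝓞 K ⧸ 𝔪) where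
  principal I := by
    obtain ⟨a, ha⟩ := IsDedekindDomain.exists_sup_span_eq
      (show 𝔪 ≤ I.comap (Ideal.Quotient.mk 𝔪) from
        Ideal.mk_ker.symm.trans_le (Ideal.ker_le_comap _))
      h𝔪
    refine ⟨Ideal.Quotient.mk 𝔪 a, ?_⟩
    have h := congrArg (Ideal.map (Ideal.Quotient.mk 𝔪)) ha
    rw [Ideal.map_comap_of_surjective _ Ideal.Quotient.mk_surjective, Ideal.map_sup,
      Ideal.map_quotient_self, bot_sup_eq, Ideal.map_span, Set.image_singleton] at h
    exact h.symm

/-- The comparison of norms that Euclidean division requires. A strict inclusion of ideals suffices,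
because a divisor of a non-zero ideal that has the same norm is equal to it. -/
theorem residueNorm_lt (h𝔪 : 𝔪 ≠ ⊥) {b r : 𝓞 K ⧸ 𝔪} (h : Ideal.span {b} < Ideal.span {r}) :
    residueNorm 𝔪 r < residueNorm 𝔪 b := by
  have hlt : (Ideal.span {b}).comap (Ideal.Quotient.mk 𝔪) <
      (Ideal.span {r}).comap (Ideal.Quotient.mk 𝔪) := by
    refine lt_of_le_of_ne (Ideal.comap_mono h.le) fun heq => h.ne ?_
    exact Ideal.comap_injective_of_surjective _ Ideal.Quotient.mk_surjective heq
  have hne : ∀ x : 𝓞 K ⧸ 𝔪, residueNorm 𝔪 x ≠ 0 := fun x => by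
    rw [residueNorm, Ne, Ideal.absNorm_eq_zero_iff]
    exact ne_bot_of_le_ne_bot h𝔪 (Ideal.mk_ker.symm.trans_le (Ideal.ker_le_comap _))
  refine lt_of_le_of_ne (Nat.le_of_dvd (Nat.pos_of_ne_zero (hne b))
    (Ideal.absNorm_dvd_absNorm_of_le hlt.le)) fun heq => hlt.ne ?_
  obtain ⟨L, hL⟩ := Ideal.dvd_iff_le.2 hlt.le
  have h1 : residueNorm 𝔪 b = residueNorm 𝔪 r * Ideal.absNorm L := by
    rw [residueNorm, hL, map_mul, residueNorm]
  have h2 : Ideal.absNorm L = 1 :=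
    Nat.eq_of_mul_eq_mul_left (Nat.pos_of_ne_zero (hne r)) (by rw [← h1, heq, mul_one])
  rw [hL, Ideal.absNorm_eq_one_iff.1 h2, Ideal.mul_top]

/-! ### From runs of programs to the operations -/

/-- The passage from runs to Las Vegas computations, and from cost bounds in `ℝ≥0∞` to real ones. -/
theorem performs_of_runs [Finite (𝓞 K ⧸ 𝔪)] {ops : (k : ℕ) → BasicOps k}
    {ω : Module.Basis (Fin d) ℤ (𝓞 K)} {n : Fin d → ℕ} {ν : Module.Basis (Fin d) ℤ 𝔪}
    (hn : ∀ i, 1 ≤ n i) (hν : ∀ i, (ν i : 𝓞 K) = (n i : ℤ) • ω i) (hd : 1 ≤ d)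
    {B : ℕ → ℝ≥0∞ → ℝ≥0∞} {C : ℕ} (hB : ∀ d p, 1 ≤ d → p ≤ 1 → B d p ≤ C * (d ^ 3 / p))
    {C' : ℝ} (hC : (C : ℝ) ≤ C') {P : Cmd} {r r' : ℕ} {X : Fin r → Fin d → ℤ}
    {Post Post' : (Fin r' → 𝓞 K ⧸ 𝔪) → Prop}
    (h : P.Runs (Ideal.absNorm 𝔪) ops (initialStore ω n (Ideal.absNorm 𝔪) X)
      (Returns (quotientCoordinates ω n ν hn hν) Post) (B d (unitRatio (𝓞 K ⧸ 𝔪))))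
    (hP : ∀ c, Post c → Post' c) :
    Performs C' ops ω n 𝔪 P X Post' := by
  have hpos : 0 < unitDensity 𝔪 := by
    have := unitRatio_ne_zero (R := 𝓞 K ⧸ 𝔪)
    rwa [unitRatio_eq_ofReal, Ne, ENNReal.ofReal_eq_zero, not_le] at this
  refine (h.mono (fun s => ?_) ((hB _ _ hd unitRatio_le_one).trans ?_)).lasVegas
    ENNReal.ofReal_ne_top
  · rintro ⟨c, hc, hs⟩
    exact ⟨c, hP c hc, fun t i => (hs t i i.2).trans (extend_coe _ _)⟩
  · rw [unitRatio_eq_ofReal]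
    have h1 : (C : ℝ≥0∞) * (d ^ 3 / ENNReal.ofReal (unitDensity 𝔪)) =
        ENNReal.ofReal (C * ((d : ℝ) ^ 3 / unitDensity 𝔪)) := by
      rw [ENNReal.ofReal_mul (by positivity), ENNReal.ofReal_div_of_pos hpos,
        ENNReal.ofReal_pow (by positivity), ENNReal.ofReal_natCast, ENNReal.ofReal_natCast]
    rw [h1]
    refine ENNReal.ofReal_le_ofReal ?_
    calc (C : ℝ) * ((d : ℝ) ^ 3 / unitDensity 𝔪) ≤ C' * ((d : ℝ) ^ 3 / unitDensity 𝔪) := by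
          gcongr
      _ = C' * (1 / unitDensity 𝔪) * (d : ℝ) ^ 3 := by ring

end NumberField

theorem mainTheorem9 :
    ∃ (C : ℝ) (pAdd pSub pMul pDiv pEudiv pXgcd pAnn pGen : Cmd),
      ∀ (ops : (k : ℕ) → BasicOps k)
        (K : Type*) [Field K] [NumberField K]
        (𝔪 : Ideal (𝓞 K))
        (ω : Module.Basis (Fin (Module.finrank ℚ K)) ℤ (𝓞 K))
        (ν : Module.Basis (Fin (Module.finrank ℚ K)) ℤ 𝔪)
        (n : Fin (Module.finrank ℚ K) → ℕ),
        𝔪 ≠ ⊥ → (∀ i, 1 ≤ n i) → (∀ i, (ν i : 𝓞 K) = (n i : ℤ) • ω i) →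
          (∀ a b : 𝓞 K ⧸ 𝔪,
            Performs C ops ω n 𝔪 pAdd ![coords ω n 𝔪 a, coords ω n 𝔪 b]
              (fun c : Fin 1 → 𝓞 K ⧸ 𝔪 => c 0 = a + b)) ∧
          (∀ a b : 𝓞 K ⧸ 𝔪,
            Performs C ops ω n 𝔪 pSub ![coords ω n 𝔪 a, coords ω n 𝔪 b]
              (fun c : Fin 1 → 𝓞 K ⧸ 𝔪 => c 0 = a - b)) ∧
          (∀ a b : 𝓞 K ⧸ 𝔪,
            Performs C ops ω n 𝔪 pMul ![coords ω n 𝔪 a, coords ω n 𝔪 b]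
              (fun c : Fin 1 → 𝓞 K ⧸ 𝔪 => c 0 = a * b)) ∧
          (∀ a b : 𝓞 K ⧸ 𝔪, b ∣ a →
            Performs C ops ω n 𝔪 pDiv ![coords ω n 𝔪 a, coords ω n 𝔪 b]
              (fun c : Fin 1 → 𝓞 K ⧸ 𝔪 => IsDivResult a b (c 0))) ∧
          (∀ a b : 𝓞 K ⧸ 𝔪, b ≠ 0 →
            Performs C ops ω n 𝔪 pEudiv ![coords ω n 𝔪 a, coords ω n 𝔪 b]
              (fun c : Fin 2 → 𝓞 K ⧸ 𝔪 => IsEudivResult (residueNorm 𝔪) a b (c 0) (c 1))) ∧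
          (∀ a b : 𝓞 K ⧸ 𝔪,
            Performs C ops ω n 𝔪 pXgcd ![coords ω n 𝔪 a, coords ω n 𝔪 b]
              (fun c : Fin 5 → 𝓞 K ⧸ 𝔪 => IsXgcdResult a b (c 0) (c 1) (c 2) (c 3) (c 4))) ∧
          (∀ a : 𝓞 K ⧸ 𝔪,
            Performs C ops ω n 𝔪 pAnn ![coords ω n 𝔪 a]
              (fun c : Fin 1 → 𝓞 K ⧸ 𝔪 => IsAnnResult a (c 0))) ∧
          (∀ (𝔞 : Ideal (𝓞 K)) (α : Fin (Module.finrank ℚ K) → 𝓞 K),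
            Submodule.span ℤ (Set.range α) = 𝔞.restrictScalars ℤ →
            Performs C ops ω n 𝔪 pGen (fun i j => ω.repr (α i) j)
              (fun c : Fin 1 → 𝓞 K ⧸ 𝔪 =>
                Ideal.span {c 0} = 𝔞.map (Ideal.Quotient.mk 𝔪))) := by
  -- The expected cost of each program is cubic.
  have hc (c : Cmd) (h : c.depth ≤ 3) : IsCubic fun d _ => c.cost d := isCubic_cost h
  have hOut := isCubic_searchCost.add (hc (writeOut 0 ⟨arrE, [.var 18]⟩) (by decide))
  obtain ⟨C₁, h₁⟩ := hc progAdd (by decide)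
  obtain ⟨C₂, h₂⟩ := hc progSub (by decide)
  obtain ⟨C₃, h₃⟩ := hc progMul (by decide)
  obtain ⟨C₄, h₄⟩ := hc progDiv (by decide)
  obtain ⟨C₅, h₅⟩ := (hc eudivTest (by decide)).add (isCubic_one.add
    ((hc eudivExact (by decide)).add ((hc loadB (by decide)).add (isCubic_searchCost.add (hc eudivEnd (by decide))))))
  obtain ⟨C₆, h₆⟩ := (hc unitStart (by decide)).add (isCubic_searchCost.add
    ((hc unitEnd (by decide)).add (isCubic_searchCost.add (hc xgcdEnd (by decide)))))
  obtain ⟨C₇, h₇⟩ := (hc annStart (by decide)).add hOut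
  obtain ⟨C₈, h₈⟩ := (hc genStart (by decide)).add hOut
  have hC : ∀ i : Fin 8, ((![C₁, C₂, C₃, C₄, C₅, C₆, C₇, C₈] i : ℕ) : ℝ) ≤
      ((∑ i, ![C₁, C₂, C₃, C₄, C₅, C₆, C₇, C₈] i : ℕ) : ℝ) := fun i =>
    Nat.cast_le.2 (Finset.single_le_sum (fun _ _ => Nat.zero_le _) (Finset.mem_univ i))
  refine ⟨(∑ i, ![C₁, C₂, C₃, C₄, C₅, C₆, C₇, C₈] i : ℕ), progAdd, progSub, progMul, progDiv,
    progEudiv, progXgcd, progAnn, progGen, ?_⟩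
  intro ops K _ _ 𝔪 ω ν n h𝔪 hn hν
  have : NeZero (Ideal.absNorm 𝔪) := ⟨by rwa [Ne, Ideal.absNorm_eq_zero_iff]⟩
  have : Finite (𝓞 K ⧸ 𝔪) := Ideal.finiteQuotientOfFreeOfNeBot 𝔪 h𝔪
  have := isPrincipalIdealRing_quotient h𝔪
  have hd : 1 ≤ Module.finrank ℚ K := Module.finrank_pos
  have hD {r : ℕ} (X : Fin r → Fin (Module.finrank ℚ K) → ℤ) :=
    describes_initialStore hn hν X
  have hrow {r : ℕ} (X : Fin r → Fin (Module.finrank ℚ K) → ℤ) {t : ℕ} (ht : t < r)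
      {a : 𝓞 K ⧸ 𝔪} (ha : X ⟨t, ht⟩ = coords ω n 𝔪 a) :
      eltRow (quotientCoordinates ω n ν hn hν) (initialStore ω n (Ideal.absNorm 𝔪) X) .input t =
        a := by
    rw [eltRow_initialStore hn hν X ht, ha, mk_sum_coords hν]
  have hr₀ (a b : 𝓞 K ⧸ 𝔪) :=
    hrow ![coords ω n 𝔪 a, coords ω n 𝔪 b] (t := 0) (by norm_num) rfl
  have hr₁ (a b : 𝓞 K ⧸ 𝔪) :=
    hrow ![coords ω n 𝔪 a, coords ω n 𝔪 b] (t := 1) (by norm_num) rfl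
  refine ⟨fun a b => ?_, fun a b => ?_, fun a b => ?_, fun a b hab => ?_, fun a b hb => ?_,
    fun a b => ?_, fun a => ?_, fun 𝔞 α hα => ?_⟩
  · refine performs_of_runs hn hν hd h₁ (hC 0) (Cmd.Runs.mono ((progAdd_wp (hD _) (hr₀ a b)
      (hr₁ a b)).runs_ready ?_ (hD _)) (fun s hs => Returns.one (Post := (· = a + b)) rfl hs.2)
      le_rfl) fun c hc => hc
    simp [progAdd, writeSum, Cmd.Bounded, Instr.vars]
  · refine performs_of_runs hn hν hd h₂ (hC 1) (Cmd.Runs.mono ((progSub_wp (hD _) (hr₀ a b)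
      (hr₁ a b)).runs_ready ?_ (hD _)) (fun s hs => Returns.one (Post := (· = a - b)) rfl hs.2)
      le_rfl) fun c hc => hc
    simp [progSub, writeDiff, Cmd.Bounded, Instr.vars]
  · refine performs_of_runs hn hν hd h₃ (hC 2) (Cmd.Runs.mono ((progMul_wp (hD _) (hr₀ a b)
      (hr₁ a b)).runs_ready ?_ (hD _)) (fun s hs => Returns.one (Post := (· = a * b)) rfl hs.2)
      le_rfl) fun c hc => hc
    simp [progMul, divisor, scaling, loadVec, prepare, mulMatrix, howell, clearT, loadRow,
      insertVec, insertStep, loadAnn, loadG, zeroB, combine, writeOut, writeSum, Cmd.Bounded,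
      Instr.vars]
  · refine performs_of_runs hn hν hd h₄ (hC 3) (Cmd.Runs.mono ((progDiv_wp (hD _) (hr₀ a b)
      (hr₁ a b) hab).runs_ready ?_ (hD _)) (fun s hs => Exists.elim hs.2 fun c hc =>
        Returns.one (Post := IsDivResult a b) hc.1 hc.2) le_rfl) fun c hc => hc
    simp [progDiv, divisor, scaling, loadVec, prepare, mulMatrix, howell, clearT, loadRow,
      insertVec, insertStep, loadAnn, loadG, reduce, writeNeg, writeDiff, Cmd.Bounded, Instr.vars]
  · exact performs_of_runs hn hν hd h₅ (hC 4) (progEudiv_runs (hD _) (hr₀ a b) (hr₁ a b))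
      fun c hc => ⟨hc.1, hc.2.imp_right (residueNorm_lt h𝔪)⟩
  · exact performs_of_runs hn hν hd h₆ (hC 5) (progXgcd_runs (hD _) (hr₀ a b) (hr₁ a b))
      fun c hc => hc
  · exact performs_of_runs hn hν hd h₇ (hC 6) (progAnn_runs (hD _)
      (hrow ![coords ω n 𝔪 a] (t := 0) (by norm_num) rfl)) fun c hc => hc
  · exact performs_of_runs hn hν hd h₈ (hC 7) (progGen_runs (hD _) (combo_input_iff hn hν hα))
      fun c hc => hc
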